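/- Work in standard homotopy type theory (intensional Martin-Löf type theory with a cumulative hierarchy of universes $\mathcal U_0:\mathcal U_1:\cdots$, function extensionality, univalence, and higher inductive types). For a type $A$ let the free $\infty$-group $\mathbf F(A)$ be the higher inductive type with constructors \[ \begin{aligned} &\mathsf{unit}:\mathbf F(A),\qquad \mathsf{cons},\ \mathsf{icons}: A\to \mathbf F(A)\to \mathbf F(A),\\ &\mu_1:(a:A)\to(x:\mathbf F(A))\to \mathsf{icons}_a(\mathsf{cons}_a(x))=x,\\ &\mu_2:(a:A)\to(x:\mathbf F(A))\to \mathsf{cons}_a(\mathsf{icons}_a(x))=x,\\ &\mu:(a:A)\to(x:\mathbf F(A))\to \mathsf{ap}_{\mathsf{cons}_a}(\mu_1(a,x))=\mu_2(a,\mathsf{cons}_a(x)), \end{aligned} \] so that each $\mathsf{cons}_a$ is a half-adjoint equivalence. Let $\hat A = A+A$ be the type of signed elements of $A$, with $\bar a$ denoting $a$ with its sign changed, and write $xy$ for the concatenation of lists $x,y:\mathsf{List}(\hat A)$. Let the non-recursive approximation $\mathbf N(A)$ be the higher inductive type with constructors \[ \begin{aligned} &\eta:\mathsf{List}(\hat A)\to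 \mathbf N(A),\\ &\tau:(x:\mathsf{List}(\hat A))\to(a:\hat A)\to(y:\mathsf{List}(\hat A))\to \eta(xa\bar a y)=\eta(xy),\\ &\mathsf{sw}:(x:\mathsf{List}(\hat A))\to(a:\hat A)\to(y:\mathsf{List}(\hat A))\to(b:\hat A)\to(z:\mathsf{List}(\hat A))\\ &\qquad\to \tau(x,a,yb\bar bz)\cdot\tau(xy,b,z)=\tau(xa\bar ay,b,z)\cdot\tau(x,a,yz),\\ &\mathsf{ov}:(x:\mathsf{List}(\hat A))\to(a:\hat A)\to(y:\mathsf{List}(\hat A))\to \tau(x,a,ay)=\tau(xa,\bar a,y),\\ &\mathsf{tr}:\mathbf N(A)\text{ is a }1\text{-type}, \end{aligned} \] where the canonical identifications $(xy)z=x(yz)$ and $\bar{\bar a}=a$ are left implicit in $\mathsf{sw}$ and $\mathsf{ov}$. Then, for every set $A$ (in any universe $\mathcal U_i$), the $1$-truncation of $\mathbf F(A)$ is equivalent to $\mathbf N(A)$: \[ \|\mathbf F(A)\|_1\simeq \mathbf N(A). \] That is, for every $i$ the closed type $(A:\mathcal U_i)\to \mathsf{isset}(A)\to \bigl(\|\mathbf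 F(A)\|_1\simeq \mathbf N(A)\bigr)$ is inhabited by a closed term of this type theory. -/

import Mathlib

/-!
Homotopy type theory as a formal system: raw terms, conversion and typing for intensional
Martin-Löf type theory with a cumulative hierarchy of Russell universes, function
extensionality, univalence, the usual inductive types, truncations, and the two higher inductive
types `free` (the free ∞-group) and `approx` (its non-recursive approximation).

Term-level equality in the object theory is the identity type `Const.id`, never Lean's `=`.
-/

namespace BookHoTT

/-! ### Raw syntax -/

/-- The primitive constants.  Parameters are explicit arguments, as in `refl A x`. -/
inductive Const : Type
  -- dependent sums, coproducts, empty type, unit type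
  | sigma | pair | sigmaInd
  | sum | inl | inr | sumInd
  | empty | emptyInd
  | unit | star | unitInd
  -- natural numbers, lists, W-types
  | nat | zero | succ | natInd
  | list | nil | cons | listInd
  | wtype | sup | wInd
  -- identity types; function extensionality; univalence
  | id | refl | idInd
  | funext | univalence
  -- `trunc n` is the truncation `‖-‖` to `(n - 1)`-types (`0`: propositions, `1`: sets, ...)
  | trunc (n : ℕ) | truncMk (n : ℕ) | truncIs (n : ℕ) | truncInd (n : ℕ)
  -- the free ∞-group
  | free | fUnit | fCons | fICons | fMu1 | fMu2 | fMu
  | freeInd | freeIndMu1 | freeIndMu2 | freeIndMu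
  -- the non-recursive approximation
  | approx | aEta | aTau | aSw | aOv | aTr
  | approxInd | approxIndTau
  deriving DecidableEq

/-- Raw terms, with de Bruijn indices. -/
inductive Tm : Type
  | var (n : ℕ)
  | univ (i : ℕ)
  | pi (A B : Tm)
  | lam (t : Tm)
  | app (f a : Tm)
  | con (k : Const)
  deriving DecidableEq

namespace Tm

/-- Extension of a renaming under a binder. -/
def upRen (ρ : ℕ → ℕ) : ℕ → ℕ
  | 0 => 0
  | n + 1 => ρ n + 1

def rename (ρ : ℕ → ℕ) : Tm → Tm
  | var n => var (ρ n)
  | univ i => univ i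
  | pi A B => pi (rename ρ A) (rename (upRen ρ) B)
  | lam t => lam (rename (upRen ρ) t)
  | app f a => app (rename ρ f) (rename ρ a)
  | con k => con k

/-- Weakening by one variable. -/
def lift (t : Tm) : Tm := rename Nat.succ t

/-- Extension of a substitution under a binder. -/
def upSub (σ : ℕ → Tm) : ℕ → Tm
  | 0 => var 0
  | n + 1 => lift (σ n)

def subst (σ : ℕ → Tm) : Tm → Tm
  | var n => σ n
  | univ i => univ i
  | pi A B => pi (subst σ A) (subst (upSub σ) B)
  | lam t => lam (subst (upSub σ) t)
  | app f a => app (subst σ f) (subst σ a)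
  | con k => con k

/-- The substitution that sends the variable `0` to `a` and lowers all others by one. -/
def single (a : Tm) : ℕ → Tm
  | 0 => a
  | n + 1 => var n

/-- `t.inst a` is `t[a/x]`, for `x` the variable `0`. -/
def inst (t a : Tm) : Tm := subst (single a) t

/-- Iterated application. -/
def apps (f : Tm) (as : List Tm) : Tm := as.foldl app f

end Tm

/-! ### Convertibility

The congruence generated by `β`, `η` for functions, and the computation rules of the eliminators
on point constructors. -/

open Tm in
inductive Conv : Tm → Tm → Prop
  | refl (t) : Conv t t
  | symm {t u} : Conv t u → Conv u t
  | trans {t u v} : Conv t u → Conv u v → Conv t v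
  | pi {A A' B B'} : Conv A A' → Conv B B' → Conv (.pi A B) (.pi A' B')
  | lam {t t'} : Conv t t' → Conv (.lam t) (.lam t')
  | app {f f' a a'} : Conv f f' → Conv a a' → Conv (.app f a) (.app f' a')
  | beta (t a) : Conv (.app (.lam t) a) (t.inst a)
  | eta (f) : Conv (.lam (.app f.lift (.var 0))) f
  | sigma (A B C f A' B' a b) :
      Conv (apps (con .sigmaInd) [A, B, C, f, apps (con .pair) [A', B', a, b]])
        (apps f [a, b])
  | inl (A B C f g A' B' a) :
      Conv (apps (con .sumInd) [A, B, C, f, g, apps (con .inl) [A', B', a]]) (.app f a)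
  | inr (A B C f g A' B' b) :
      Conv (apps (con .sumInd) [A, B, C, f, g, apps (con .inr) [A', B', b]]) (.app g b)
  | unit (C c) : Conv (apps (con .unitInd) [C, c, con .star]) c
  | zero (C z s) : Conv (apps (con .natInd) [C, z, s, con .zero]) z
  | succ (C z s n) :
      Conv (apps (con .natInd) [C, z, s, .app (con .succ) n])
        (apps s [n, apps (con .natInd) [C, z, s, n]])
  | nil (A C z s A') :
      Conv (apps (con .listInd) [A, C, z, s, .app (con .nil) A']) z
  | cons (A C z s A' a l) :
      Conv (apps (con .listInd) [A, C, z, s, apps (con .cons) [A', a, l]])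
        (apps s [a, l, apps (con .listInd) [A, C, z, s, l]])
  | sup (A B C g A' B' a f) :
      Conv (apps (con .wInd) [A, B, C, g, apps (con .sup) [A', B', a, f]])
        (apps g [a, f, .lam (apps (con .wInd)
          [A.lift, B.lift, C.lift, g.lift, .app f.lift (.var 0)])])
  | id (A C c x y A' z) :
      Conv (apps (con .idInd) [A, C, c, x, y, apps (con .refl) [A', z]]) (.app c z)
  | trunc (n X P h f X' x) :
      Conv (apps (con (.truncInd n)) [X, P, h, f, apps (con (.truncMk n)) [X', x]]) (.app f x)
  | fUnit (A P u c i m₁ m₂ m A') :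
      Conv (apps (con .freeInd) [A, P, u, c, i, m₁, m₂, m, .app (con .fUnit) A']) u
  | fCons (A P u c i m₁ m₂ m A' a x) :
      Conv (apps (con .freeInd) [A, P, u, c, i, m₁, m₂, m, apps (con .fCons) [A', a, x]])
        (apps c [a, x, apps (con .freeInd) [A, P, u, c, i, m₁, m₂, m, x]])
  | fICons (A P u c i m₁ m₂ m A' a x) :
      Conv (apps (con .freeInd) [A, P, u, c, i, m₁, m₂, m, apps (con .fICons) [A', a, x]])
        (apps i [a, x, apps (con .freeInd) [A, P, u, c, i, m₁, m₂, m, x]])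
  | aEta (A P h e t s o A' l) :
      Conv (apps (con .approxInd) [A, P, h, e, t, s, o, apps (con .aEta) [A', l]]) (.app e l)

/-! ### Writing object-level terms with named variables

An `Expr` is a term together with its dependence on the length of the ambient context; this
turns Lean's `fun x ↦ …` into de Bruijn binders. -/

structure Expr where
  atDepth : ℕ → Tm

namespace Expr

/-- The closed term described by an expression. -/
def toTm (e : Expr) : Tm := e.atDepth 0

def app (f a : Expr) : Expr := ⟨fun d ↦ .app (f.atDepth d) (a.atDepth d)⟩

instance : CoeFun Expr (fun _ ↦ Expr → Expr) := ⟨app⟩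

/-- The variable bound at depth `d`. -/
def bound (d : ℕ) : Expr := ⟨fun d' ↦ .var (d' - (d + 1))⟩

def pi (A : Expr) (B : Expr → Expr) : Expr :=
  ⟨fun d ↦ .pi (A.atDepth d) ((B (bound d)).atDepth (d + 1))⟩

def lam (t : Expr → Expr) : Expr := ⟨fun d ↦ .lam ((t (bound d)).atDepth (d + 1))⟩

def univ (i : ℕ) : Expr := ⟨fun _ ↦ .univ i⟩

def k (c : Const) : Expr := ⟨fun _ ↦ .con c⟩

/-- Non-dependent function types. -/
def arr (A B : Expr) : Expr := pi A fun _ ↦ B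

infixr:25 " ⇒ " => arr

/-! #### Paths -/

/-- The identity type `x =_A y`. -/
def eq (A x y : Expr) : Expr := k .id A x y

def refl (A x : Expr) : Expr := k .refl A x

/-- `transport` in the family `P` over `A`, along `p : x = y`. -/
def transport (A P x y p u : Expr) : Expr :=
  k .idInd A (lam fun x ↦ lam fun y ↦ lam fun _ ↦ P x ⇒ P y) (lam fun _ ↦ lam fun u ↦ u) x y p u

/-- The composite of `p : x = y` and `q : y = z`. -/
def concat (A x y z p q : Expr) : Expr :=
  k .idInd A (lam fun x ↦ lam fun y ↦ lam fun _ ↦ pi A fun z ↦ eq A y z ⇒ eq A x z)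
    (lam fun _ ↦ lam fun _ ↦ lam fun q ↦ q) x y p z q

/-- The inverse of `p : x = y`. -/
def inverse (A x y p : Expr) : Expr :=
  k .idInd A (lam fun x ↦ lam fun y ↦ lam fun _ ↦ eq A y x) (lam fun x ↦ refl A x) x y p

/-- `ap f p : f x = f y` for `f : A → B` and `p : x = y`. -/
def ap (A B f x y p : Expr) : Expr :=
  k .idInd A (lam fun x ↦ lam fun y ↦ lam fun _ ↦ eq B (f x) (f y)) (lam fun x ↦ refl B (f x))
    x y p

/-- The type of paths from `u : P x` to `v : P y` over `p : x = y`. -/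
def pathOver (A P x y p u v : Expr) : Expr := eq (P y) (transport A P x y p u) v

/-- `apd f p`, a path from `f x` to `f y` over `p`, for a dependent function `f`. -/
def apd (A P f x y p : Expr) : Expr :=
  k .idInd A (lam fun x ↦ lam fun y ↦ lam fun p ↦ pathOver A P x y p (f x) (f y))
    (lam fun x ↦ refl (P x) (f x)) x y p

/-- Composition of `wp`, a path from `u` to `v` over `p : x = y`, with `wq`, a path from `v` to
`w` over `q : y = z`; the result lies over the composite of `p` and `q`. -/
def concatOver (A P x y z p q u v w wp wq : Expr) : Expr :=
  k .idInd A
    (lam fun x ↦ lam fun y ↦ lam fun p ↦ pi A fun z ↦ pi (eq A y z) fun q ↦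
      pi (P x) fun u ↦ pi (P y) fun v ↦ pi (P z) fun w ↦
        pathOver A P x y p u v ⇒ pathOver A P y z q v w ⇒
          pathOver A P x z (concat A x y z p q) u w)
    (lam fun x ↦ lam fun z ↦ lam fun q ↦ lam fun u ↦ lam fun v ↦ lam fun w ↦
      lam fun wp ↦ lam fun wq ↦
        k .idInd (P x)
          (lam fun u ↦ lam fun v ↦ lam fun _ ↦ pi (P z) fun w ↦
            pathOver A P x z q v w ⇒ pathOver A P x z q u w)
          (lam fun _ ↦ lam fun _ ↦ lam fun wq ↦ wq) u v wp w wq)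
    x y p z q u v w wp wq

/-- The action of `g : A → A` and `G : (x : A) → P x → P (g x)` on `w`, a path from `u` to `v`
over `p : x = y`: a path from `G x u` to `G y v` over `ap g p`. -/
def apOver (A P g G x y p u v w : Expr) : Expr :=
  k .idInd A
    (lam fun x ↦ lam fun y ↦ lam fun p ↦ pi (P x) fun u ↦ pi (P y) fun v ↦
      pathOver A P x y p u v ⇒
        pathOver A P (g x) (g y) (ap A A g x y p) (G x u) (G y v))
    (lam fun x ↦ lam fun u ↦ lam fun v ↦ lam fun w ↦ ap (P x) (P (g x)) (G x) u v w)
    x y p u v w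

/-- For `f : (x : A) → P x` with `f (g x) ≡ G x (f x)`, the canonical path from
`apd f (ap g p)` to `apOver g G (apd f p)`. -/
def apdAp (A P g G f x y p : Expr) : Expr :=
  k .idInd A
    (lam fun x ↦ lam fun y ↦ lam fun p ↦
      eq (pathOver A P (g x) (g y) (ap A A g x y p) (f (g x)) (f (g y)))
        (apd A P f (g x) (g y) (ap A A g x y p))
        (apOver A P g G x y p (f x) (f y) (apd A P f x y p)))
    (lam fun x ↦ refl (eq (P (g x)) (f (g x)) (f (g x))) (refl (P (g x)) (f (g x))))
    x y p

/-! #### Truncation levels and equivalences -/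

def sig (A : Expr) (B : Expr → Expr) : Expr := k .sigma A (lam B)

/-- `isTrunc n X`: the type `X` is an `(n - 1)`-type (`0`: proposition, `1`: set, `2`: 1-type). -/
def isTrunc : ℕ → Expr → Expr
  | 0, X => pi X fun x ↦ pi X fun y ↦ eq X x y
  | n + 1, X => pi X fun x ↦ pi X fun y ↦ isTrunc n (eq X x y)

def isSet (X : Expr) : Expr := isTrunc 1 X

/-- `f : A → B` is a half-adjoint equivalence. -/
def isEquiv (A B f : Expr) : Expr :=
  sig (B ⇒ A) fun g ↦
    sig (pi A fun x ↦ eq A (g (f x)) x) fun η ↦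
      sig (pi B fun y ↦ eq B (f (g y)) y) fun ε ↦
        pi A fun x ↦ eq (eq B (f (g (f x))) (f x)) (ap A B f (g (f x)) x (η x)) (ε (f x))

def equiv (A B : Expr) : Expr := sig (A ⇒ B) fun f ↦ isEquiv A B f

/-- The identity equivalence. -/
def idEquiv (A : Expr) : Expr :=
  let i : Expr := lam fun x ↦ x
  let h : Expr := lam fun x ↦ refl A x
  let coh : Expr → Expr → Expr → Expr := fun g η ε ↦
    pi A fun x ↦ eq (eq A (g x) x) (ap A A i (g x) x (η x)) (ε x)
  let Eps : Expr → Expr := fun g ↦ pi A fun y ↦ eq A (g y) y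
  let Eta : Expr → Expr := fun g ↦ pi A fun x ↦ eq A (g x) x
  k .pair (A ⇒ A) (lam fun f ↦ isEquiv A A f) i
    (k .pair (A ⇒ A) (lam fun g ↦ sig (Eta g) fun η ↦ sig (Eps g) fun ε ↦ coh g η ε) i
      (k .pair (Eta i) (lam fun η ↦ sig (Eps i) fun ε ↦ coh i η ε) h
        (k .pair (Eps i) (lam fun ε ↦ coh i h ε) h
          (lam fun x ↦ refl (eq A x x) (refl A x)))))

/-- The canonical map `(A =_{U i} B) → (A ≃ B)`. -/
def idToEquiv (i : ℕ) (A B : Expr) : Expr :=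
  lam fun p ↦ k .idInd (univ i) (lam fun A ↦ lam fun B ↦ lam fun _ ↦ equiv A B)
    (lam fun A ↦ idEquiv A) A B p

/-- The canonical map `(f = g) → ((x : A) → f x = g x)`. -/
def happly (A B f g : Expr) : Expr :=
  lam fun p ↦ k .idInd (pi A fun x ↦ B x)
    (lam fun f ↦ lam fun g ↦ lam fun _ ↦ pi A fun x ↦ eq (B x) (f x) (g x))
    (lam fun f ↦ lam fun x ↦ refl (B x) (f x)) f g p

/-! #### Lists of signed elements -/

/-- `A + A`: elements of `A` with a sign. -/
def signed (A : Expr) : Expr := k .sum A A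

/-- Change of sign. -/
def inv (A a : Expr) : Expr :=
  k .sumInd A A (lam fun _ ↦ signed A) (lam fun a ↦ k .inr A A a) (lam fun a ↦ k .inl A A a) a

/-- The path `inv (inv a) = a`. -/
def invInv (A a : Expr) : Expr :=
  k .sumInd A A (lam fun a ↦ eq (signed A) (inv A (inv A a)) a)
    (lam fun a ↦ refl (signed A) (k .inl A A a)) (lam fun a ↦ refl (signed A) (k .inr A A a)) a

/-- The type of lists over `A + A`. -/
def words (A : Expr) : Expr := k .list (signed A)

def nil (A : Expr) : Expr := k .nil (signed A)

def cons (A a x : Expr) : Expr := k .cons (signed A) a x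

/-- Concatenation of words. -/
def append (A x y : Expr) : Expr :=
  k .listInd (signed A) (lam fun _ ↦ words A) y
    (lam fun a ↦ lam fun _ ↦ lam fun l ↦ cons A a l) x

/-- The canonical path `(x ++ y) ++ z = x ++ (y ++ z)`. -/
def assoc (A x y z : Expr) : Expr :=
  k .listInd (signed A)
    (lam fun x ↦ eq (words A) (append A (append A x y) z) (append A x (append A y z)))
    (refl (words A) (append A y z))
    (lam fun a ↦ lam fun x ↦ lam fun p ↦
      ap (words A) (words A) (lam fun l ↦ cons A a l)
        (append A (append A x y) z) (append A x (append A y z)) p)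
    x

def assocInv (A x y z : Expr) : Expr :=
  inverse (words A) (append A (append A x y) z) (append A x (append A y z)) (assoc A x y z)

/-- The word `a ā x`. -/
def redex (A a x : Expr) : Expr := cons A a (cons A (inv A a) x)

/-! #### The free ∞-group

A higher inductive type with constructors `unit`, `cons a`, `icons a`, `μ₁`, `μ₂`, `μ`; the last
five say that each `cons a` is a half-adjoint equivalence. -/

def free (A : Expr) : Expr := k .free A
def fUnit (A : Expr) : Expr := k .fUnit A
def fCons (A a x : Expr) : Expr := k .fCons A a x
def fICons (A a x : Expr) : Expr := k .fICons A a x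
def fMu1 (A a x : Expr) : Expr := k .fMu1 A a x
def fMu2 (A a x : Expr) : Expr := k .fMu2 A a x
def fMu (A a x : Expr) : Expr := k .fMu A a x

/-- `ap (cons a) (μ₁ a x) : cons a (icons a (cons a x)) = cons a x`. -/
def apConsMu1 (A a x : Expr) : Expr :=
  ap (free A) (free A) (k .fCons A a) (fICons A a (fCons A a x)) x (fMu1 A a x)

/-- Given `w` over `μ₁ a x`, from `i a (cons a x) (c a x p)` to `p`, the path over `μ₂ a (cons a x)`
obtained by acting with `c a` on `w` and transporting along `μ a x`. -/
def transportMu (A P c a x u v w : Expr) : Expr :=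
  let y := fCons A a (fICons A a (fCons A a x))
  let y' := fCons A a x
  let z := fICons A a (fCons A a x)
  transport (eq (free A) y y')
    (lam fun q ↦ pathOver (free A) P y y' q (c a z u) (c a x v))
    (apConsMu1 A a x) (fMu2 A a y') (fMu A a x)
    (apOver (free A) P (k .fCons A a) (c a) z x (fMu1 A a x) u v w)

/-- The telescope of arguments of the induction principle of `free A` for families in `U j`:
a parameter type, a family, and one datum for each constructor. -/
def freeIndTele (i j : ℕ) (body : (A P u c i m₁ m₂ m : Expr) → Expr) : Expr :=
  pi (univ i) fun A ↦
  pi (free A ⇒ univ j) fun P ↦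
  pi (P (fUnit A)) fun u ↦
  pi (pi A fun a ↦ pi (free A) fun x ↦ P x ⇒ P (fCons A a x)) fun c ↦
  pi (pi A fun a ↦ pi (free A) fun x ↦ P x ⇒ P (fICons A a x)) fun ic ↦
  pi (pi A fun a ↦ pi (free A) fun x ↦ pi (P x) fun p ↦
    pathOver (free A) P (fICons A a (fCons A a x)) x (fMu1 A a x)
      (ic a (fCons A a x) (c a x p)) p) fun m₁ ↦
  pi (pi A fun a ↦ pi (free A) fun x ↦ pi (P x) fun p ↦
    pathOver (free A) P (fCons A a (fICons A a x)) x (fMu2 A a x)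
      (c a (fICons A a x) (ic a x p)) p) fun m₂ ↦
  pi (pi A fun a ↦ pi (free A) fun x ↦ pi (P x) fun p ↦
    let v := c a x p
    let u := ic a (fCons A a x) v
    eq (pathOver (free A) P (fCons A a (fICons A a (fCons A a x))) (fCons A a x)
        (fMu2 A a (fCons A a x)) (c a (fICons A a (fCons A a x)) u) v)
      (transportMu A P c a x u p (m₁ a x p))
      (m₂ a (fCons A a x) v)) fun m ↦
  body A P u c ic m₁ m₂ m

/-- The function defined by induction. -/
def freeInd (A P u c i m₁ m₂ m : Expr) : Expr := k .freeInd A P u c i m₁ m₂ m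

/-- The computation rule at `μ`: the two paths to `m₂ a (cons a x) (f (cons a x))`, one through
`apd f (μ₂ a (cons a x))`, the other through `m₁` and `m`, agree. -/
def freeIndMuType (A P u c i m₁ m₂ m a x : Expr) : Expr :=
  let f := freeInd A P u c i m₁ m₂ m
  let y := fCons A a (fICons A a (fCons A a x))
  let y' := fCons A a x
  let z := fICons A a (fCons A a x)
  let S : Expr := lam fun q ↦ pathOver (free A) P y y' q (f y) (f y')
  let D : Expr := pathOver (free A) P y y' (fMu2 A a y') (f y) (f y')
  let D₁ : Expr := pathOver (free A) P z x (fMu1 A a x) (f z) (f x)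
  let D₀ : Expr := pathOver (free A) P y y' (apConsMu1 A a x) (f y) (f y')
  let tr : Expr := lam fun w ↦
    transport (eq (free A) y y') S (apConsMu1 A a x) (fMu2 A a y') (fMu A a x) w
  let start : Expr := tr (apd (free A) P f y y' (apConsMu1 A a x))
  let finish : Expr := m₂ a y' (f y')
  let mid₁ : Expr := transportMu A P c a x (f z) (f x) (apd (free A) P f z x (fMu1 A a x))
  let mid₂ : Expr := transportMu A P c a x (f z) (f x) (m₁ a x (f x))
  eq (eq D start finish)
    (concat D start (apd (free A) P f y y' (fMu2 A a y')) finish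
      (apd (eq (free A) y y') S (lam fun q ↦ apd (free A) P f y y' q)
        (apConsMu1 A a x) (fMu2 A a y') (fMu A a x))
      (k .freeIndMu2 A P u c i m₁ m₂ m a y'))
    (concat D start mid₁ finish
      (ap D₀ D tr (apd (free A) P f y y' (apConsMu1 A a x))
        (apOver (free A) P (k .fCons A a) (c a) z x (fMu1 A a x) (f z) (f x)
          (apd (free A) P f z x (fMu1 A a x)))
        (apdAp (free A) P (k .fCons A a) (c a) f z x (fMu1 A a x)))
      (concat D mid₁ mid₂ finish
        (ap D₁ D (lam fun w ↦ transportMu A P c a x (f z) (f x) w)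
          (apd (free A) P f z x (fMu1 A a x)) (m₁ a x (f x))
          (k .freeIndMu1 A P u c i m₁ m₂ m a x))
        (m a x (f x))))

/-! #### The non-recursive approximation

A higher inductive type with constructors `η`, `τ`, `sw`, `ov` and a constructor that makes it a
1-type.  Re-bracketing of concatenations and the identification of `inv (inv a)` with `a` are
inserted explicitly, along the canonical paths. -/

def approx (A : Expr) : Expr := k .approx A
def aEta (A x : Expr) : Expr := k .aEta A x
def aTau (A x a y : Expr) : Expr := k .aTau A x a y

/-- A path `η src = η tgt` in `approx A`, and (for a given family `P`, with `e : (x) → P (η x)`)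
a path over it from `e src` to `e tgt`. -/
structure Route where
  src : Expr
  tgt : Expr
  path : Expr
  lift : Expr

namespace Route

/-- `τ x a y`, and over it `t x a y`. -/
def tau (A t x a y : Expr) : Route where
  src := append A x (redex A a y)
  tgt := append A x y
  path := aTau A x a y
  lift := t x a y

/-- `ap η q` for a path `q : x = y` between words, and over it the action of `e` on `q`. -/
def word (A P e x y q : Expr) : Route where
  src := x
  tgt := y
  path := ap (words A) (approx A) (k .aEta A) x y q
  lift := k .idInd (words A)
    (lam fun x ↦ lam fun y ↦ lam fun q ↦
      pathOver (approx A) P (aEta A x) (aEta A y)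
        (ap (words A) (approx A) (k .aEta A) x y q) (e x) (e y))
    (lam fun x ↦ refl (P (aEta A x)) (e x)) x y q

/-- Composition of routes. -/
def comp (A P e : Expr) (r s : Route) : Route where
  src := r.src
  tgt := s.tgt
  path := concat (approx A) (aEta A r.src) (aEta A r.tgt) (aEta A s.tgt) r.path s.path
  lift := concatOver (approx A) P (aEta A r.src) (aEta A r.tgt) (aEta A s.tgt) r.path s.path
    (e r.src) (e r.tgt) (e s.tgt) r.lift s.lift

/-- The type of 2-paths between parallel routes. -/
def eqPath (A : Expr) (r s : Route) : Expr :=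
  eq (eq (approx A) (aEta A r.src) (aEta A r.tgt)) r.path s.path

/-- The type of 2-paths between parallel routes over a given `h : r.path = s.path`. -/
def eqOver (A P e : Expr) (r s : Route) (h : Expr) : Expr :=
  pathOver (eq (approx A) (aEta A r.src) (aEta A r.tgt))
    (lam fun q ↦ pathOver (approx A) P (aEta A r.src) (aEta A r.tgt) q (e r.src) (e r.tgt))
    r.path s.path h r.lift s.lift

/-- `x a ā y b b̄ z ⟶ x y b b̄ z ⟶ x y z`, by `τ(x,a,y b b̄ z)` and `τ(xy,b,z)`. -/
def swLeft (A P e t x a y b z : Expr) : Route :=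
  comp A P e (tau A t x a (append A y (redex A b z))) <|
  comp A P e (word A P e (append A x (append A y (redex A b z)))
    (append A (append A x y) (redex A b z)) (assocInv A x y (redex A b z))) <|
  tau A t (append A x y) b z

/-- `x a ā y b b̄ z ⟶ x a ā y z ⟶ x y z`, by `τ(x a ā y,b,z)` and `τ(x,a,yz)`. -/
def swRight (A P e t x a y b z : Expr) : Route :=
  comp A P e (word A P e (append A x (redex A a (append A y (redex A b z))))
    (append A (append A x (redex A a y)) (redex A b z))
    (assocInv A x (redex A a y) (redex A b z))) <|
  comp A P e (tau A t (append A x (redex A a y)) b z) <|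
  comp A P e (word A P e (append A (append A x (redex A a y)) z)
    (append A x (redex A a (append A y z))) (assoc A x (redex A a y) z)) <|
  comp A P e (tau A t x a (append A y z)) <|
  word A P e (append A x (append A y z)) (append A (append A x y) z) (assocInv A x y z)

/-- `x a ā a y ⟶ x a y` by `τ(x,a,ay)`. -/
def ovLeft (A t x a y : Expr) : Route := tau A t x a (cons A a y)

/-- `x a ā a y ⟶ x a y` by `τ(xa,ā,y)`. -/
def ovRight (A P e t x a y : Expr) : Route :=
  let a' := inv A a
  let xa := append A x (cons A a (nil A))
  let ins : Expr := lam fun b ↦ append A x (cons A a (cons A a' (cons A b y)))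
  comp A P e (word A P e (append A x (redex A a (cons A a y)))
    (append A x (cons A a (redex A a' y)))
    (ap (signed A) (words A) ins a (inv A a')
      (inverse (signed A) (inv A a') a (invInv A a)))) <|
  comp A P e (word A P e (append A x (cons A a (redex A a' y)))
    (append A xa (redex A a' y)) (assocInv A x (cons A a (nil A)) (redex A a' y))) <|
  comp A P e (tau A t xa a' y) <|
  word A P e (append A xa y) (append A x (cons A a y)) (assoc A x (cons A a (nil A)) y)

end Route

/-- A path constructor does not involve a family: its type uses only the `path` fields of the
routes, which do not depend on `P`, `e`, `t`. -/
def aSwType (A x a y b z : Expr) : Expr :=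
  let o := k .star
  Route.eqPath A (Route.swLeft A o o o x a y b z) (Route.swRight A o o o x a y b z)

def aOvType (A x a y : Expr) : Expr :=
  let o := k .star
  Route.eqPath A (Route.ovLeft A o x a y) (Route.ovRight A o o o x a y)

/-- The telescope of arguments of the induction principle of `approx A` for families in `U j`.
The datum for the truncation constructor is that the family consists of 1-types. -/
def approxIndTele (i j : ℕ) (body : (A P h e t s o : Expr) → Expr) : Expr :=
  pi (univ i) fun A ↦
  pi (approx A ⇒ univ j) fun P ↦
  pi (pi (approx A) fun n ↦ isTrunc 2 (P n)) fun h ↦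
  pi (pi (words A) fun x ↦ P (aEta A x)) fun e ↦
  pi (pi (words A) fun x ↦ pi (signed A) fun a ↦ pi (words A) fun y ↦
    pathOver (approx A) P (aEta A (append A x (redex A a y))) (aEta A (append A x y))
      (aTau A x a y) (e (append A x (redex A a y))) (e (append A x y))) fun t ↦
  pi (pi (words A) fun x ↦ pi (signed A) fun a ↦ pi (words A) fun y ↦
    pi (signed A) fun b ↦ pi (words A) fun z ↦
      Route.eqOver A P e (Route.swLeft A P e t x a y b z) (Route.swRight A P e t x a y b z)
        (k .aSw A x a y b z)) fun s ↦
  pi (pi (words A) fun x ↦ pi (signed A) fun a ↦ pi (words A) fun y ↦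
    Route.eqOver A P e (Route.ovLeft A t x a y) (Route.ovRight A P e t x a y)
      (k .aOv A x a y)) fun o ↦
  body A P h e t s o

/-! ### The types of the constants -/

/-- The type of each constant, for parameter types in `U i` and families in `U j`. -/
def typeOf (i j : ℕ) : Const → Expr
  | .sigma => pi (univ i) fun A ↦ (A ⇒ univ i) ⇒ univ i
  | .pair => pi (univ i) fun A ↦ pi (A ⇒ univ i) fun B ↦
      pi A fun a ↦ B a ⇒ k .sigma A B
  | .sigmaInd => pi (univ i) fun A ↦ pi (A ⇒ univ i) fun B ↦
      pi (k .sigma A B ⇒ univ j) fun C ↦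
      (pi A fun a ↦ pi (B a) fun b ↦ C (k .pair A B a b)) ⇒
      pi (k .sigma A B) fun p ↦ C p
  | .sum => univ i ⇒ univ i ⇒ univ i
  | .inl => pi (univ i) fun A ↦ pi (univ i) fun B ↦ A ⇒ k .sum A B
  | .inr => pi (univ i) fun A ↦ pi (univ i) fun B ↦ B ⇒ k .sum A B
  | .sumInd => pi (univ i) fun A ↦ pi (univ i) fun B ↦ pi (k .sum A B ⇒ univ j) fun C ↦
      (pi A fun a ↦ C (k .inl A B a)) ⇒ (pi B fun b ↦ C (k .inr A B b)) ⇒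
      pi (k .sum A B) fun x ↦ C x
  | .empty => univ i
  | .emptyInd => pi (k .empty ⇒ univ j) fun C ↦ pi (k .empty) fun x ↦ C x
  | .unit => univ i
  | .star => k .unit
  | .unitInd => pi (k .unit ⇒ univ j) fun C ↦ C (k .star) ⇒ pi (k .unit) fun x ↦ C x
  | .nat => univ i
  | .zero => k .nat
  | .succ => k .nat ⇒ k .nat
  | .natInd => pi (k .nat ⇒ univ j) fun C ↦ C (k .zero) ⇒
      (pi (k .nat) fun n ↦ C n ⇒ C (k .succ n)) ⇒ pi (k .nat) fun n ↦ C n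
  | .list => univ i ⇒ univ i
  | .nil => pi (univ i) fun A ↦ k .list A
  | .cons => pi (univ i) fun A ↦ A ⇒ k .list A ⇒ k .list A
  | .listInd => pi (univ i) fun A ↦ pi (k .list A ⇒ univ j) fun C ↦ C (k .nil A) ⇒
      (pi A fun a ↦ pi (k .list A) fun l ↦ C l ⇒ C (k .cons A a l)) ⇒
      pi (k .list A) fun l ↦ C l
  | .wtype => pi (univ i) fun A ↦ (A ⇒ univ i) ⇒ univ i
  | .sup => pi (univ i) fun A ↦ pi (A ⇒ univ i) fun B ↦
      pi A fun a ↦ (B a ⇒ k .wtype A B) ⇒ k .wtype A B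
  | .wInd => pi (univ i) fun A ↦ pi (A ⇒ univ i) fun B ↦
      pi (k .wtype A B ⇒ univ j) fun C ↦
      (pi A fun a ↦ pi (B a ⇒ k .wtype A B) fun f ↦
        (pi (B a) fun b ↦ C (f b)) ⇒ C (k .sup A B a f)) ⇒
      pi (k .wtype A B) fun w ↦ C w
  | .id => pi (univ i) fun A ↦ A ⇒ A ⇒ univ i
  | .refl => pi (univ i) fun A ↦ pi A fun x ↦ eq A x x
  | .idInd => pi (univ i) fun A ↦
      pi (pi A fun x ↦ pi A fun y ↦ eq A x y ⇒ univ j) fun C ↦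
      (pi A fun x ↦ C x x (refl A x)) ⇒
      pi A fun x ↦ pi A fun y ↦ pi (eq A x y) fun p ↦ C x y p
  | .funext => pi (univ i) fun A ↦ pi (A ⇒ univ i) fun B ↦
      pi (pi A fun x ↦ B x) fun f ↦ pi (pi A fun x ↦ B x) fun g ↦
      isEquiv (eq (pi A fun x ↦ B x) f g) (pi A fun x ↦ eq (B x) (f x) (g x)) (happly A B f g)
  | .univalence => pi (univ i) fun A ↦ pi (univ i) fun B ↦
      isEquiv (eq (univ i) A B) (equiv A B) (idToEquiv i A B)
  | .trunc _ => univ i ⇒ univ i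
  | .truncMk n => pi (univ i) fun X ↦ X ⇒ k (.trunc n) X
  | .truncIs n => pi (univ i) fun X ↦ isTrunc n (k (.trunc n) X)
  | .truncInd n => pi (univ i) fun X ↦ pi (k (.trunc n) X ⇒ univ j) fun P ↦
      (pi (k (.trunc n) X) fun x ↦ isTrunc n (P x)) ⇒
      (pi X fun x ↦ P (k (.truncMk n) X x)) ⇒ pi (k (.trunc n) X) fun x ↦ P x
  | .free => univ i ⇒ univ i
  | .fUnit => pi (univ i) fun A ↦ free A
  | .fCons => pi (univ i) fun A ↦ A ⇒ free A ⇒ free A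
  | .fICons => pi (univ i) fun A ↦ A ⇒ free A ⇒ free A
  | .fMu1 => pi (univ i) fun A ↦ pi A fun a ↦ pi (free A) fun x ↦
      eq (free A) (fICons A a (fCons A a x)) x
  | .fMu2 => pi (univ i) fun A ↦ pi A fun a ↦ pi (free A) fun x ↦
      eq (free A) (fCons A a (fICons A a x)) x
  | .fMu => pi (univ i) fun A ↦ pi A fun a ↦ pi (free A) fun x ↦
      eq (eq (free A) (fCons A a (fICons A a (fCons A a x))) (fCons A a x))
        (apConsMu1 A a x) (fMu2 A a (fCons A a x))
  | .freeInd => freeIndTele i j fun A P _ _ _ _ _ _ ↦ pi (free A) fun x ↦ P x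
  | .freeIndMu1 => freeIndTele i j fun A P u c ic m₁ m₂ m ↦ pi A fun a ↦ pi (free A) fun x ↦
      let f := freeInd A P u c ic m₁ m₂ m
      eq (pathOver (free A) P (fICons A a (fCons A a x)) x (fMu1 A a x)
          (f (fICons A a (fCons A a x))) (f x))
        (apd (free A) P f (fICons A a (fCons A a x)) x (fMu1 A a x)) (m₁ a x (f x))
  | .freeIndMu2 => freeIndTele i j fun A P u c ic m₁ m₂ m ↦ pi A fun a ↦ pi (free A) fun x ↦
      let f := freeInd A P u c ic m₁ m₂ m
      eq (pathOver (free A) P (fCons A a (fICons A a x)) x (fMu2 A a x)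
          (f (fCons A a (fICons A a x))) (f x))
        (apd (free A) P f (fCons A a (fICons A a x)) x (fMu2 A a x)) (m₂ a x (f x))
  | .freeIndMu => freeIndTele i j fun A P u c ic m₁ m₂ m ↦ pi A fun a ↦ pi (free A) fun x ↦
      freeIndMuType A P u c ic m₁ m₂ m a x
  | .approx => univ i ⇒ univ i
  | .aEta => pi (univ i) fun A ↦ words A ⇒ approx A
  | .aTau => pi (univ i) fun A ↦
      pi (words A) fun x ↦ pi (signed A) fun a ↦ pi (words A) fun y ↦
      eq (approx A) (aEta A (append A x (redex A a y))) (aEta A (append A x y))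
  | .aSw => pi (univ i) fun A ↦
      pi (words A) fun x ↦ pi (signed A) fun a ↦ pi (words A) fun y ↦
      pi (signed A) fun b ↦ pi (words A) fun z ↦ aSwType A x a y b z
  | .aOv => pi (univ i) fun A ↦
      pi (words A) fun x ↦ pi (signed A) fun a ↦ pi (words A) fun y ↦ aOvType A x a y
  | .aTr => pi (univ i) fun A ↦ isTrunc 2 (approx A)
  | .approxInd => approxIndTele i j fun A P _ _ _ _ _ ↦ pi (approx A) fun n ↦ P n
  | .approxIndTau => approxIndTele i j fun A P h e t s o ↦
      pi (words A) fun x ↦ pi (signed A) fun a ↦ pi (words A) fun y ↦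
      let f := k .approxInd A P h e t s o
      eq (pathOver (approx A) P (aEta A (append A x (redex A a y))) (aEta A (append A x y))
          (aTau A x a y) (f (aEta A (append A x (redex A a y)))) (f (aEta A (append A x y))))
        (apd (approx A) P f (aEta A (append A x (redex A a y))) (aEta A (append A x y))
          (aTau A x a y))
        (t x a y)

/-- The 1-truncation. -/
def oneTrunc (X : Expr) : Expr := k (.trunc 2) X

end Expr

/-! ### Typing -/

/-- `HasType Γ t A` is the judgment `Γ ⊢ t : A`.  A context is the list of the types of its
variables, the most recent first; the rules `var` and `weaken` only build well-formed ones. -/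
inductive HasType : List Tm → Tm → Tm → Prop
  | univ (i) : HasType [] (.univ i) (.univ (i + 1))
  | con (c : Const) (i j) : HasType [] (.con c) (Expr.typeOf i j c).toTm
  | var {Γ A i} : HasType Γ A (.univ i) → HasType (A :: Γ) (.var 0) A.lift
  | weaken {Γ t B A i} : HasType Γ t B → HasType Γ A (.univ i) →
      HasType (A :: Γ) t.lift B.lift
  | cumul {Γ A i} : HasType Γ A (.univ i) → HasType Γ A (.univ (i + 1))
  | pi {Γ A B i} : HasType Γ A (.univ i) → HasType (A :: Γ) B (.univ i) →
      HasType Γ (.pi A B) (.univ i)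
  | lam {Γ A B t} : HasType (A :: Γ) t B → HasType Γ (.lam t) (.pi A B)
  | app {Γ A B f a} : HasType Γ f (.pi A B) → HasType Γ a A →
      HasType Γ (.app f a) (B.inst a)
  | conv {Γ t A B i} : HasType Γ t A → Conv A B → HasType Γ B (.univ i) → HasType Γ t B

/-- A closed type is provable if it has a closed inhabitant. -/
def Provable (T : Expr) : Prop := ∃ t : Tm, HasType [] t T.toTm

end BookHoTT

namespace BookHoTT

/-! ### Renaming and substitution -/

namespace Tm

/-! The claim is that a closed term of a formal type theory exists, so the proof has two layers: an
argument inside homotopy type theory, and a type checker, proved sound in Lean, which certifies that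
argument as a derivation.

Inside the type theory, both sides are 1-types with a base point on which every letter acts by a
half-adjoint equivalence. On the approximation the action is prefixing (`aCons`). It is definable by
recursion because τ, sw and ov are imposed under an arbitrary left context. The path from a ā n to n
is τ with empty left context on words. Its naturality in n is sw with empty left context
(`aCancelTau`), and its triangle law is ov with empty left context (`aCancelCons`). This is all that
recursion on the free ∞-group asks for, and the resulting map factors through the 1-truncation
because the approximation is a 1-type.

In the other direction a word is folded into the action of its letters on the unit (`fold`). A redex
cancels by the homotopies μ₁ and μ₂, carried along the letters in front of it (`foldTau`). The law
sw becomes naturality of these homotopies (`foldSw`); ov becomes a triangle law, the given one for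
positive letters and its mirror image `adjointSymm` for negative ones (`foldOv`).

Both composites are identified with the identity by induction. Paths in a 1-type form a set, so such
a homotopy needs only values at the point constructors and commuting squares at the path
constructors. The squares hold because both maps commute with the action of letters (`toFreeCons`,
`toApproxAct`) and with cancellation (`toFreeCancel`, `toApproxCancel`). No normal forms of words
enter.

To turn this into a derivation, the argument is written as a list `env` of annotated definitions.
Substitution is shown to be admissible for the typing rules, and from this the checker is sound
(`infer_sound`, `EnvOK.exists_of_ok`). The kernel evaluates the checker on `env` once
(`okRange_env`). Levels in `env` are relative to a base level, so this single evaluation covers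
every universe. -/

theorem upRen_comp (ρ ξ : ℕ → ℕ) : upRen (ρ ∘ ξ) = upRen ρ ∘ upRen ξ := by
  funext n; cases n <;> rfl

theorem rename_rename (t : Tm) : ∀ ρ ξ : ℕ → ℕ, (t.rename ξ).rename ρ = t.rename (ρ ∘ ξ) := by
  induction t with
  | pi A B hA hB => intro ρ ξ; simp [rename, hA, hB, upRen_comp]
  | lam t h => intro ρ ξ; simp [rename, h, upRen_comp]
  | app f a hf ha => intro ρ ξ; simp [rename, hf, ha]
  | _ => intros; rfl

theorem upSub_comp_ren (σ : ℕ → Tm) (ξ : ℕ → ℕ) : upSub (σ ∘ ξ) = upSub σ ∘ upRen ξ := by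
  funext n; cases n <;> rfl

theorem subst_rename (t : Tm) : ∀ (σ : ℕ → Tm) (ξ : ℕ → ℕ),
    (t.rename ξ).subst σ = t.subst (σ ∘ ξ) := by
  induction t with
  | pi A B hA hB => intro ρ ξ; simp [rename, subst, hA, hB, upSub_comp_ren]
  | lam t h => intro ρ ξ; simp [rename, subst, h, upSub_comp_ren]
  | app f a hf ha => intro ρ ξ; simp [rename, subst, hf, ha]
  | _ => intros; rfl

theorem ren_comp_upSub (ρ : ℕ → ℕ) (σ : ℕ → Tm) :
    upSub (fun n ↦ (σ n).rename ρ) = fun n ↦ (upSub σ n).rename (upRen ρ) := by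
  funext n
  cases n with
  | zero => rfl
  | succ n => simp only [upSub, lift, rename_rename]; rfl

theorem rename_subst (t : Tm) : ∀ (ρ : ℕ → ℕ) (σ : ℕ → Tm),
    (t.subst σ).rename ρ = t.subst (fun n ↦ (σ n).rename ρ) := by
  induction t with
  | pi A B hA hB => intro ρ ξ; simp [rename, subst, hA, hB, ren_comp_upSub]
  | lam t h => intro ρ ξ; simp [rename, subst, h, ren_comp_upSub]
  | app f a hf ha => intro ρ ξ; simp [rename, subst, hf, ha]
  | _ => intros; rfl

theorem lift_subst_upSub (t : Tm) (σ : ℕ → Tm) : t.lift.subst (upSub σ) = (t.subst σ).lift := by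
  simp only [lift, subst_rename, rename_subst]; rfl

theorem upSub_comp (τ σ : ℕ → Tm) :
    upSub (fun n ↦ (σ n).subst τ) = fun n ↦ (upSub σ n).subst (upSub τ) := by
  funext n
  cases n with
  | zero => rfl
  | succ n => simp only [upSub, lift_subst_upSub]

theorem subst_subst (t : Tm) : ∀ (τ σ : ℕ → Tm),
    (t.subst σ).subst τ = t.subst (fun n ↦ (σ n).subst τ) := by
  induction t with
  | pi A B hA hB => intro ρ ξ; simp [subst, hA, hB, upSub_comp]
  | lam t h => intro ρ ξ; simp [subst, h, upSub_comp]
  | app f a hf ha => intro ρ ξ; simp [subst, hf, ha]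
  | _ => intros; rfl

theorem upSub_var : upSub var = var := by
  funext n; cases n <;> rfl

theorem subst_var (t : Tm) : t.subst var = t := by
  induction t with
  | pi A B hA hB => simp [subst, hA, hB, upSub_var]
  | lam t h => simp [subst, h, upSub_var]
  | app f a hf ha => simp [subst, hf, ha]
  | _ => rfl

theorem upSub_var_comp (ρ : ℕ → ℕ) : upSub (fun n ↦ var (ρ n)) = fun n ↦ var (upRen ρ n) := by
  funext n; cases n <;> rfl

theorem rename_eq_subst (t : Tm) : ∀ ρ : ℕ → ℕ, t.rename ρ = t.subst (fun n ↦ var (ρ n)) := by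
  induction t with
  | pi A B hA hB => intro ρ; simp [rename, subst, hA, hB, upSub_var_comp]
  | lam t h => intro ρ; simp [rename, subst, h, upSub_var_comp]
  | app f a hf ha => intro ρ; simp [rename, subst, hf, ha]
  | _ => intros; rfl

theorem inst_subst (t a : Tm) (σ : ℕ → Tm) :
    (t.inst a).subst σ = (t.subst (upSub σ)).inst (a.subst σ) := by
  simp only [inst, subst_subst]
  congr 1
  funext n
  cases n with
  | zero => rfl
  | succ n => simp only [upSub, single, lift, subst_rename, subst]; exact (subst_var _).symm

theorem apps_subst (as : List Tm) : ∀ (f : Tm) (σ : ℕ → Tm),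
    (apps f as).subst σ = apps (f.subst σ) (as.map (subst σ)) := by
  induction as with
  | nil => intros; rfl
  | cons a as h => intro f σ; exact h _ _

/-! #### Closed terms -/

/-- All free variables of the term are less than the given bound. -/
def closedAt : ℕ → Tm → Bool
  | d, var n => Nat.blt n d
  | _, univ _ => true
  | d, pi A B => A.closedAt d && B.closedAt (d + 1)
  | d, lam t => t.closedAt (d + 1)
  | d, app f a => f.closedAt d && a.closedAt d
  | _, con _ => true

theorem subst_congr_of_closedAt (t : Tm) : ∀ (d : ℕ) (σ τ : ℕ → Tm), t.closedAt d = true →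
    (∀ n < d, σ n = τ n) → t.subst σ = t.subst τ := by
  have up : ∀ (d : ℕ) (σ τ : ℕ → Tm), (∀ n < d, σ n = τ n) →
      ∀ n < d + 1, upSub σ n = upSub τ n := by
    intro d σ τ h n hn
    cases n with
    | zero => rfl
    | succ n => simp only [upSub, h n (by omega)]
  induction t with
  | var n => intro d σ τ h e; exact e n (by simpa [closedAt] using h)
  | pi A B hA hB =>
    intro d σ τ h e
    simp only [closedAt, Bool.and_eq_true] at h
    simp only [subst, hA d σ τ h.1 e, hB _ _ _ h.2 (up d σ τ e)]
  | lam t ht =>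
    intro d σ τ h e
    simp only [subst, ht _ _ _ h (up d σ τ e)]
  | app f a hf ha =>
    intro d σ τ h e
    simp only [closedAt, Bool.and_eq_true] at h
    simp only [subst, hf d σ τ h.1 e, ha _ _ _ h.2 e]
  | _ => intros; rfl

theorem subst_of_closed {t : Tm} (h : t.closedAt 0 = true) (σ : ℕ → Tm) : t.subst σ = t := by
  rw [subst_congr_of_closedAt t 0 σ var h (by intro n hn; omega), subst_var]

theorem lift_of_closed {t : Tm} (h : t.closedAt 0 = true) : t.lift = t := by
  rw [lift, rename_eq_subst, subst_of_closed h]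

end Tm

/-! ### Conversion is stable under substitution -/

namespace Conv

theorem apps {as bs : List Tm} (h : List.Forall₂ Conv as bs) :
    ∀ {f g : Tm}, Conv f g → Conv (Tm.apps f as) (Tm.apps g bs) := by
  induction h with
  | nil => intro f g e; exact e
  | cons h _ ih => intro f g e; exact ih (.app e h)

theorem subst {t u : Tm} (h : Conv t u) : ∀ σ : ℕ → Tm, Conv (t.subst σ) (u.subst σ) := by
  induction h with
  | refl t => intro σ; exact .refl _
  | symm _ h => intro σ; exact .symm (h σ)
  | trans _ _ h h' => intro σ; exact .trans (h σ) (h' σ)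
  | pi _ _ h h' => intro σ; exact .pi (h σ) (h' _)
  | lam _ h => intro σ; exact .lam (h _)
  | app _ _ h h' => intro σ; exact .app (h σ) (h' σ)
  | beta t a => intro σ; rw [Tm.inst_subst]; exact .beta _ _
  | eta f =>
    intro σ
    simp only [Tm.subst, Tm.lift_subst_upSub]
    exact .eta _
  | sup =>
    intro σ
    simp only [Tm.apps_subst, Tm.subst, List.map, Tm.lift_subst_upSub]
    exact .sup ..
  | _ =>
    intro σ
    simp only [Tm.apps_subst, Tm.subst, List.map]
    first
      | exact .sigma .. | exact .inl .. | exact .inr .. | exact .unit .. | exact .zero ..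
      | exact .succ .. | exact .nil .. | exact .cons .. | exact .id .. | exact .trunc ..
      | exact .fUnit .. | exact .fCons .. | exact .fICons .. | exact .aEta ..

end Conv

/-! ### Typing is stable under weakening and substitution -/

namespace Expr

/-- All free variables of the expression are bound at depth less than the given one. -/
def Scoped (e : Expr) (d : ℕ) : Prop := ∀ d' ≥ d, (e.atDepth d').closedAt d' = true

/-- For a variable level `n` the recursion in `isTrunc` does not evaluate, so closedness of the
types of the truncation constants needs an induction. The predicate quantifies over all deeper
contexts because each step places `X` under two further binders. -/
theorem scoped_isTrunc (n : ℕ) : ∀ (X : Expr) (d : ℕ), X.Scoped d → (isTrunc n X).Scoped d := by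
  have hb : ∀ d d', d < d' → (bound d).Scoped d' := by
    intro d d' h d'' h'
    simp [bound, Tm.closedAt]; omega
  have hpi : ∀ (A : Expr) (B : Expr → Expr) (d : ℕ), A.Scoped d →
      (∀ d' ≥ d, (B (bound d')).Scoped (d' + 1)) → (pi A B).Scoped d := by
    intro A B d hA hB d' h
    simp only [pi, Tm.closedAt, Bool.and_eq_true]
    exact ⟨hA d' h, hB d' h _ le_rfl⟩
  have hmono : ∀ (A : Expr) (d d' : ℕ), A.Scoped d → d ≤ d' → A.Scoped d' :=
    fun A d d' h h' d'' h'' ↦ h d'' (h'.trans h'')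
  have heq : ∀ (A x y : Expr) (d : ℕ), A.Scoped d → x.Scoped d → y.Scoped d →
      (eq A x y).Scoped d := by
    intro A x y d hA hx hy d' h
    simp only [eq, k, app, Tm.closedAt, Bool.and_eq_true]
    exact ⟨⟨⟨trivial, hA d' h⟩, hx d' h⟩, hy d' h⟩
  induction n with
  | zero =>
    intro X d h
    refine hpi _ _ _ h fun d' h' ↦ hpi _ _ _ (hmono _ _ _ h (by omega)) fun d'' h'' ↦ ?_
    exact heq _ _ _ _ (hmono _ _ _ h (by omega)) (hb _ _ (by omega)) (hb _ _ (by omega))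
  | succ n ih =>
    intro X d h
    refine hpi _ _ _ h fun d' h' ↦ hpi _ _ _ (hmono _ _ _ h (by omega)) fun d'' h'' ↦ ih _ _ ?_
    exact heq _ _ _ _ (hmono _ _ _ h (by omega)) (hb _ _ (by omega)) (hb _ _ (by omega))

theorem closed_typeOf (i j : ℕ) (c : Const) : (typeOf i j c).toTm.closedAt 0 = true := by
  cases c with
  | truncIs n =>
    simp only [typeOf, toTm, pi, Tm.closedAt, Bool.and_eq_true]
    refine ⟨rfl, ?_⟩
    refine scoped_isTrunc n _ 1 ?_ 1 le_rfl
    intro d h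
    simp [k, app, bound, Tm.closedAt]; omega
  | truncInd n =>
    simp only [typeOf, toTm, pi, arr, Tm.closedAt, Bool.and_eq_true]
    refine ⟨rfl, ⟨rfl, rfl⟩, ⟨rfl, ?_⟩, ⟨rfl, rfl⟩, rfl, rfl⟩
    refine scoped_isTrunc n _ 3 ?_ 3 le_rfl
    intro d h
    simp [app, bound, Tm.closedAt]; omega
  | _ => rfl

end Expr

/-- Every type in the context lives in some universe. -/
def WF : List Tm → Prop
  | [] => True
  | A :: Γ => WF Γ ∧ ∃ i, HasType Γ A (.univ i)

namespace HasType

theorem wf {Γ : List Tm} {t T : Tm} (h : HasType Γ t T) : WF Γ := by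
  induction h with
  | univ | con => trivial
  | var h ih => exact ⟨ih, _, h⟩
  | weaken _ h ih => exact ⟨ih, _, h⟩
  | cumul _ ih => exact ih
  | pi _ _ ih => exact ih
  | lam _ ih => exact ih.1
  | app _ _ ih => exact ih
  | conv _ _ _ ih => exact ih

/-- A well-typed closed term whose type is closed keeps its type in every context. -/
theorem weaken_closed {Γ : List Tm} {t T : Tm} (h : HasType [] t T) (ht : t.closedAt 0 = true)
    (hT : T.closedAt 0 = true) (hΓ : WF Γ) : HasType Γ t T := by
  induction Γ with
  | nil => exact h
  | cons A Γ ih =>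
    obtain ⟨hΓ, i, hA⟩ := hΓ
    have := HasType.weaken (ih hΓ) hA
    rwa [Tm.lift_of_closed ht, Tm.lift_of_closed hT] at this

/-- The substitution `σ` sends the variables of `Γ` to terms in the context `Δ`. -/
def SubstTyped (Δ : List Tm) (σ : ℕ → Tm) (Γ : List Tm) : Prop :=
  ∀ n A, Γ[n]? = some A → HasType Δ (σ n) ((A.rename (· + (n + 1))).subst σ)

theorem SubstTyped.tail {Δ Γ : List Tm} {A : Tm} {σ : ℕ → Tm} (h : SubstTyped Δ σ (A :: Γ)) :
    SubstTyped Δ (σ ∘ Nat.succ) Γ := by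
  intro n B hB
  have := h (n + 1) B (by simpa using hB)
  rw [Tm.subst_rename] at this ⊢
  exact this

theorem SubstTyped.up {Δ Γ : List Tm} {A : Tm} {σ : ℕ → Tm} {i : ℕ} (h : SubstTyped Δ σ Γ)
    (hA : HasType Δ (A.subst σ) (.univ i)) :
    SubstTyped (A.subst σ :: Δ) (Tm.upSub σ) (A :: Γ) := by
  intro n B hB
  cases n with
  | zero =>
    obtain rfl : A = B := by simpa using hB
    have := HasType.var hA
    rw [← Tm.lift_subst_upSub] at this
    exact this
  | succ n =>
    have := HasType.weaken (h n B (by simpa using hB)) hA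
    rw [← Tm.lift_subst_upSub, Tm.lift, Tm.lift, Tm.rename_rename] at this
    exact this

/-- Every type in the context is stable under substitution. -/
def CtxStable : List Tm → Prop
  | [] => True
  | A :: Γ => CtxStable Γ ∧ ∀ {Δ : List Tm} {σ : ℕ → Tm}, WF Δ → SubstTyped Δ σ Γ →
      ∃ i, HasType Δ (A.subst σ) (.univ i)

/-- Pushing a substitution under a binder requires the domain to remain a type, but the rule `lam`
has no premise about its domain. The domain occurs only in the context of the body, so the induction
also carries the stability of the context. -/
theorem subst_aux {Γ : List Tm} {t T : Tm} (h : HasType Γ t T) :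
    CtxStable Γ ∧ ∀ {Δ : List Tm} {σ : ℕ → Tm}, WF Δ → SubstTyped Δ σ Γ →
      HasType Δ (t.subst σ) (T.subst σ) := by
  induction h with
  | univ i => exact ⟨trivial, fun hΔ _ ↦ weaken_closed (.univ i) rfl rfl hΔ⟩
  | con c i j =>
    refine ⟨trivial, fun hΔ _ ↦ ?_⟩
    rw [Tm.subst_of_closed (Expr.closed_typeOf i j c)]
    exact weaken_closed (.con c i j) rfl (Expr.closed_typeOf i j c) hΔ
  | var hA ih => exact ⟨⟨ih.1, fun hΔ hσ ↦ ⟨_, ih.2 hΔ hσ⟩⟩, fun hΔ hσ ↦ hσ 0 _ rfl⟩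
  | weaken _ _ ih ih' =>
    refine ⟨⟨ih'.1, fun hΔ hσ ↦ ⟨_, ih'.2 hΔ hσ⟩⟩, fun hΔ hσ ↦ ?_⟩
    simp only [Tm.lift, Tm.subst_rename]
    exact ih.2 hΔ hσ.tail
  | cumul _ ih => exact ⟨ih.1, fun hΔ hσ ↦ .cumul (ih.2 hΔ hσ)⟩
  | pi _ _ ih ih' =>
    refine ⟨ih.1, fun hΔ hσ ↦ ?_⟩
    have hA := ih.2 hΔ hσ
    exact .pi hA (ih'.2 ⟨hΔ, _, hA⟩ (hσ.up hA))
  | lam hb ih =>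
    refine ⟨ih.1.1, fun hΔ hσ ↦ ?_⟩
    obtain ⟨i, hA⟩ := ih.1.2 hΔ hσ
    exact .lam (ih.2 ⟨hΔ, _, hA⟩ (hσ.up hA))
  | app _ _ ih ih' =>
    refine ⟨ih.1, fun hΔ hσ ↦ ?_⟩
    rw [Tm.inst_subst]
    exact .app (ih.2 hΔ hσ) (ih'.2 hΔ hσ)
  | conv _ hc _ ih ih' =>
    exact ⟨ih.1, fun hΔ hσ ↦ .conv (ih.2 hΔ hσ) (hc.subst _) (ih'.2 hΔ hσ)⟩

theorem subst {Γ Δ : List Tm} {σ : ℕ → Tm} {t T : Tm} (h : HasType Γ t T) (hΔ : WF Δ)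
    (hσ : SubstTyped Δ σ Γ) : HasType Δ (t.subst σ) (T.subst σ) :=
  (subst_aux h).2 hΔ hσ

theorem var_of_getElem? {Γ : List Tm} (hΓ : WF Γ) : ∀ {n : ℕ} {A : Tm}, Γ[n]? = some A →
    HasType Γ (.var n) (A.rename (· + (n + 1))) := by
  induction Γ with
  | nil => intro n A h; simp at h
  | cons B Γ ih =>
    obtain ⟨hΓ, i, hB⟩ := hΓ
    intro n A h
    cases n with
    | zero =>
      obtain rfl : B = A := by simpa using h
      exact .var hB
    | succ n =>
      have := HasType.weaken (ih hΓ (n := n) (by simpa using h)) hB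
      rw [Tm.lift, Tm.lift, Tm.rename_rename] at this
      exact this

theorem isType_of_getElem? {Γ : List Tm} (hΓ : WF Γ) : ∀ {n : ℕ} {A : Tm}, Γ[n]? = some A →
    ∃ i, HasType Γ (A.rename (· + (n + 1))) (.univ i) := by
  induction Γ with
  | nil => intro n A h; simp at h
  | cons B Γ ih =>
    obtain ⟨hΓ, i, hB⟩ := hΓ
    intro n A h
    cases n with
    | zero =>
      obtain rfl : B = A := by simpa using h
      exact ⟨i, .weaken hB hB⟩
    | succ n =>
      obtain ⟨j, hA⟩ := ih hΓ (n := n) (by simpa using h)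
      have := HasType.weaken hA hB
      rw [Tm.lift, Tm.rename_rename] at this
      exact ⟨j, this⟩

theorem inst {Γ : List Tm} {A B : Tm} {b a : Tm} (hb : HasType (A :: Γ) b B)
    (ha : HasType Γ a A) : HasType Γ (b.inst a) (B.inst a) := by
  refine hb.subst ha.wf fun n C hC ↦ ?_
  cases n with
  | zero =>
    obtain rfl : A = C := by simpa using hC
    simp only [Tm.subst_rename]
    have : (Tm.single a ∘ fun n ↦ n + (0 + 1)) = Tm.var := rfl
    rw [this, Tm.subst_var]
    exact ha
  | succ n =>
    have := var_of_getElem? ha.wf (n := n) (by simpa using hC)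
    rw [Tm.rename_eq_subst] at this
    rw [Tm.subst_rename]
    exact this

/-- Only `pi`, `cumul`, `conv` and `weaken` can end a derivation whose subject is a product, and the
middle two leave the subject unchanged. The result makes applications checkable without injectivity
of products up to conversion: a product already known to be a type has types as its domain and
codomain. -/
theorem pi_inv {Γ : List Tm} {A B T : Tm} (h : HasType Γ (.pi A B) T) :
    ∃ i, HasType Γ A (.univ i) ∧ HasType (A :: Γ) B (.univ i) := by
  generalize e : Tm.pi A B = t at h
  induction h generalizing A B with
  | pi hA hB => cases e; exact ⟨_, hA, hB⟩
  | cumul _ ih => exact ih e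
  | conv _ _ _ ih => exact ih e
  | @weaken Γ t B₀ C i h hC ih =>
    cases t with
    | pi A₀ B₀ =>
      cases e
      obtain ⟨j, hA, hB⟩ := ih rfl
      refine ⟨j, .weaken hA hC, ?_⟩
      have hA' := HasType.weaken hA hC
      -- The codomain has to be weakened below its own bound variable, which the rule `weaken` does
      -- not provide; it is obtained as a substitution of variables.
      have : SubstTyped (C :: Γ) (fun n ↦ .var (n + 1)) Γ := by
        intro n D hD
        have := HasType.weaken (var_of_getElem? hA.wf hD) hC
        rw [Tm.lift, Tm.lift, Tm.rename_eq_subst _ Nat.succ, Tm.rename_eq_subst _ Nat.succ] at this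
        exact this
      have hs : Tm.subst (fun n ↦ .var (n + 1)) A₀ = A₀.lift := (Tm.rename_eq_subst _ _).symm
      have h' := this.up (A := A₀) (i := j) (by rw [hs]; exact hA')
      rw [Tm.upSub_var_comp, hs] at h'
      have := hB.subst (Δ := A₀.lift :: C :: Γ) ⟨⟨hA.wf, _, hC⟩, _, hA'⟩ h'
      rw [← Tm.rename_eq_subst] at this
      exact this
    | _ => cases e
  | _ => cases e

theorem cumul_le {Γ : List Tm} {A : Tm} {i j : ℕ} (h : HasType Γ A (.univ i)) (hij : i ≤ j) :
    HasType Γ A (.univ j) := by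
  induction hij with
  | refl => exact h
  | step _ ih => exact .cumul ih

end HasType

/-! ### A type checker for terms with annotated abstractions and global definitions

The functions that the type checker consists of are defined by recursors, which the kernel
evaluates faster than the compiled forms of pattern matching. -/

noncomputable section

def Fast.and (a b : Bool) : Bool := Bool.casesOn a false b

def Fast.or (a b : Bool) : Bool := Bool.casesOn a b true

def Fast.ifb {R : Type} (c : Bool) (a b : R) : R := Bool.casesOn c b a

def Fast.bind {R S : Type} (o : Option R) (f : R → Option S) : Option S :=
  Option.casesOn o none f

/-- The entry of a list at a given position. -/
def Fast.get {R : Type} (l : List R) : ℕ → Option R :=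
  List.rec (fun _ ↦ none) (fun a _ ih n ↦ Nat.casesOn n (some a) fun n ↦ ih n) l

def Fast.isNil {R : Type} (l : List R) : Bool := List.casesOn l true fun _ _ ↦ false

/-- A number for each constant, apart from the level of truncations. -/
def Const.code (c : Const) : ℕ := c.ctorIdx

/-- The level of a constant that belongs to a truncation. -/
def Const.level (c : Const) : ℕ :=
  match c with
  | .trunc n | .truncMk n | .truncIs n | .truncInd n => n
  | _ => 0

def Const.same (c c' : Const) : Bool :=
  Fast.and (Nat.beq c.code c'.code) (Nat.beq c.level c'.level)

/-- Terms with annotated abstractions and references to global definitions. Universe levels are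
relative to a fixed base level. -/
inductive Core : Type
  | var (n : ℕ)
  | univ (k : ℕ)
  | pi (A B : Core)
  | lam (A t : Core)
  | app (f a : Core)
  | con (c : Const)
  | gbl (n : ℕ)

open Fast

namespace Core

/-- The raw term described by an annotated term, for given values of the global definitions and a
given base level. -/
def den (ρ : ℕ → Tm) (i : ℕ) : Core → Tm
  | var n => .var n
  | univ k => .univ (i + k)
  | pi A B => .pi (den ρ i A) (den ρ i B)
  | lam _ t => .lam (den ρ i t)
  | app f a => .app (den ρ i f) (den ρ i a)
  | con c => .con c
  | gbl n => ρ n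

/-! #### Case distinctions -/

section

variable {R : Type} (t : Core)

def asVar (k : ℕ → R) (d : R) : R :=
  Core.casesOn t k (fun _ ↦ d) (fun _ _ ↦ d) (fun _ _ ↦ d) (fun _ _ ↦ d) (fun _ ↦ d) (fun _ ↦ d)

def asUniv (k : ℕ → R) (d : R) : R :=
  Core.casesOn t (fun _ ↦ d) k (fun _ _ ↦ d) (fun _ _ ↦ d) (fun _ _ ↦ d) (fun _ ↦ d) (fun _ ↦ d)

def asPi (k : Core → Core → R) (d : R) : R :=
  Core.casesOn t (fun _ ↦ d) (fun _ ↦ d) k (fun _ _ ↦ d) (fun _ _ ↦ d) (fun _ ↦ d) (fun _ ↦ d)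

def asLam (k : Core → Core → R) (d : R) : R :=
  Core.casesOn t (fun _ ↦ d) (fun _ ↦ d) (fun _ _ ↦ d) k (fun _ _ ↦ d) (fun _ ↦ d) (fun _ ↦ d)

def asApp (k : Core → Core → R) (d : R) : R :=
  Core.casesOn t (fun _ ↦ d) (fun _ ↦ d) (fun _ _ ↦ d) (fun _ _ ↦ d) k (fun _ ↦ d) (fun _ ↦ d)

def asCon (k : Const → R) (d : R) : R :=
  Core.casesOn t (fun _ ↦ d) (fun _ ↦ d) (fun _ _ ↦ d) (fun _ _ ↦ d) (fun _ _ ↦ d) k (fun _ ↦ d)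

def asGbl (k : ℕ → R) (d : R) : R :=
  Core.casesOn t (fun _ ↦ d) (fun _ ↦ d) (fun _ _ ↦ d) (fun _ _ ↦ d) (fun _ _ ↦ d) (fun _ ↦ d) k

end

/-! #### Substitution and comparison -/

def ofTm (t : Tm) : Core :=
  Tm.rec var univ (fun _ _ A B ↦ pi A B) (fun _ t ↦ lam (univ 0) t) (fun _ _ f a ↦ app f a) con t

def apps (f : Core) (as : List Core) : Core :=
  List.rec (motive := fun _ ↦ Core → Core) (fun f ↦ f) (fun a _ ih f ↦ ih (app f a)) as f

/-- Raise the variables from `c` on by `k`. -/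
def shift (k : ℕ) (t : Core) : ℕ → Core :=
  Core.rec (fun n c ↦ ifb (Nat.blt n c) (var n) (var (Nat.add n k))) (fun l _ ↦ univ l)
    (fun _ _ A B c ↦ pi (A c) (B (Nat.succ c))) (fun _ _ A t c ↦ lam (A c) (t (Nat.succ c)))
    (fun _ _ f a c ↦ app (f c) (a c)) (fun c _ ↦ con c) (fun n _ ↦ gbl n) t

/-- Replace the variable `k` by `a`, which lives outside the `k` innermost binders. -/
def instAt (a t : Core) : ℕ → Core :=
  Core.rec
    (fun n k ↦ ifb (Nat.blt n k) (var n) (ifb (Nat.beq n k) (ifb (Nat.beq k 0) a (shift k a 0))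
      (var (Nat.pred n))))
    (fun l _ ↦ univ l)
    (fun _ _ A B k ↦ pi (A k) (B (Nat.succ k))) (fun _ _ A t k ↦ lam (A k) (t (Nat.succ k)))
    (fun _ _ f b k ↦ app (f k) (b k)) (fun c _ ↦ con c) (fun n _ ↦ gbl n) t

/-- Syntactic equality up to annotations. -/
def same (t : Core) : Core → Bool :=
  Core.rec (fun n u ↦ asVar u (fun m ↦ Nat.beq n m) false)
    (fun n u ↦ asUniv u (fun m ↦ Nat.beq n m) false)
    (fun _ _ A B u ↦ asPi u (fun A' B' ↦ Fast.and (A A') (B B')) false)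
    (fun _ _ _ t u ↦ asLam u (fun _ t' ↦ t t') false)
    (fun _ _ f a u ↦ asApp u (fun f' a' ↦ Fast.and (f f') (a a')) false)
    (fun c u ↦ asCon u (fun c' ↦ Const.same c c') false)
    (fun n u ↦ asGbl u (fun m ↦ Nat.beq n m) false) t

def closedAt (t : Core) : ℕ → Bool :=
  Core.rec (fun n d ↦ Nat.blt n d) (fun _ _ ↦ true)
    (fun _ _ A B d ↦ Fast.and (A d) (B (Nat.succ d))) (fun _ _ _ t d ↦ t (Nat.succ d))
    (fun _ _ f a d ↦ Fast.and (f d) (a d)) (fun _ _ ↦ true) (fun _ _ ↦ true) t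

/-- All references are to global definitions with index less than `N`. -/
def gblBelow (N : ℕ) (t : Core) : Bool :=
  Core.rec (fun _ ↦ true) (fun _ ↦ true) (fun _ _ A B ↦ Fast.and A B) (fun _ _ _ t ↦ t)
    (fun _ _ f a ↦ Fast.and f a) (fun _ ↦ true) (fun n ↦ Nat.blt n N) t

/-! #### Reduction and conversion -/

/-- The computation rules of the eliminators; `w` computes weak head normal forms. -/
def iota (w : Core → Core × List Core) (c : Const) (as : List Core) :
    Option (Core × List Core) :=
  match c with
  | .sumInd => match as with
    | _ :: _ :: _ :: f :: g :: x :: as => match w x with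
      | (con .inl, [_, _, a]) => some (f, a :: as)
      | (con .inr, [_, _, b]) => some (g, b :: as)
      | _ => none
    | _ => none
  | .listInd => match as with
    | A :: C :: z :: s :: l :: as => match w l with
      | (con .nil, [_]) => some (z, as)
      | (con .cons, [_, a, l]) => some (s, a :: l :: apps (con .listInd) [A, C, z, s, l] :: as)
      | _ => none
    | _ => none
  | .idInd => match as with
    | _ :: _ :: c :: _ :: _ :: p :: as => match w p with
      | (con .refl, [_, z]) => some (c, z :: as)
      | _ => none
    | _ => none
  | .truncInd n => match as with
    | _ :: _ :: _ :: f :: x :: as => match w x with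
      | (con (.truncMk m), [_, x]) => if n = m then some (f, x :: as) else none
      | _ => none
    | _ => none
  | .freeInd => match as with
    | A :: P :: u :: c :: i :: m₁ :: m₂ :: m :: x :: as => match w x with
      | (con .fUnit, [_]) => some (u, as)
      | (con .fCons, [_, a, x]) =>
        some (c, a :: x :: apps (con .freeInd) [A, P, u, c, i, m₁, m₂, m, x] :: as)
      | (con .fICons, [_, a, x]) =>
        some (i, a :: x :: apps (con .freeInd) [A, P, u, c, i, m₁, m₂, m, x] :: as)
      | _ => none
    | _ => none
  | .approxInd => match as with
    | _ :: _ :: _ :: e :: _ :: _ :: _ :: n :: as => match w n with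
      | (con .aEta, [_, l]) => some (e, l :: as)
      | _ => none
    | _ => none
  | _ => none

end Core

/-- A global definition. -/
structure Entry where
  ty : Core
  body : Core

def Entry.getTy (e : Entry) : Core := Entry.casesOn e fun ty _ ↦ ty

def Entry.getBody (e : Entry) : Core := Entry.casesOn e fun _ body ↦ body

namespace Core

/-- The weak head normal form of `apps t as`, as a head with a list of arguments. -/
def whnf (E : ℕ → Option Entry) (n : ℕ) : Core → List Core → Core × List Core :=
  Nat.rec (fun t as ↦ (t, as))
    (fun _ ih t as ↦ Core.casesOn t (fun n ↦ (var n, as)) (fun k ↦ (univ k, as))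
      (fun A B ↦ (pi A B, as))
      (fun A b ↦ List.casesOn as (lam A b, []) fun a as ↦ ih (instAt a b 0) as)
      (fun f a ↦ ih f (a :: as))
      (fun c ↦ Option.casesOn (iota (fun x ↦ ih x []) c as) (con c, as)
        fun r ↦ Prod.casesOn r fun t as ↦ ih t as)
      (fun k ↦ Option.casesOn (E k) (gbl k, as) fun e ↦ ih e.getBody as)) n

def all₂ (r : Core → Core → Bool) (as : List Core) : List Core → Bool :=
  List.rec (fun bs ↦ isNil bs)
    (fun a _ ih bs ↦ List.casesOn bs false fun b bs ↦ Fast.and (r a b) (ih bs)) as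

/-- Comparison of the heads and the arguments of two applications. -/
def spine (r : Core → Core → Bool) (t : Core) : Core → Bool :=
  Core.rec (fun n u ↦ asVar u (fun m ↦ Nat.beq n m) false) (fun _ _ ↦ false)
    (fun _ _ _ _ _ ↦ false) (fun _ _ _ _ _ ↦ false)
    (fun _ a f _ u ↦ asApp u (fun f' a' ↦ Fast.and (f f') (r a a')) false)
    (fun c u ↦ asCon u (fun c' ↦ Const.same c c') false)
    (fun n u ↦ asGbl u (fun m ↦ Nat.beq n m) false) t

/-- Comparison of weak head normal forms. -/
def convHead (r : Core → Core → Bool) (h : Core) (as : List Core) (h' : Core) (bs : List Core) :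
    Bool :=
  asLam h
    (fun _ b ↦ Fast.and (isNil as) (asLam h' (fun _ b' ↦ Fast.and (isNil bs) (r b b'))
      (r b (app (shift 1 (apps h' bs) 0) (var 0)))))
    (asLam h' (fun _ b' ↦ Fast.and (isNil bs) (r (app (shift 1 (apps h as) 0) (var 0)) b'))
      (asPi h
        (fun A B ↦ Fast.and (isNil as)
          (asPi h' (fun A' B' ↦ Fast.and (isNil bs) (Fast.and (r A A') (r B B'))) false))
        (Fast.and (same h h') (all₂ r as bs))))

/-- The cheap tests come first: syntactic equality, then comparison along the application spine,
which leaves definitions folded; reduction is the last resort. Fuel costs only completeness, since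
running out of it leaves the syntactic test. -/
def conv (E : ℕ → Option Entry) (n : ℕ) : Core → Core → Bool :=
  Nat.rec (fun t u ↦ same t u)
    (fun n ih t u ↦ Fast.or (same t u) (Fast.or (spine ih t u)
      (Prod.casesOn (whnf E n t []) fun h as ↦ Prod.casesOn (whnf E n u []) fun h' bs ↦
        convHead ih h as h' bs))) n

/-! #### Type inference -/

/-- The level of a universe. -/
def sort (E : ℕ → Option Entry) (n : ℕ) (T : Core) : Option ℕ :=
  asUniv T some (Prod.casesOn (whnf E n T []) fun h as ↦ ifb (isNil as) (asUniv h some none) none)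

/-- The type of a constant, found at its position in the list of global definitions. -/
def constType (E : ℕ → Option Entry) (idx : Const → ℕ) (c : Const) : Option Core :=
  Fast.bind (E (idx c)) fun e ↦
    asCon e.getBody (fun c' ↦ ifb (Const.same c c') (some e.getTy) none) none

/-- The type of `app f a` for `f` of type `T` and `a` of type `A'`; `rec` infers types. -/
def appType (E : ℕ → Option Entry) (n : ℕ) (rec : Core → Option Core) (T a A' : Core) :
    Option Core :=
  asPi T (fun A B ↦ ifb (conv E n A' A) (some (instAt a B 0)) none)
    (Prod.casesOn (whnf E n T []) fun h as ↦ ifb (isNil as)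
      (asPi h
        (fun A B ↦ Fast.bind (rec h) fun S ↦ Fast.bind (sort E n S) fun _ ↦
          ifb (conv E n A' A) (some (instAt a B 0)) none)
        none)
      none)

/-- One layer of type inference, where `rec` is used for types that have been reduced. -/
def inferStep (E : ℕ → Option Entry) (idx : Const → ℕ) (n : ℕ)
    (rec : List Core → Core → Option Core) (t : Core) : List Core → Option Core :=
  Core.rec
    (fun k Γ ↦ Fast.bind (Fast.get Γ k) fun A ↦ some (shift (Nat.succ k) A 0))
    (fun k _ ↦ some (univ (Nat.succ k)))
    (fun A _ inferA inferB Γ ↦ Fast.bind (inferA Γ) fun S ↦ Fast.bind (sort E n S) fun i ↦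
      Fast.bind (inferB (A :: Γ)) fun S' ↦ Fast.bind (sort E n S') fun j ↦
        some (univ (ifb (Nat.blt i j) j i)))
    (fun A _ inferA infer_t Γ ↦ Fast.bind (inferA Γ) fun S ↦ Fast.bind (sort E n S) fun _ ↦
      Fast.bind (infer_t (A :: Γ)) fun B ↦ some (pi A B))
    (fun _ a infer_f infer_a Γ ↦ Fast.bind (infer_f Γ) fun T ↦ Fast.bind (infer_a Γ) fun A' ↦
      appType E n (rec Γ) T a A')
    (fun c _ ↦ constType E idx c)
    (fun k _ ↦ Fast.bind (E k) fun e ↦ some e.getTy) t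

/-- Within one layer inference is structural in the term. The bound `m` counts only the nested calls
on types produced by reduction, which are not subterms. -/
def infer (E : ℕ → Option Entry) (idx : Const → ℕ) (n m : ℕ) : List Core → Core → Option Core :=
  Nat.rec (fun _ _ ↦ none) (fun _ ih Γ t ↦ inferStep E idx n ih t Γ) m

/-- The closed term `A` is a type. -/
def isType (E : ℕ → Option Entry) (idx : Const → ℕ) (n : ℕ) (A : Core) : Bool :=
  Option.casesOn (infer E idx n 9 [] A) false fun S ↦
    Option.casesOn (sort E n S) false fun _ ↦ true

/-- The closed term `t` has the type `A`. -/
def check (E : ℕ → Option Entry) (idx : Const → ℕ) (n : ℕ) (t A : Core) : Bool :=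
  Option.casesOn (infer E idx n 9 [] t) false fun T ↦ conv E n T A

end Core

end

/-! ### Soundness of the type checker -/

theorem Const.eq_of_same {c c' : Const} (h : c.same c' = true) : c = c' := by
  cases c <;> cases c' <;> simp_all [Const.same, Fast.and, Const.code, Const.level, Const.ctorIdx]

@[simp]
theorem Fast.and_eq_true {a b : Bool} : Fast.and a b = true ↔ a = true ∧ b = true := by
  cases a <;> simp [Fast.and]

@[simp]
theorem Fast.or_eq_true {a b : Bool} : Fast.or a b = true ↔ a = true ∨ b = true := by
  cases a <;> simp [Fast.or]

theorem Fast.ifb_eq {R : Type} (c : Bool) (a b : R) : Fast.ifb c a b = bif c then a else b := by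
  cases c <;> rfl

theorem Fast.bind_eq_some {R S : Type} {o : Option R} {f : R → Option S} {s : S} :
    Fast.bind o f = some s ↔ ∃ r, o = some r ∧ f r = some s := by
  cases o <;> simp [Fast.bind]

@[simp]
theorem Fast.ifb_eq_some {R : Type} {c : Bool} {a : R} {o : Option R} :
    Fast.ifb c o none = some a ↔ c = true ∧ o = some a := by
  cases c <;> simp [Fast.ifb]

theorem Fast.get_eq {R : Type} (l : List R) : ∀ n, Fast.get l n = l[n]? := by
  induction l with
  | nil => intro n; rfl
  | cons a l ih =>
    intro n
    cases n with
    | zero => rfl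
    | succ n => exact (ih n).trans (by simp)

theorem Fast.isNil_eq_true {R : Type} {l : List R} : Fast.isNil l = true ↔ l = [] := by
  cases l <;> simp [Fast.isNil]

theorem blt_eq_decide (n m : ℕ) : Nat.blt n m = decide (n < m) := by
  rw [Bool.eq_iff_iff]; simp

theorem beq_eq_decide (n m : ℕ) : Nat.beq n m = decide (n = m) := by
  rw [Bool.eq_iff_iff]; simp

/-! ### Annotated terms read as raw terms -/

namespace Core

theorem shift_var (k n c : ℕ) :
    shift k (var n) c = bif Nat.blt n c then var n else var (n + k) := Fast.ifb_eq _ _ _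

theorem shift_pi (k c : ℕ) (A B : Core) :
    shift k (pi A B) c = pi (shift k A c) (shift k B (c + 1)) := rfl

theorem shift_lam (k c : ℕ) (A t : Core) :
    shift k (lam A t) c = lam (shift k A c) (shift k t (c + 1)) := rfl

theorem shift_app (k c : ℕ) (f a : Core) :
    shift k (app f a) c = app (shift k f c) (shift k a c) := rfl

theorem shift_gbl (k c n : ℕ) : shift k (gbl n) c = gbl n := rfl

theorem shift_zero (t : Core) : ∀ c, shift 0 t c = t := by
  induction t with
  | var n =>
    intro c
    rw [shift_var, Nat.add_zero]
    cases Nat.blt n c <;> rfl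
  | pi A B hA hB => intro c; rw [shift_pi, hA, hB]
  | lam A t hA ht => intro c; rw [shift_lam, hA, ht]
  | app f a hf ha => intro c; rw [shift_app, hf, ha]
  | _ => intros; rfl

theorem instAt_var (a : Core) (n k : ℕ) :
    instAt a (var n) k = bif Nat.blt n k then var n else
      bif Nat.beq n k then shift k a 0 else var (n - 1) := by
  have h : Fast.ifb (Nat.beq k 0) a (shift k a 0) = shift k a 0 := by
    cases k with
    | zero => exact (shift_zero a 0).symm
    | succ k => rfl
  rw [← Fast.ifb_eq, ← Fast.ifb_eq, ← h]
  rfl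

theorem instAt_pi (a A B : Core) (k : ℕ) :
    instAt a (pi A B) k = pi (instAt a A k) (instAt a B (k + 1)) := rfl

theorem instAt_lam (a A t : Core) (k : ℕ) :
    instAt a (lam A t) k = lam (instAt a A k) (instAt a t (k + 1)) := rfl

theorem instAt_app (a f b : Core) (k : ℕ) :
    instAt a (app f b) k = app (instAt a f k) (instAt a b k) := rfl

theorem instAt_gbl (a : Core) (n k : ℕ) : instAt a (gbl n) k = gbl n := rfl

theorem same_pi (A B A' B' : Core) :
    same (pi A B) (pi A' B') = Fast.and (same A A') (same B B') := rfl

theorem same_app (A B A' B' : Core) :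
    same (app A B) (app A' B') = Fast.and (same A A') (same B B') := rfl

theorem closedAt_pi (A B : Core) (d : ℕ) :
    (pi A B).closedAt d = Fast.and (A.closedAt d) (B.closedAt (d + 1)) := rfl

theorem closedAt_app (f a : Core) (d : ℕ) :
    (app f a).closedAt d = Fast.and (f.closedAt d) (a.closedAt d) := rfl

theorem gblBelow_pi (A B : Core) (N : ℕ) :
    (pi A B).gblBelow N = Fast.and (A.gblBelow N) (B.gblBelow N) := rfl

theorem gblBelow_app (f a : Core) (N : ℕ) :
    (app f a).gblBelow N = Fast.and (f.gblBelow N) (a.gblBelow N) := rfl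

theorem gblBelow_gbl (n N : ℕ) : (gbl n).gblBelow N = Nat.blt n N := rfl

theorem den_apps (ρ : ℕ → Tm) (i : ℕ) (as : List Core) : ∀ f : Core,
    den ρ i (apps f as) = Tm.apps (den ρ i f) (as.map (den ρ i)) := by
  induction as with
  | nil => intro f; rfl
  | cons a as ih => intro f; exact ih _

theorem closedAt_den {ρ : ℕ → Tm} (hρ : ∀ n, (ρ n).closedAt 0 = true) (i : ℕ) (t : Core) :
    ∀ d, t.closedAt d = true → (den ρ i t).closedAt d = true := by
  have mono : ∀ (t : Tm) (d e : ℕ), d ≤ e → t.closedAt d = true → t.closedAt e = true := by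
    intro t
    induction t with
    | var n => intro d e h; simp only [Tm.closedAt, Nat.blt_eq]; omega
    | pi A B hA hB =>
      intro d e h
      simp only [Tm.closedAt, Bool.and_eq_true]
      exact And.imp (hA _ _ h) (hB _ _ (by omega))
    | lam t ht => intro d e h; exact ht _ _ (by omega)
    | app f a hf ha =>
      intro d e h
      simp only [Tm.closedAt, Bool.and_eq_true]
      exact And.imp (hf _ _ h) (ha _ _ h)
    | _ => intros; rfl
  induction t with
  | pi A B hA hB =>
    intro d
    simp only [closedAt_pi, den, Tm.closedAt, Bool.and_eq_true, Fast.and_eq_true]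
    exact And.imp (hA _) (hB _)
  | lam A t _ ht => intro d; exact ht _
  | app f a hf ha =>
    intro d
    simp only [closedAt_app, den, Tm.closedAt, Bool.and_eq_true, Fast.and_eq_true]
    exact And.imp (hf _) (ha _)
  | gbl n => intro d _; exact mono _ 0 d (by omega) (hρ n)
  | _ => intro d h; exact h

theorem den_congr_of_gblBelow {ρ ρ' : ℕ → Tm} {N : ℕ} (h : ∀ n < N, ρ n = ρ' n) (i : ℕ) (t : Core) :
    t.gblBelow N = true → den ρ i t = den ρ' i t := by
  induction t with
  | pi A B hA hB =>
    simp only [gblBelow_pi, den, Fast.and_eq_true]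
    intro h; rw [hA h.1, hB h.2]
  | lam A t _ ht => intro h; simp only [den]; rw [ht h]
  | app A B hA hB =>
    simp only [gblBelow_app, den, Fast.and_eq_true]
    intro h; rw [hA h.1, hB h.2]
  | gbl n => intro hn; exact h n (by simpa [gblBelow_gbl] using hn)
  | _ => intro _; rfl

theorem gblBelow_mono {N M : ℕ} (h : N ≤ M) (t : Core) :
    t.gblBelow N = true → t.gblBelow M = true := by
  induction t with
  | pi A B hA hB => simp only [gblBelow_pi, Fast.and_eq_true]; exact And.imp hA hB
  | lam A t _ ht => exact ht
  | app A B hA hB => simp only [gblBelow_app, Fast.and_eq_true]; exact And.imp hA hB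
  | gbl n => simp only [gblBelow_gbl, Nat.blt_eq]; omega
  | _ => intro _; rfl

/-- Global references are ignored by shifting, which is correct because their values are closed and
hence fixed by every renaming. -/
theorem den_shift {ρ : ℕ → Tm} (hρ : ∀ n, (ρ n).closedAt 0 = true) (i : ℕ)
    (k : ℕ) (t : Core) : ∀ c,
    den ρ i (shift k t c) = (den ρ i t).rename (fun n ↦ if n < c then n else n + k) := by
  have up : ∀ c, Tm.upRen (fun n ↦ if n < c then n else n + k) =
      fun n ↦ if n < c + 1 then n else n + k := by
    intro c; funext n
    cases n with
    | zero => simp [Tm.upRen]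
    | succ n => simp only [Tm.upRen]; split_ifs <;> omega
  induction t with
  | var n =>
    intro c
    by_cases h : n < c <;> simp [shift_var, den, Tm.rename, h, blt_eq_decide]
  | pi A B hA hB => intro c; simp only [shift_pi, den, Tm.rename, hA, hB, up]
  | lam A t _ ht => intro c; simp only [shift_lam, den, Tm.rename, ht, up]
  | app f a hf ha => intro c; simp only [shift_app, den, Tm.rename, hf, ha]
  | gbl n =>
    intro c
    simp only [shift_gbl, den, Tm.rename_eq_subst, Tm.subst_of_closed (hρ n)]
  | _ => intros; rfl

theorem den_shift_zero {ρ : ℕ → Tm} (hρ : ∀ n, (ρ n).closedAt 0 = true) (i : ℕ)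
    (k : ℕ) (t : Core) :
    den ρ i (shift k t 0) = (den ρ i t).rename (· + k) := by
  simp [den_shift hρ]

theorem den_instAt {ρ : ℕ → Tm} (hρ : ∀ n, (ρ n).closedAt 0 = true) (i : ℕ)
    (a : Core) (t : Core) : ∀ k,
    den ρ i (instAt a t k) = (den ρ i t).subst
      (fun n ↦ if n < k then .var n else if n = k then (den ρ i a).rename (· + k)
        else .var (n - 1)) := by
  have up : ∀ k, Tm.upSub (fun n ↦ if n < k then .var n else
        if n = k then (den ρ i a).rename (· + k) else .var (n - 1)) =
      fun n ↦ if n < k + 1 then .var n else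
        if n = k + 1 then (den ρ i a).rename (· + (k + 1)) else .var (n - 1) := by
    intro k; funext n
    cases n with
    | zero => simp [Tm.upSub]
    | succ n =>
      simp only [Tm.upSub]
      split_ifs <;> first | omega | skip
      · rfl
      · rw [Tm.lift, Tm.rename_rename]; rfl
      · simp only [Tm.lift, Tm.rename]; congr 1; omega
  induction t with
  | var n =>
    intro k
    by_cases h : n < k
    · simp [instAt_var, den, Tm.subst, h, blt_eq_decide]
    · by_cases h' : n = k
      · simp [instAt_var, den, Tm.subst, h', den_shift hρ, blt_eq_decide]
      · simp [instAt_var, den, Tm.subst, h, h', blt_eq_decide, beq_eq_decide]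
  | pi A B hA hB => intro c; simp only [instAt_pi, den, Tm.subst, hA, hB, up]
  | lam A t _ ht => intro c; simp only [instAt_lam, den, Tm.subst, ht, up]
  | app f a hf ha => intro c; simp only [instAt_app, den, Tm.subst, hf, ha]
  | gbl n =>
    intro c
    simp only [instAt_gbl, den, Tm.subst_of_closed (hρ n)]
  | _ => intros; rfl

theorem den_inst {ρ : ℕ → Tm} (hρ : ∀ n, (ρ n).closedAt 0 = true) (i : ℕ)
    (a t : Core) : den ρ i (instAt a t 0) = (den ρ i t).inst (den ρ i a) := by
  rw [den_instAt hρ, Tm.inst]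
  congr 1
  funext n
  cases n with
  | zero => simpa [Tm.single] using (Tm.rename_eq_subst _ _).trans (Tm.subst_var _)
  | succ n => simp [Tm.single]

/-- `same` skips the annotations of abstractions, and `den` erases them. -/
theorem den_eq_of_same {ρ : ℕ → Tm} {i : ℕ} (t : Core) : ∀ u, same t u = true →
    den ρ i t = den ρ i u := by
  induction t with
  | var n => intro u h; cases u <;> simp_all [same, asVar, den]
  | univ n => intro u h; cases u <;> simp_all [same, asUniv, den]
  | gbl n => intro u h; cases u <;> simp_all [same, asGbl, den]
  | con c =>
    intro u h
    cases u with
    | con c' => rw [show c = c' from Const.eq_of_same h]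
    | _ => cases h
  | pi A B hA hB =>
    intro u h
    cases u with
    | pi A' B' =>
      rw [same_pi, Fast.and_eq_true] at h
      simp only [den, hA _ h.1, hB _ h.2]
    | _ => cases h
  | lam A B hA hB =>
    intro u h
    cases u with
    | lam A' B' => simp only [den, hB _ h]
    | _ => cases h
  | app A B hA hB =>
    intro u h
    cases u with
    | app A' B' =>
      rw [same_app, Fast.and_eq_true] at h
      simp only [den, hA _ h.1, hB _ h.2]
    | _ => cases h

/-- The application of the head to the arguments. -/
def denPair (ρ : ℕ → Tm) (i : ℕ) (p : Core × List Core) : Tm :=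
  Tm.apps (den ρ i p.1) (p.2.map (den ρ i))

/-! ### Soundness of reduction and conversion -/

theorem conv_iota {ρ : ℕ → Tm} {i : ℕ} {w : Core → Core × List Core}
    (hw : ∀ x, Conv (den ρ i x) (denPair ρ i (w x))) {c : Const} {as : List Core}
    {r : Core × List Core} (h : iota w c as = some r) :
    Conv (denPair ρ i (con c, as)) (denPair ρ i r) := by
  -- The argument list is split at the scrutinee `x`: replacing `x` by its weak head normal form is
  -- a congruence, the computation rule then fires on the part up to `x`, and the surplus arguments
  -- `post` are carried along.
  have key : ∀ (pre post : List Core) (x : Core) (v : Core × List Core) (r : Tm), w x = v →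
      Conv (Tm.apps (.con c) (pre.map (den ρ i) ++ [denPair ρ i v])) r →
      Conv (denPair ρ i (con c, pre ++ x :: post)) (Tm.apps r (post.map (den ρ i))) := by
    intro pre post x v r hv hr
    have hx := hw x
    rw [hv] at hx
    have : denPair ρ i (con c, pre ++ x :: post) =
        Tm.apps (Tm.apps (.con c) (pre.map (den ρ i) ++ [den ρ i x])) (post.map (den ρ i)) := by
      simp [denPair, Tm.apps, den]
    rw [this]
    refine Conv.apps (by rw [List.forall₂_same]; intro x _; exact .refl x) (.trans ?_ hr)
    simp only [Tm.apps, List.foldl_append, List.foldl_cons, List.foldl_nil]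
    exact .app (.refl _) hx
  unfold iota at h
  split at h
  · split at h
    · split at h
      · rename_i hv; cases h; refine key [_, _, _, _, _] _ _ _ _ hv ?_; exact (.inl ..)
      · rename_i hv; cases h; refine key [_, _, _, _, _] _ _ _ _ hv ?_; exact (.inr ..)
      · cases h
    · cases h
  · split at h
    · split at h
      · rename_i hv; cases h; refine key [_, _, _, _] _ _ _ _ hv ?_; exact (.nil ..)
      · rename_i hv; cases h; refine key [_, _, _, _] _ _ _ _ hv ?_; exact (.cons ..)
      · cases h
    · cases h
  · split at h
    · split at h
      · rename_i hv; cases h; refine key [_, _, _, _, _] _ _ _ _ hv ?_; exact (.id ..)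
      · cases h
    · cases h
  · split at h
    · split at h
      · split at h
        · subst_vars
          rename_i hv; cases h; refine key [_, _, _, _] _ _ _ _ hv ?_; exact (.trunc ..)
        · cases h
      · cases h
    · cases h
  · split at h
    · split at h
      · rename_i hv; cases h; refine key [_, _, _, _, _, _, _, _] _ _ _ _ hv ?_; exact (.fUnit ..)
      · rename_i hv; cases h; refine key [_, _, _, _, _, _, _, _] _ _ _ _ hv ?_; exact (.fCons ..)
      · rename_i hv; cases h; refine key [_, _, _, _, _, _, _, _] _ _ _ _ hv ?_; exact (.fICons ..)
      · cases h
    · cases h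
  · split at h
    · split at h
      · rename_i hv; cases h; refine key [_, _, _, _, _, _, _] _ _ _ _ hv ?_; exact (.aEta ..)
      · cases h
    · cases h
  · cases h

/-- The values `ρ` of the global definitions agree with the definitions in `E`, and have the types
stated there. -/
structure EnvOK (E : ℕ → Option Entry) (ρ : ℕ → Tm) (i : ℕ) : Prop where
  closed : ∀ n, (ρ n).closedAt 0 = true
  closed_ty : ∀ {n e}, E n = some e → (den ρ i e.getTy).closedAt 0 = true
  body : ∀ {n e}, E n = some e → ρ n = den ρ i e.getBody
  hasType : ∀ {n e}, E n = some e → HasType [] (ρ n) (den ρ i e.getTy)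
  isType : ∀ {n e}, E n = some e → ∃ j, HasType [] (den ρ i e.getTy) (.univ j)

theorem conv_whnf {E : ℕ → Option Entry} {ρ : ℕ → Tm} {i : ℕ} (hE : EnvOK E ρ i)
    (n : ℕ) : ∀ (t : Core) (as : List Core),
    Conv (denPair ρ i (t, as)) (denPair ρ i (whnf E n t as)) := by
  have hrefl : ∀ l : List Tm, List.Forall₂ Conv l l := by
    intro l; rw [List.forall₂_same]; intro x _; exact .refl x
  induction n with
  | zero => intro t as; exact .refl _
  | succ n ih =>
    intro t as
    cases t with
    | app f a => exact ih f (a :: as)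
    | lam A b =>
      cases as with
      | nil => exact .refl _
      | cons a as =>
        refine .trans ?_ (ih (instAt a b 0) as)
        rw [denPair, denPair, den_inst hE.closed]
        exact Conv.apps (hrefl _) (.beta _ _)
    | gbl k =>
      cases h : E k with
      | some e =>
        have hw : whnf E (n + 1) (gbl k) as = whnf E n e.getBody as := by
          change Option.casesOn (motive := fun _ ↦ Core × List Core) (E k) (gbl k, as)
            (fun e ↦ whnf E n e.getBody as) = _
          rw [h]
        rw [hw]
        refine .trans ?_ (ih e.getBody as)
        rw [denPair, denPair, den, hE.body h]
        exact .refl _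
      | none =>
        have hw : whnf E (n + 1) (gbl k) as = (gbl k, as) := by
          change Option.casesOn (motive := fun _ ↦ Core × List Core) (E k) (gbl k, as)
            (fun e ↦ whnf E n e.getBody as) = _
          rw [h]
        rw [hw]
        exact .refl _
    | con c =>
      cases h : iota (fun x ↦ whnf E n x []) c as with
      | some r =>
        have hw : whnf E (n + 1) (con c) as = whnf E n r.1 r.2 := by
          change Option.casesOn (motive := fun _ ↦ Core × List Core)
            (iota (fun x ↦ whnf E n x []) c as) (con c, as) (fun r ↦ whnf E n r.1 r.2) = _
          rw [h]
        rw [hw]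
        exact .trans (conv_iota (fun x ↦ ih x []) h) (ih _ _)
      | none =>
        have hw : whnf E (n + 1) (con c) as = (con c, as) := by
          change Option.casesOn (motive := fun _ ↦ Core × List Core)
            (iota (fun x ↦ whnf E n x []) c as) (con c, as) (fun r ↦ whnf E n r.1 r.2) = _
          rw [h]
        rw [hw]
        exact .refl _
    | _ => exact .refl _

theorem conv_all₂ {ρ : ℕ → Tm} {i : ℕ} {r : Core → Core → Bool}
    (hr : ∀ t u, r t u = true → Conv (den ρ i t) (den ρ i u)) (as : List Core) :
    ∀ bs, all₂ r as bs = true →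
      List.Forall₂ Conv (as.map (den ρ i)) (bs.map (den ρ i)) := by
  induction as with
  | nil => intro bs h; rw [Fast.isNil_eq_true.1 h]; exact .nil
  | cons a as ih =>
    intro bs h
    cases bs with
    | nil => cases h
    | cons b bs =>
      obtain ⟨h₁, h₂⟩ := Fast.and_eq_true.1 h
      exact .cons (hr _ _ h₁) (ih _ h₂)

theorem conv_spine {ρ : ℕ → Tm} {i : ℕ} {r : Core → Core → Bool}
    (hr : ∀ t u, r t u = true → Conv (den ρ i t) (den ρ i u)) (t : Core) :
    ∀ u, spine r t u = true → Conv (den ρ i t) (den ρ i u) := by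
  induction t with
  | app f a ih _ =>
    intro u h
    cases u with
    | app g b =>
      obtain ⟨h₁, h₂⟩ := Fast.and_eq_true.1 h
      exact .app (ih _ h₁) (hr _ _ h₂)
    | _ => cases h
  | var | con | gbl =>
    intro u h
    rw [den_eq_of_same _ u (by cases u <;> first | exact h)]
    exact .refl _
  | _ => intro u h; cases h

theorem conv_convHead {E : ℕ → Option Entry} {ρ : ℕ → Tm} {i : ℕ} (hE : EnvOK E ρ i)
    {r : Core → Core → Bool}
    (hr : ∀ t u, r t u = true → Conv (den ρ i t) (den ρ i u)) (h : Core) (as : List Core)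
    (h' : Core) (bs : List Core) (hc : convHead r h as h' bs = true) :
    Conv (denPair ρ i (h, as)) (denPair ρ i (h', bs)) := by
  have eta : ∀ (u : Core) (as : List Core),
      Conv (.lam (den ρ i (app (shift 1 (apps u as) 0) (var 0)))) (denPair ρ i (u, as)) := by
    intro u as
    rw [den, den_shift_zero hE.closed, den_apps]
    exact .eta _
  have other : Fast.and (same h h') (all₂ r as bs) = true →
      Conv (denPair ρ i (h, as)) (denPair ρ i (h', bs)) := by
    intro hc
    obtain ⟨h₁, h₂⟩ := Fast.and_eq_true.1 hc
    rw [denPair, denPair, den_eq_of_same _ _ h₁]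
    exact Conv.apps (conv_all₂ hr _ _ h₂) (.refl _)
  -- An abstraction on the right only: the left side is η-expanded and the bodies are compared.
  have right : ∀ b A, h' = lam A b → Fast.and (Fast.isNil bs)
      (r (app (shift 1 (apps h as) 0) (var 0)) b) = true →
      Conv (denPair ρ i (h, as)) (denPair ρ i (h', bs)) := by
    rintro b A rfl hc
    obtain ⟨h₁, h₂⟩ := Fast.and_eq_true.1 hc
    obtain rfl := Fast.isNil_eq_true.1 h₁
    exact .trans (.symm (eta _ _)) (.lam (hr _ _ h₂))
  cases h with
  | lam A b =>
    obtain ⟨h₁, h₂⟩ := Fast.and_eq_true.1 hc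
    obtain rfl := Fast.isNil_eq_true.1 h₁
    cases h' with
    | lam A' b' =>
      obtain ⟨h₁, h₂⟩ := Fast.and_eq_true.1 h₂
      obtain rfl := Fast.isNil_eq_true.1 h₁
      exact .lam (hr _ _ h₂)
    | _ => exact .trans (.lam (hr _ _ h₂)) (eta _ _)
  | pi A B =>
    cases h' with
    | lam A' b' => exact right _ _ rfl hc
    | pi A' B' =>
      obtain ⟨h₁, hc⟩ := Fast.and_eq_true.1 hc
      obtain ⟨h₂, hc⟩ := Fast.and_eq_true.1 hc
      obtain ⟨h₃, h₄⟩ := Fast.and_eq_true.1 hc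
      obtain rfl := Fast.isNil_eq_true.1 h₁
      obtain rfl := Fast.isNil_eq_true.1 h₂
      exact .pi (hr _ _ h₃) (hr _ _ h₄)
    | _ => cases (Fast.and_eq_true.1 hc).2
  | _ =>
    cases h' with
    | lam A' b' => exact right _ _ rfl hc
    | _ => exact other hc

theorem conv_conv {E : ℕ → Option Entry} {ρ : ℕ → Tm} {i : ℕ} (hE : EnvOK E ρ i)
    (n : ℕ) : ∀ t u, conv E n t u = true → Conv (den ρ i t) (den ρ i u) := by
  induction n with
  | zero => intro t u h; rw [den_eq_of_same _ _ h]; exact .refl _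
  | succ n ih =>
    intro t u h
    obtain h | h := Fast.or_eq_true.1 h
    · rw [den_eq_of_same _ _ h]; exact .refl _
    obtain h | h := Fast.or_eq_true.1 h
    · exact conv_spine ih _ _ h
    · exact .trans (conv_whnf hE n t []) (.trans (conv_convHead hE ih _ _ _ _ h)
        (.symm (conv_whnf hE n u [])))

/-! ### Soundness of type inference -/

theorem conv_sort {E : ℕ → Option Entry} {ρ : ℕ → Tm} {i : ℕ} (hE : EnvOK E ρ i)
    {n : ℕ} {T : Core} {k : ℕ} (h : sort E n T = some k) :
    Conv (den ρ i T) (.univ (i + k)) := by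
  have aux : ∀ {S : Core} {d : Option ℕ}, asUniv S some d = some k →
      S = univ k ∨ d = some k := by
    intro S d h
    cases S <;> simp_all [asUniv]
  obtain rfl | h := aux h
  · exact .refl _
  · have hw := conv_whnf hE n T []
    revert h hw
    generalize whnf E n T [] = q
    obtain ⟨q₁, q₂⟩ := q
    intro h hw
    obtain ⟨h₁, h₂⟩ := Fast.ifb_eq_some.1 h
    obtain h₂ | h₂ := aux h₂
    · obtain rfl := h₂
      obtain rfl := Fast.isNil_eq_true.1 h₁
      exact hw
    · cases h₂

theorem hasType_of_sort {E : ℕ → Option Entry} {ρ : ℕ → Tm} {i : ℕ} (hE : EnvOK E ρ i)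
    {n k : ℕ} {Γ : List Tm} {A : Tm} {T : Core}
    (hA : HasType Γ A (den ρ i T)) (h : sort E n T = some k) : HasType Γ A (.univ (i + k)) :=
  .conv hA (conv_sort hE h) (HasType.weaken_closed (.univ _) rfl rfl hA.wf)

theorem appType_sound {E : ℕ → Option Entry} {ρ : ℕ → Tm} {i : ℕ} (hE : EnvOK E ρ i) {n : ℕ}
    {Γ : List Tm} {rec : Core → Option Core} {f T a A' R : Core}
    (hrec : ∀ {t S : Core}, rec t = some S → HasType Γ (den ρ i t) (den ρ i S))
    (hf : HasType Γ (den ρ i f) (den ρ i T)) (hT : ∃ j, HasType Γ (den ρ i T) (.univ j))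
    (ha : HasType Γ (den ρ i a) (den ρ i A')) (h : appType E n rec T a A' = some R) :
    HasType Γ (den ρ i (app f a)) (den ρ i R) ∧ ∃ j, HasType Γ (den ρ i R) (.univ j) := by
  have happ : ∀ {A B : Core}, HasType Γ (den ρ i f) (den ρ i (pi A B)) →
      (∃ j, HasType Γ (den ρ i (pi A B)) (.univ j)) →
      Fast.ifb (conv E n A' A) (some (instAt a B 0)) none = some R →
      HasType Γ (den ρ i (app f a)) (den ρ i R) ∧ ∃ j, HasType Γ (den ρ i R) (.univ j) := by
    intro A B hf ⟨j, hT⟩ h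
    obtain ⟨hc, hR⟩ := Fast.ifb_eq_some.1 h
    cases hR
    obtain ⟨l, hA, hB⟩ := hT.pi_inv
    have ha' := HasType.conv ha (conv_conv hE n _ _ hc) hA
    rw [den_inst hE.closed]
    exact ⟨.app hf ha', l, hB.inst ha'⟩
  have aux : ∀ {S : Core} {k : Core → Core → Option Core} {d : Option Core},
      asPi S k d = some R → (∃ A B, S = pi A B ∧ k A B = some R) ∨ d = some R := by
    intro S k d h
    cases S <;> simp_all [asPi]
  obtain ⟨A, B, rfl, h⟩ | h := aux h
  · exact happ hf hT h
  · have hw := conv_whnf hE n T []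
    revert h hw
    generalize whnf E n T [] = q
    obtain ⟨q₁, q₂⟩ := q
    intro h hw
    obtain ⟨h₁, h₂⟩ := Fast.ifb_eq_some.1 h
    obtain ⟨A, B, h₂, h₃⟩ | h₂ := aux h₂
    · subst h₂
      obtain rfl := Fast.isNil_eq_true.1 h₁
      obtain ⟨S, hS, h₃⟩ := Fast.bind_eq_some.1 h₃
      obtain ⟨k, hk, h₃⟩ := Fast.bind_eq_some.1 h₃
      -- Subject reduction is not established, so the reduced product is not known to be a type; its
      -- type is inferred afresh before the conversion rule is applied.
      have hP := hasType_of_sort hE (hrec hS) hk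
      exact happ (.conv hf hw hP) ⟨_, hP⟩ h₃
    · cases h₂

/-- The inferred type is shown to be a type itself, because inversion of products at an application
depends on it. The induction is on the number of layers and, within a layer, on the term. -/
theorem infer_sound {E : ℕ → Option Entry} {ρ : ℕ → Tm} {i : ℕ} (hE : EnvOK E ρ i)
    (idx : Const → ℕ) (n m : ℕ) : ∀ (Γ : List Core) (t T : Core),
    WF (Γ.map (den ρ i)) → infer E idx n m Γ t = some T →
      HasType (Γ.map (den ρ i)) (den ρ i t) (den ρ i T) ∧
        ∃ j, HasType (Γ.map (den ρ i)) (den ρ i T) (.univ j) := by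
  have hclosed : ∀ {Γ : List Tm} {k e}, WF Γ → E k = some e →
      HasType Γ (ρ k) (den ρ i e.getTy) ∧ ∃ j, HasType Γ (den ρ i e.getTy) (.univ j) := by
    intro Γ k e hΓ h
    obtain ⟨j, hT⟩ := hE.isType h
    exact ⟨(hE.hasType h).weaken_closed (hE.closed k) (hE.closed_ty h) hΓ,
      j, hT.weaken_closed (hE.closed_ty h) rfl hΓ⟩
  induction m with
  | zero => intro Γ t T _ h; cases h
  | succ m ihm =>
    intro Γ t
    induction t generalizing Γ with
    | var k =>
      intro T hΓ h
      obtain ⟨A, hA, h⟩ := Fast.bind_eq_some.1 h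
      cases h
      have hA' : (Γ.map (den ρ i))[k]? = some (den ρ i A) := by
        rw [Fast.get_eq] at hA; simp [hA]
      rw [den_shift_zero hE.closed]
      exact ⟨HasType.var_of_getElem? hΓ hA', HasType.isType_of_getElem? hΓ hA'⟩
    | univ k =>
      intro T hΓ h
      cases h
      exact ⟨HasType.weaken_closed (.univ _) rfl rfl hΓ, _,
        HasType.weaken_closed (.univ _) rfl rfl hΓ⟩
    | pi A B ihA ihB =>
      intro T hΓ h
      obtain ⟨S, hS, h⟩ := Fast.bind_eq_some.1 h
      obtain ⟨k, hk, h⟩ := Fast.bind_eq_some.1 h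
      obtain ⟨S', hS', h⟩ := Fast.bind_eq_some.1 h
      obtain ⟨l, hl, h⟩ := Fast.bind_eq_some.1 h
      cases h
      have hA := hasType_of_sort hE (ihA _ _ hΓ hS).1 hk
      have hB := hasType_of_sort hE (ihB (A :: Γ) _ ⟨hΓ, _, hA⟩ hS').1 hl
      have hmax : k ≤ Fast.ifb (Nat.blt k l) l k ∧ l ≤ Fast.ifb (Nat.blt k l) l k := by
        rw [Fast.ifb_eq, blt_eq_decide, Bool.cond_decide]
        split_ifs <;> omega
      exact ⟨.pi (hA.cumul_le (by simpa using hmax.1)) (hB.cumul_le (by simpa using hmax.2)), _,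
        HasType.weaken_closed (.univ _) rfl rfl hΓ⟩
    | lam A t ihA iht =>
      intro T hΓ h
      obtain ⟨S, hS, h⟩ := Fast.bind_eq_some.1 h
      obtain ⟨k, hk, h⟩ := Fast.bind_eq_some.1 h
      obtain ⟨B, hB, h⟩ := Fast.bind_eq_some.1 h
      cases h
      have hA := hasType_of_sort hE (ihA _ _ hΓ hS).1 hk
      obtain ⟨ht, l, hB⟩ := iht (A :: Γ) _ ⟨hΓ, _, hA⟩ hB
      exact ⟨.lam ht, _, .pi (hA.cumul_le (le_max_left _ l)) (hB.cumul_le (le_max_right _ l))⟩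
    | app f a ihf iha =>
      intro T hΓ h
      obtain ⟨S, hS, h⟩ := Fast.bind_eq_some.1 h
      obtain ⟨A', hA', h⟩ := Fast.bind_eq_some.1 h
      exact appType_sound hE (fun ht ↦ (ihm _ _ _ hΓ ht).1) (ihf _ _ hΓ hS).1 (ihf _ _ hΓ hS).2
        (iha _ _ hΓ hA').1 h
    | con c =>
      intro T hΓ h
      obtain ⟨e, he, h⟩ := Fast.bind_eq_some.1 h
      have := hclosed hΓ he
      rw [hE.body he] at this
      revert h this
      generalize e.getBody = b
      intro h this
      cases b with
      | con c' =>
        obtain ⟨h₁, h₂⟩ := Fast.ifb_eq_some.1 h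
        cases h₂
        rwa [show c = c' from Const.eq_of_same h₁]
      | _ => cases h
    | gbl k =>
      intro T hΓ h
      obtain ⟨e, he, h⟩ := Fast.bind_eq_some.1 h
      cases h
      exact hclosed hΓ he

theorem isType_sound {E : ℕ → Option Entry} {ρ : ℕ → Tm} {i : ℕ} (hE : EnvOK E ρ i)
    {idx : Const → ℕ} {n : ℕ} {A : Core} (h : isType E idx n A = true) :
    ∃ j, HasType [] (den ρ i A) (.univ j) := by
  unfold isType at h
  cases hS : infer E idx n 9 [] A with
  | none => rw [hS] at h; cases h
  | some S =>
    rw [hS] at h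
    cases hk : sort E n S with
    | none => simp only [hk] at h; cases h
    | some k => exact ⟨_, hasType_of_sort hE (infer_sound hE idx n 9 [] _ _ trivial hS).1 hk⟩

theorem check_sound {E : ℕ → Option Entry} {ρ : ℕ → Tm} {i : ℕ} (hE : EnvOK E ρ i)
    {idx : Const → ℕ} {n : ℕ} {t A : Core} (hA : isType E idx n A = true)
    (h : check E idx n t A = true) : HasType [] (den ρ i t) (den ρ i A) := by
  obtain ⟨j, hA⟩ := isType_sound hE hA
  unfold check at h
  cases hT : infer E idx n 9 [] t with
  | none => rw [hT] at h; cases h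
  | some T =>
    rw [hT] at h
    exact .conv (infer_sound hE idx n 9 [] _ _ trivial hT).1 (conv_conv hE n _ _ h) hA

end Core

/-! ### Lists of global definitions -/

noncomputable section

/-- The constants whose type depends uniformly on the base level by computation alone. -/
def Const.levelUniform : Const → Bool
  | .truncIs n => Nat.beq n 2
  | .truncInd n => Nat.beq n 2
  | _ => true

namespace Core

/-- Checking uses the constants at level `0`; reading the levels relative to `i` shifts every
universe in their types to `i`, which holds by computation once the truncation level in `isTrunc` is
a numeral. Parameter types and families are both placed at the base level. -/
theorem den_ofTm_typeOf (ρ : ℕ → Tm) (i : ℕ) {c : Const} (h : c.levelUniform = true) :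
    den ρ i (ofTm (Expr.typeOf 0 0 c).toTm) = (Expr.typeOf i i c).toTm := by
  cases c with
  | truncIs n =>
    obtain rfl : n = 2 := by simpa [Const.levelUniform] using h
    rfl
  | truncInd n =>
    obtain rfl : n = 2 := by simpa [Const.levelUniform] using h
    rfl
  | _ => rfl

end Core

open BookHoTT.Core

/-- The entries of the list with index less than `N`. -/
def takeEnv (L : List Entry) (N n : ℕ) : Option Entry :=
  Fast.ifb (Nat.blt n N) (Fast.get L n) none

/-- The validity of the entry with index `N`, relative to the ones before. -/
def Entry.ok (L : List Entry) (idx : Const → ℕ) (fuel N : ℕ) (e : Entry) : Bool :=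
  Fast.and (e.getTy.closedAt 0) <| Fast.and (e.getBody.closedAt 0) <|
  Fast.and (e.getTy.gblBelow N) <| Fast.and (e.getBody.gblBelow N) <|
  Fast.and (isType (takeEnv L N) idx fuel e.getTy) <|
  -- A primitive constant is justified by the typing rule for constants, its stated type only having
  -- to be convertible to the official one. For every other body the type is inferred.
  asCon e.getBody
    (fun c ↦ Fast.and c.levelUniform
      (conv (takeEnv L N) fuel (ofTm (Expr.typeOf 0 0 c).toTm) e.getTy))
    (check (takeEnv L N) idx fuel e.getBody e.getTy)

/-- The values of the definitions are built one entry at a time, each body being read with the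
values of the earlier entries. References go only backwards (`gblBelow`), so adding a value disturbs
nothing already established. The base level `i` is arbitrary because `Entry.ok` does not mention it.
-/
theorem Core.EnvOK.exists_of_ok {L : List Entry} {idx : Const → ℕ} {fuel : ℕ}
    (h : ∀ (N : ℕ) (e : Entry), L[N]? = some e → e.ok L idx fuel N = true) (i N : ℕ) :
    ∃ ρ, EnvOK (takeEnv L N) ρ i := by
  have h' := fun {N : ℕ} {e : Entry} (he : L[N]? = some e) ↦ h N e he
  simp only [Entry.ok, Fast.and_eq_true] at h'
  have lookup : ∀ {N n e}, takeEnv L N n = some e → n < N ∧ L[n]? = some e := by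
    intro N n e he
    rw [takeEnv, Fast.ifb_eq, Fast.get_eq, blt_eq_decide, Bool.cond_decide] at he
    split at he
    · exact ⟨‹_›, he⟩
    · cases he
  induction N with
  | zero =>
    -- The value at an index without an entry is never looked up; it only has to be closed.
    refine ⟨fun _ ↦ .univ 0, fun n ↦ rfl, ?_, ?_, ?_, ?_⟩ <;>
    · intro n e he
      exact absurd (lookup he).1 (by omega)
  | succ N ih =>
    obtain ⟨ρ, hρ⟩ := ih
    cases hN : L[N]? with
    | none =>
      have : takeEnv L (N + 1) = takeEnv L N := by
        funext n
        simp only [takeEnv, Fast.ifb_eq, Fast.get_eq, blt_eq_decide, Bool.cond_decide]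
        by_cases h₁ : n < N
        · simp [h₁, Nat.lt_succ_of_lt h₁]
        · by_cases h₂ : n = N
          · simp [h₂, hN]
          · simp [h₁, show ¬ n < N + 1 by omega]
      rw [this]
      exact ⟨ρ, hρ⟩
    | some e =>
      obtain ⟨hc, hcb, hb, hbb, hty, hbody⟩ := h' hN
      let ρ' : ℕ → Tm := fun n ↦ if n = N then den ρ i e.getBody else ρ n
      have agree : ∀ n < N, ρ' n = ρ n := fun n hn ↦ if_neg (by omega)
      have agree' : ∀ t : Core, t.gblBelow N = true → den ρ' i t = den ρ i t :=
        fun t ↦ den_congr_of_gblBelow agree i t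
      have hT : HasType [] (den ρ i e.getBody) (den ρ i e.getTy) := by
        revert hbody
        cases e.getBody with
        | con c =>
          intro hbody
          obtain ⟨hc, hbody⟩ := Fast.and_eq_true.1 hbody
          obtain ⟨j, hj⟩ := isType_sound hρ hty
          have := conv_conv hρ _ _ _ hbody
          rw [den_ofTm_typeOf ρ i hc] at this
          exact .conv (.con c i i) this hj
        | _ =>
          intro hbody
          exact check_sound (t := _) hρ hty hbody
      have key : ∀ {n e'}, takeEnv L (N + 1) n = some e' →
          (takeEnv L N n = some e' ∧ ρ' n = ρ n ∧
            den ρ' i e'.getTy = den ρ i e'.getTy ∧ den ρ' i e'.getBody = den ρ i e'.getBody) ∨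
          (n = N ∧ e' = e) := by
        intro n e' he'
        obtain ⟨h₁, h₂⟩ := lookup he'
        by_cases hn : n < N
        · obtain ⟨-, -, hb', hbb', -⟩ := h' h₂
          refine .inl ⟨by simp [takeEnv, Fast.ifb_eq, Fast.get_eq, blt_eq_decide, hn, h₂],
            agree n hn, ?_, ?_⟩
          · exact agree' _ (gblBelow_mono hn.le _ hb')
          · exact agree' _ (gblBelow_mono hn.le _ hbb')
        · obtain rfl : n = N := by omega
          exact .inr ⟨rfl, by rw [hN] at h₂; exact (Option.some.inj h₂).symm⟩
      have hN' : ρ' N = den ρ i e.getBody := if_pos rfl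
      refine ⟨ρ', fun n ↦ ?_, fun {n e'} he' ↦ ?_, fun {n e'} he' ↦ ?_, fun {n e'} he' ↦ ?_,
        fun {n e'} he' ↦ ?_⟩
      · by_cases hn : n = N
        · subst hn
          rw [hN']
          exact closedAt_den hρ.closed i _ 0 hcb
        · rw [show ρ' n = ρ n from if_neg hn]
          exact hρ.closed n
      · obtain ⟨h₁, -, h₂, -⟩ | ⟨rfl, rfl⟩ := key he'
        · rw [h₂]; exact hρ.closed_ty h₁
        · rw [agree' _ hb]; exact closedAt_den hρ.closed i _ 0 hc
      · obtain ⟨h₁, h₂, -, h₃⟩ | ⟨rfl, rfl⟩ := key he'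
        · rw [h₂, h₃]; exact hρ.body h₁
        · rw [agree' _ hbb, hN']
      · obtain ⟨h₁, h₂, h₃, -⟩ | ⟨rfl, rfl⟩ := key he'
        · rw [h₂, h₃]; exact hρ.hasType h₁
        · rw [agree' _ hb, hN']; exact hT
      · obtain ⟨h₁, -, h₂, -⟩ | ⟨rfl, rfl⟩ := key he'
        · rw [h₂]; exact hρ.isType h₁
        · rw [agree' _ hb]; exact isType_sound hρ hty

/-- The validity of the entries with indices in a given range. -/
def okRange (L : List Entry) (idx : Const → ℕ) (fuel start len : ℕ) : Bool :=
  Nat.rec (fun _ ↦ true) (fun _ ih start ↦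
    Fast.and (Option.casesOn (Fast.get L start) true (Entry.ok L idx fuel start))
      (ih (Nat.succ start))) len start

theorem ok_of_okRange {L : List Entry} {idx : Const → ℕ} {fuel : ℕ} (len : ℕ) :
    ∀ {start : ℕ}, okRange L idx fuel start len = true →
      ∀ (N : ℕ) (e : Entry), start ≤ N → N < start + len → L[N]? = some e →
        e.ok L idx fuel N = true := by
  induction len with
  | zero => intros; omega
  | succ len ih =>
    intro start h N e h₁ h₂ he
    obtain ⟨h, h'⟩ := Fast.and_eq_true.1 h
    obtain rfl | h₃ := h₁.eq_or_lt
    · rw [Fast.get_eq, he] at h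
      exact h
    · exact ih h' N e h₃ (by omega) he

end

noncomputable section

/-! ### Writing annotated terms with named variables and implicit arguments

An `Ex` is an annotated term together with its dependence on the length of the context. The type
`Trm T` of terms that are meant to have type `T` lets Lean fill in implicit arguments; nothing
depends on the correctness of `T`, which is only established by the type checker. -/

structure Ex where
  atDepth : ℕ → Core

structure Trm (T : Ex) where
  ex : Ex

namespace Core

def occurs (t : Core) : ℕ → Bool :=
  Core.rec (fun n k ↦ Nat.beq n k) (fun _ _ ↦ false)
    (fun _ _ A B k ↦ Fast.or (A k) (B (Nat.succ k)))
    (fun _ _ A t k ↦ Fast.or (A k) (t (Nat.succ k)))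
    (fun _ _ f a k ↦ Fast.or (f k) (a k)) (fun _ _ ↦ false) (fun _ _ ↦ false) t

/-- An abstraction, contracted if it is an `η`-expansion. -/
def etaLam (A t : Core) : Core :=
  asApp t (fun f a ↦ asVar a (fun n ↦ Nat.casesOn n
    (Fast.ifb (occurs f 0) (lam A t) (instAt (univ 0) f 0)) fun _ ↦ lam A t) (lam A t)) (lam A t)

end Core

namespace Ex

def app (f a : Ex) : Ex := ⟨fun d ↦ .app (f.atDepth d) (a.atDepth d)⟩

def bound (d : ℕ) : Ex := ⟨fun d' ↦ .var (d' - (d + 1))⟩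

def pi (A : Ex) (B : Ex → Ex) : Ex :=
  ⟨fun d ↦ .pi (A.atDepth d) ((B (bound d)).atDepth (d + 1))⟩

def lam (A : Ex) (t : Ex → Ex) : Ex :=
  ⟨fun d ↦ .etaLam (A.atDepth d) ((t (bound d)).atDepth (d + 1))⟩

def con (c : Const) : Ex := ⟨fun _ ↦ .con c⟩

def gbl (n : ℕ) : Ex := ⟨fun _ ↦ .gbl n⟩

end Ex

/-- The universe at the base level. -/
def U : Ex := ⟨fun _ ↦ .univ 0⟩

/-- A Lean type that represents an object type `ty`, with conversions in both directions. -/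
class Rep (D : Type) where
  ty : Ex
  up : Ex → D
  down : D → Ex

instance : Rep Ex := ⟨U, id, id⟩

instance (T : Ex) : Rep (Trm T) := ⟨T, .mk, Trm.ex⟩

/-- Reification and reflection as in normalization by evaluation: a Lean function becomes an object
abstraction by application to a fresh variable, and an object function becomes a Lean function
through application nodes. Implicit Lean arguments thus turn into explicit object arguments. -/
instance {D : Type} {G : D → Type} [Rep D] [∀ x, Rep (G x)] : Rep ((x : D) → G x) where
  ty := .pi (Rep.ty D) fun v ↦ Rep.ty (G (Rep.up v))
  up e := fun x ↦ Rep.up (e.app (Rep.down x))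
  down f := .lam (Rep.ty D) fun v ↦ Rep.down (f (Rep.up v))

/-- The object type represented by a Lean type. -/
def El (D : Type) [Rep D] : Ex := Rep.ty D

def prim (c : Const) (F : Type) [Rep F] : F := Rep.up (.con c)

/-- The last argument serves only to fix the Lean type; the result is a reference to position `n` of
`env`, so terms stay small and shared. The choice of `n` is not trusted, as the checker reads the
type from the entry itself. -/
def gl (n : ℕ) {F : Type} [Rep F] (_ : F) : F := Rep.up (.gbl n)

def primEntry (c : Const) {F : Type} [Rep F] (_ : F) : Entry :=
  ⟨(Rep.ty F).atDepth 0, .con c⟩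

def defEntry {F : Type} [Rep F] (f : F) : Entry :=
  ⟨(Rep.ty F).atDepth 0, (Rep.down f).atDepth 0⟩

/-- A term regarded as one of a convertible type. -/
def cv {S T : Ex} (t : Trm S) : Trm T := ⟨t.ex⟩

/-- An object function as a Lean function, and conversely. -/
def ofEl {D : Type} [Rep D] (t : Trm (El D)) : D := Rep.up t.ex

def toEl {D : Type} [Rep D] (f : D) : Trm (El D) := ⟨Rep.down f⟩

set_option synthInstance.maxHeartbeats 400000
set_option synthInstance.maxSize 1000
set_option linter.unusedVariables false

namespace Syn

/-! #### Identity types -/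

def IdP := @prim .id ((A : Ex) → Trm A → Trm A → Ex) _

-- Irreducibility lets unification recover `A`, `x` and `y` from the Lean type of a path, instead of
-- unfolding both sides to functions into `Core`.
@[irreducible]
def Id {A : Ex} (x y : Trm A) : Ex := IdP A x y

def refl := @prim .refl ({A : Ex} → (x : Trm A) → Trm (Id x x)) _

def idInd := @prim .idInd ({A : Ex} → (C : (x y : Trm A) → Trm (Id x y) → Ex) →
  ((x : Trm A) → Trm (C x x (refl x))) → {x y : Trm A} → (p : Trm (Id x y)) → Trm (C x y p)) _

/-- Path induction for families of types that are represented by Lean types. -/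
def J {A : Ex} (C : (x y : Trm A) → Trm (Id x y) → Type) [∀ x y p, Rep (C x y p)]
    (c : (x : Trm A) → C x x (refl x)) {x y : Trm A} (p : Trm (Id x y)) : C x y p :=
  ofEl (idInd (fun x y p ↦ El (C x y p)) (fun x ↦ toEl (c x)) p)

/-- This and the path operations after it repeat the path inductions occurring in the official types
of the constants, so that the two descriptions of those types are convertible. -/
def transportTm {A : Ex} (P : Trm A → Ex) {x y : Trm A} (p : Trm (Id x y)) (u : Trm (P x)) :
    Trm (P y) :=
  J (fun x y _ ↦ Trm (P x) → Trm (P y)) (fun _ u ↦ u) p u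

def transport := @gl 3 _ _ @transportTm

def concatTm {A : Ex} {x y z : Trm A} (p : Trm (Id x y)) (q : Trm (Id y z)) : Trm (Id x z) :=
  J (fun x y _ ↦ (z : Trm A) → Trm (Id y z) → Trm (Id x z)) (fun _ _ q ↦ q) p z q

def concat := @gl 4 _ _ @concatTm

infixr:70 " ⬝ " => concat

def inverseTm {A : Ex} {x y : Trm A} (p : Trm (Id x y)) : Trm (Id y x) :=
  J (fun x y _ ↦ Trm (Id y x)) (fun x ↦ refl x) p

def inverse := @gl 5 _ _ @inverseTm

def apTm {A B : Ex} (f : Trm A → Trm B) {x y : Trm A} (p : Trm (Id x y)) :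
    Trm (Id (f x) (f y)) :=
  J (fun x y _ ↦ Trm (Id (f x) (f y))) (fun x ↦ refl (f x)) p

def ap := @gl 6 _ _ @apTm

def pathOverTm {A : Ex} (P : Trm A → Ex) {x y : Trm A} (p : Trm (Id x y)) (u : Trm (P x))
    (v : Trm (P y)) : Ex :=
  Id (transport P p u) v

def pathOver := @gl 7 _ _ @pathOverTm

def apdTm {A : Ex} (P : Trm A → Ex) (f : (x : Trm A) → Trm (P x)) {x y : Trm A}
    (p : Trm (Id x y)) : Trm (pathOver P p (f x) (f y)) :=
  J (fun x y p ↦ Trm (pathOver P p (f x) (f y))) (fun x ↦ cv (refl (f x))) p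

def apd := @gl 8 _ _ @apdTm

def concatOverTm {A : Ex} (P : Trm A → Ex) {x y z : Trm A} {p : Trm (Id x y)} {q : Trm (Id y z)}
    {u : Trm (P x)} {v : Trm (P y)} {w : Trm (P z)} (wp : Trm (pathOver P p u v))
    (wq : Trm (pathOver P q v w)) : Trm (pathOver P (p ⬝ q) u w) :=
  J (fun x y p ↦ (z : Trm A) → (q : Trm (Id y z)) → (u : Trm (P x)) → (v : Trm (P y)) →
      (w : Trm (P z)) → Trm (pathOver P p u v) → Trm (pathOver P q v w) →
        Trm (pathOver P (p ⬝ q) u w))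
    (fun x z q u v w wp wq ↦ J (A := P x) (x := u) (y := v)
      (fun u v _ ↦ (w : Trm (P z)) → Trm (pathOver P q v w) → Trm (pathOver P q u w))
      (fun _ _ wq ↦ wq) (cv wp) w wq |> cv)
    p z q u v w wp wq

def concatOver := @gl 9 _ _ @concatOverTm

def apOverTm {A : Ex} (P : Trm A → Ex) (g : Trm A → Trm A)
    (G : (x : Trm A) → Trm (P x) → Trm (P (g x))) {x y : Trm A} {p : Trm (Id x y)}
    {u : Trm (P x)} {v : Trm (P y)} (w : Trm (pathOver P p u v)) :
    Trm (pathOver P (ap g p) (G x u) (G y v)) :=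
  J (fun x y p ↦ (u : Trm (P x)) → (v : Trm (P y)) → Trm (pathOver P p u v) →
      Trm (pathOver P (ap g p) (G x u) (G y v)))
    (fun x u v w ↦ cv (ap (A := P x) (x := u) (y := v) (G x) (cv w))) p u v w

def apOver := @gl 10 _ _ @apOverTm

/-! #### Sums, lists and truncations -/

def sigma := @prim .sigma ((A : Ex) → (Trm A → Ex) → Ex) _

def pair := @prim .pair ({A : Ex} → (B : Trm A → Ex) → (a : Trm A) → Trm (B a) →
  Trm (sigma A B)) _

def sum := @prim .sum (Ex → Ex → Ex) _

def inl := @prim .inl ({A B : Ex} → Trm A → Trm (sum A B)) _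

def inr := @prim .inr ({A B : Ex} → Trm B → Trm (sum A B)) _

def sumInd := @prim .sumInd ({A B : Ex} → (C : Trm (sum A B) → Ex) →
  ((a : Trm A) → Trm (C (inl a))) → ((b : Trm B) → Trm (C (inr b))) →
    (x : Trm (sum A B)) → Trm (C x)) _

def list := @prim .list (Ex → Ex) _

def nil := @prim .nil ({A : Ex} → Trm (list A)) _

def cons := @prim .cons ({A : Ex} → Trm A → Trm (list A) → Trm (list A)) _

def listInd := @prim .listInd ({A : Ex} → (C : Trm (list A) → Ex) → Trm (C nil) →
  ((a : Trm A) → (l : Trm (list A)) → Trm (C l) → Trm (C (cons a l))) →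
    (l : Trm (list A)) → Trm (C l)) _

abbrev IsProp (X : Ex) : Type := (x y : Trm X) → Trm (Id x y)

abbrev IsSet (X : Ex) : Type := (x y : Trm X) → IsProp (Id x y)

abbrev Is1Type (X : Ex) : Type := (x y : Trm X) → IsSet (Id x y)

def trunc := @prim (.trunc 2) (Ex → Ex) _

def truncMk := @prim (.truncMk 2) ({X : Ex} → Trm X → Trm (trunc X)) _

def truncIs := @prim (.truncIs 2) ({X : Ex} → Is1Type (trunc X)) _

def truncInd := @prim (.truncInd 2) ({X : Ex} → (P : Trm (trunc X) → Ex) →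
  ((x : Trm (trunc X)) → Is1Type (P x)) → ((x : Trm X) → Trm (P (truncMk x))) →
    (x : Trm (trunc X)) → Trm (P x)) _

/-! #### Words of signed elements -/

abbrev signed (A : Ex) : Ex := sum A A

abbrev words (A : Ex) : Ex := list (signed A)

def invTm {A : Ex} (a : Trm (signed A)) : Trm (signed A) :=
  sumInd (fun _ ↦ signed A) (fun a ↦ inr a) (fun a ↦ inl a) a

def inv := @gl 25 _ _ @invTm

def invInvTm {A : Ex} (a : Trm (signed A)) : Trm (Id (inv (inv a)) a) :=
  sumInd (fun a ↦ Id (inv (inv a)) a) (fun a ↦ cv (refl (A := signed A) (inl a)))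
    (fun a ↦ cv (refl (A := signed A) (inr a))) a

def invInv := @gl 26 _ _ @invInvTm

def appendTm {A : Ex} (x y : Trm (words A)) : Trm (words A) :=
  listInd (fun _ ↦ words A) y (fun a _ l ↦ cons a l) x

def append := @gl 27 _ _ @appendTm

infixr:75 " ⧺ " => append

def assocTm {A : Ex} (x y z : Trm (words A)) : Trm (Id ((x ⧺ y) ⧺ z) (x ⧺ (y ⧺ z))) :=
  listInd (fun x ↦ Id ((x ⧺ y) ⧺ z) (x ⧺ (y ⧺ z))) (cv (refl (y ⧺ z)))
    (fun a _ p ↦ cv (ap (fun l ↦ cons a l) p)) x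

def assoc := @gl 28 _ _ @assocTm

def assocInvTm {A : Ex} (x y z : Trm (words A)) : Trm (Id (x ⧺ (y ⧺ z)) ((x ⧺ y) ⧺ z)) :=
  inverse (assoc x y z)

def assocInv := @gl 29 _ _ @assocInvTm

def redexTm {A : Ex} (a : Trm (signed A)) (x : Trm (words A)) : Trm (words A) :=
  cons a (cons (inv a) x)

def redex := @gl 30 _ _ @redexTm

def insTm {A : Ex} (x : Trm (words A)) (a : Trm (signed A)) (y : Trm (words A)) :
    Trm (Id (x ⧺ redex a (cons a y)) (x ⧺ cons a (redex (inv a) y))) :=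
  cv (ap (fun b ↦ x ⧺ cons a (cons (inv a) (cons b y))) (inverse (invInv a)))

def ins := @gl 31 _ _ @insTm

/-! #### The free group -/

def free := @prim .free (Ex → Ex) _

def fUnit := @prim .fUnit ({A : Ex} → Trm (free A)) _

def fCons := @prim .fCons ({A : Ex} → Trm A → Trm (free A) → Trm (free A)) _

def fICons := @prim .fICons ({A : Ex} → Trm A → Trm (free A) → Trm (free A)) _

def fMu1 := @prim .fMu1 ({A : Ex} → (a : Trm A) → (x : Trm (free A)) →
  Trm (Id (fICons a (fCons a x)) x)) _

def fMu2 := @prim .fMu2 ({A : Ex} → (a : Trm A) → (x : Trm (free A)) →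
  Trm (Id (fCons a (fICons a x)) x)) _

def fMu := @prim .fMu ({A : Ex} → (a : Trm A) → (x : Trm (free A)) →
  Trm (Id (ap (fun x ↦ fCons a x) (fMu1 a x)) (fMu2 a (fCons a x)))) _

def transportMuTm {A : Ex} (P : Trm (free A) → Ex)
    (c : (a : Trm A) → (x : Trm (free A)) → Trm (P x) → Trm (P (fCons a x))) (a : Trm A)
    (x : Trm (free A)) (u : Trm (P (fICons a (fCons a x)))) (v : Trm (P x))
    (w : Trm (pathOver P (fMu1 a x) u v)) :
    Trm (pathOver P (fMu2 a (fCons a x)) (c a (fICons a (fCons a x)) u) (c a x v)) :=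
  transport (fun q ↦ pathOver P q (c a (fICons a (fCons a x)) u) (c a x v)) (fMu a x)
    (apOver P (fun x ↦ fCons a x) (fun x ↦ c a x) w)

def transportMu := @gl 39 _ _ @transportMuTm

def freeInd := @prim .freeInd ({A : Ex} → (P : Trm (free A) → Ex) → (u : Trm (P fUnit)) →
  (c : (a : Trm A) → (x : Trm (free A)) → Trm (P x) → Trm (P (fCons a x))) →
  (i : (a : Trm A) → (x : Trm (free A)) → Trm (P x) → Trm (P (fICons a x))) →
  (m₁ : (a : Trm A) → (x : Trm (free A)) → (p : Trm (P x)) →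
    Trm (pathOver P (fMu1 a x) (i a (fCons a x) (c a x p)) p)) →
  (m₂ : (a : Trm A) → (x : Trm (free A)) → (p : Trm (P x)) →
    Trm (pathOver P (fMu2 a x) (c a (fICons a x) (i a x p)) p)) →
  (m : (a : Trm A) → (x : Trm (free A)) → (p : Trm (P x)) →
    Trm (Id (transportMu P c a x (i a (fCons a x) (c a x p)) p (m₁ a x p))
      (m₂ a (fCons a x) (c a x p)))) →
  (x : Trm (free A)) → Trm (P x)) _

def freeIndMu1 := @prim .freeIndMu1 ({A : Ex} → (P : Trm (free A) → Ex) → (u : Trm (P fUnit)) →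
  (c : (a : Trm A) → (x : Trm (free A)) → Trm (P x) → Trm (P (fCons a x))) →
  (i : (a : Trm A) → (x : Trm (free A)) → Trm (P x) → Trm (P (fICons a x))) →
  (m₁ : (a : Trm A) → (x : Trm (free A)) → (p : Trm (P x)) →
    Trm (pathOver P (fMu1 a x) (i a (fCons a x) (c a x p)) p)) →
  (m₂ : (a : Trm A) → (x : Trm (free A)) → (p : Trm (P x)) →
    Trm (pathOver P (fMu2 a x) (c a (fICons a x) (i a x p)) p)) →
  (m : (a : Trm A) → (x : Trm (free A)) → (p : Trm (P x)) →
    Trm (Id (transportMu P c a x (i a (fCons a x) (c a x p)) p (m₁ a x p))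
      (m₂ a (fCons a x) (c a x p)))) →
  (a : Trm A) → (x : Trm (free A)) →
    Trm (Id (apd P (freeInd P u c i m₁ m₂ m) (fMu1 a x))
      (cv (m₁ a x (freeInd P u c i m₁ m₂ m x))))) _

def freeIndMu2 := @prim .freeIndMu2 ({A : Ex} → (P : Trm (free A) → Ex) → (u : Trm (P fUnit)) →
  (c : (a : Trm A) → (x : Trm (free A)) → Trm (P x) → Trm (P (fCons a x))) →
  (i : (a : Trm A) → (x : Trm (free A)) → Trm (P x) → Trm (P (fICons a x))) →
  (m₁ : (a : Trm A) → (x : Trm (free A)) → (p : Trm (P x)) →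
    Trm (pathOver P (fMu1 a x) (i a (fCons a x) (c a x p)) p)) →
  (m₂ : (a : Trm A) → (x : Trm (free A)) → (p : Trm (P x)) →
    Trm (pathOver P (fMu2 a x) (c a (fICons a x) (i a x p)) p)) →
  (m : (a : Trm A) → (x : Trm (free A)) → (p : Trm (P x)) →
    Trm (Id (transportMu P c a x (i a (fCons a x) (c a x p)) p (m₁ a x p))
      (m₂ a (fCons a x) (c a x p)))) →
  (a : Trm A) → (x : Trm (free A)) →
    Trm (Id (apd P (freeInd P u c i m₁ m₂ m) (fMu2 a x))
      (cv (m₂ a x (freeInd P u c i m₁ m₂ m x))))) _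

/-! #### The non-recursive approximation -/

/-- The type of actions of a map `e` of words on the cancellation of redexes. -/
abbrev Cancel {A X : Ex} (e : Trm (words A) → Trm X) : Type :=
  (x : Trm (words A)) → (a : Trm (signed A)) → (y : Trm (words A)) →
    Trm (Id (e (x ⧺ redex a y)) (e (x ⧺ y)))

/-- Stated for an arbitrary action `t` on words: with `aEta` and `aTau` it gives a side of the
constructor `aSw`, and for general `e` and `t` a side of the hypothesis of the recursion principle.
-/
def swLeftTm {A X : Ex} (e : Trm (words A) → Trm X) (t : Cancel e) (x : Trm (words A))
    (a : Trm (signed A)) (y : Trm (words A)) (b : Trm (signed A)) (z : Trm (words A)) :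
    Trm (Id (e (x ⧺ redex a (y ⧺ redex b z))) (e ((x ⧺ y) ⧺ z))) :=
  t x a (y ⧺ redex b z) ⬝ ap e (assocInv x y (redex b z)) ⬝ t (x ⧺ y) b z

def swLeft := @gl 43 _ _ @swLeftTm

def swRightTm {A X : Ex} (e : Trm (words A) → Trm X) (t : Cancel e) (x : Trm (words A))
    (a : Trm (signed A)) (y : Trm (words A)) (b : Trm (signed A)) (z : Trm (words A)) :
    Trm (Id (e (x ⧺ redex a (y ⧺ redex b z))) (e ((x ⧺ y) ⧺ z))) :=
  -- Concatenation computes on a leading redex, so `redex a y ⧺ w` and `redex a (y ⧺ w)` are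
  -- convertible; the casts absorb this, and only re-bracketing past `x` needs a path.
  cv (ap e (assocInv x (redex a y) (redex b z))) ⬝ t (x ⧺ redex a y) b z ⬝
    cv (ap e (assoc x (redex a y) z)) ⬝ t x a (y ⧺ z) ⬝ ap e (assocInv x y z)

def swRight := @gl 44 _ _ @swRightTm

def ovLeftTm {A X : Ex} (e : Trm (words A) → Trm X) (t : Cancel e) (x : Trm (words A))
    (a : Trm (signed A)) (y : Trm (words A)) :
    Trm (Id (e (x ⧺ redex a (cons a y))) (e (x ⧺ cons a y))) :=
  t x a (cons a y)

def ovLeft := @gl 45 _ _ @ovLeftTm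

def ovRightTm {A X : Ex} (e : Trm (words A) → Trm X) (t : Cancel e) (x : Trm (words A))
    (a : Trm (signed A)) (y : Trm (words A)) :
    Trm (Id (e (x ⧺ redex a (cons a y))) (e (x ⧺ cons a y))) :=
  ap e (ins x a y) ⬝ cv (ap e (assocInv x (cons a nil) (redex (inv a) y))) ⬝
    t (x ⧺ cons a nil) (inv a) y ⬝ cv (ap e (assoc x (cons a nil) y))

def ovRight := @gl 46 _ _ @ovRightTm

def approx := @prim .approx (Ex → Ex) _

def aEta := @prim .aEta ({A : Ex} → Trm (words A) → Trm (approx A)) _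

def aTau := @prim .aTau ({A : Ex} → Cancel (A := A) (X := approx A) (fun x ↦ aEta x)) _

def aSw := @prim .aSw ({A : Ex} → (x : Trm (words A)) → (a : Trm (signed A)) →
  (y : Trm (words A)) → (b : Trm (signed A)) → (z : Trm (words A)) →
    Trm (Id (swLeft (fun x ↦ aEta x) (fun x a y ↦ aTau x a y) x a y b z)
      (swRight (fun x ↦ aEta x) (fun x a y ↦ aTau x a y) x a y b z))) _

def aOv := @prim .aOv ({A : Ex} → (x : Trm (words A)) → (a : Trm (signed A)) →
  (y : Trm (words A)) →
    Trm (Id (ovLeft (fun x ↦ aEta x) (fun x a y ↦ aTau x a y) x a y)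
      (ovRight (fun x ↦ aEta x) (fun x a y ↦ aTau x a y) x a y))) _

def aTr := @prim .aTr ({A : Ex} → Is1Type (approx A)) _

def wordOverTm {A : Ex} (P : Trm (approx A) → Ex) (e : (x : Trm (words A)) → Trm (P (aEta x)))
    {x y : Trm (words A)} (q : Trm (Id x y)) :
    Trm (pathOver P (ap (fun x ↦ aEta x) q) (e x) (e y)) :=
  J (fun x y q ↦ Trm (pathOver P (ap (fun x ↦ aEta x) q) (e x) (e y)))
    (fun x ↦ cv (refl (e x))) q

def wordOver := @gl 53 _ _ @wordOverTm

/-- The type of paths over `aTau` between the values of `e`. -/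
abbrev CancelOver {A : Ex} (P : Trm (approx A) → Ex)
    (e : (x : Trm (words A)) → Trm (P (aEta x))) : Type :=
  (x : Trm (words A)) → (a : Trm (signed A)) → (y : Trm (words A)) →
    Trm (pathOver P (aTau x a y) (e (x ⧺ redex a y)) (e (x ⧺ y)))

def swLeftOverTm {A : Ex} (P : Trm (approx A) → Ex) (e : (x : Trm (words A)) → Trm (P (aEta x)))
    (t : CancelOver P e) (x : Trm (words A)) (a : Trm (signed A)) (y : Trm (words A))
    (b : Trm (signed A)) (z : Trm (words A)) :
    Trm (pathOver P (swLeft (fun x ↦ aEta x) (fun x a y ↦ aTau x a y) x a y b z)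
      (e (x ⧺ redex a (y ⧺ redex b z))) (e ((x ⧺ y) ⧺ z))) :=
  cv (concatOver P (t x a (y ⧺ redex b z)) (concatOver P (wordOver P e (assocInv x y (redex b z)))
    (t (x ⧺ y) b z)))

def swLeftOver := @gl 54 _ _ @swLeftOverTm

def swRightOverTm {A : Ex} (P : Trm (approx A) → Ex)
    (e : (x : Trm (words A)) → Trm (P (aEta x)))
    (t : CancelOver P e) (x : Trm (words A)) (a : Trm (signed A)) (y : Trm (words A))
    (b : Trm (signed A)) (z : Trm (words A)) :
    Trm (pathOver P (swRight (fun x ↦ aEta x) (fun x a y ↦ aTau x a y) x a y b z)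
      (e (x ⧺ redex a (y ⧺ redex b z))) (e ((x ⧺ y) ⧺ z))) :=
  cv (concatOver P (wordOver P e (assocInv x (redex a y) (redex b z)))
    (concatOver P (t (x ⧺ redex a y) b z) (concatOver P (wordOver P e (assoc x (redex a y) z))
      (concatOver P (cv (t x a (y ⧺ z)) : Trm (pathOver P (x := aEta (x ⧺ (redex a y ⧺ z)))
          (cv (aTau x a (y ⧺ z))) (e (x ⧺ (redex a y ⧺ z))) (e (x ⧺ (y ⧺ z)))))
        (wordOver P e (assocInv x y z))))))

def swRightOver := @gl 55 _ _ @swRightOverTm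

def ovLeftOverTm {A : Ex} (P : Trm (approx A) → Ex) (e : (x : Trm (words A)) → Trm (P (aEta x)))
    (t : CancelOver P e) (x : Trm (words A)) (a : Trm (signed A)) (y : Trm (words A)) :
    Trm (pathOver P (ovLeft (fun x ↦ aEta x) (fun x a y ↦ aTau x a y) x a y)
      (e (x ⧺ redex a (cons a y))) (e (x ⧺ cons a y))) :=
  cv (t x a (cons a y))

def ovLeftOver := @gl 56 _ _ @ovLeftOverTm

def ovRightOverTm {A : Ex} (P : Trm (approx A) → Ex) (e : (x : Trm (words A)) → Trm (P (aEta x)))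
    (t : CancelOver P e) (x : Trm (words A)) (a : Trm (signed A)) (y : Trm (words A)) :
    Trm (pathOver P (ovRight (fun x ↦ aEta x) (fun x a y ↦ aTau x a y) x a y)
      (e (x ⧺ redex a (cons a y))) (e (x ⧺ cons a y))) :=
  cv (concatOver P (wordOver P e (ins x a y))
    (concatOver P (cv (wordOver P e (assocInv x (cons a nil) (redex (inv a) y))) :
        Trm (pathOver P (cv (ap (fun x ↦ aEta x) (assocInv x (cons a nil) (redex (inv a) y))))
          (e (x ⧺ cons a (redex (inv a) y))) (e ((x ⧺ cons a nil) ⧺ redex (inv a) y))))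
      (concatOver P (t (x ⧺ cons a nil) (inv a) y)
        (wordOver P e (assoc x (cons a nil) y)))))

def ovRightOver := @gl 57 _ _ @ovRightOverTm

/-- The type of paths over `aSw`. -/
abbrev SwOver {A : Ex} (P : Trm (approx A) → Ex) (e : (x : Trm (words A)) → Trm (P (aEta x)))
    (t : CancelOver P e) : Type :=
  (x : Trm (words A)) → (a : Trm (signed A)) → (y : Trm (words A)) → (b : Trm (signed A)) →
    (z : Trm (words A)) → Trm (pathOver (fun q ↦ pathOver P q
      (e (x ⧺ redex a (y ⧺ redex b z))) (e ((x ⧺ y) ⧺ z))) (aSw x a y b z)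
      (swLeftOver P e t x a y b z) (swRightOver P e t x a y b z))

/-- The type of paths over `aOv`. -/
abbrev OvOver {A : Ex} (P : Trm (approx A) → Ex) (e : (x : Trm (words A)) → Trm (P (aEta x)))
    (t : CancelOver P e) : Type :=
  (x : Trm (words A)) → (a : Trm (signed A)) → (y : Trm (words A)) →
    Trm (pathOver (fun q ↦ pathOver P q
      (e (x ⧺ redex a (cons a y))) (e (x ⧺ cons a y))) (aOv x a y)
      (ovLeftOver P e t x a y) (ovRightOver P e t x a y))

def approxInd := @prim .approxInd ({A : Ex} → (P : Trm (approx A) → Ex) →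
  (h : (n : Trm (approx A)) → Is1Type (P n)) → (e : (x : Trm (words A)) → Trm (P (aEta x))) →
    (t : CancelOver P e) → (s : SwOver P e t) → (o : OvOver P e t) →
      (n : Trm (approx A)) → Trm (P n)) _

def approxIndTau := @prim .approxIndTau ({A : Ex} → (P : Trm (approx A) → Ex) →
  (h : (n : Trm (approx A)) → Is1Type (P n)) → (e : (x : Trm (words A)) → Trm (P (aEta x))) →
    (t : CancelOver P e) → (s : SwOver P e t) → (o : OvOver P e t) →
      (x : Trm (words A)) → (a : Trm (signed A)) → (y : Trm (words A)) →
        Trm (Id (apd P (approxInd P h e t s o) (aTau x a y)) (cv (t x a y)))) _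

/-! #### The groupoid structure of types -/

/-- Composition is by induction on the left factor: `refl x ⬝ p` computes to `p`, while a trailing
`refl` has to be removed by this path. It accounts for most uses of `concatRefl` below. -/
def concatReflTm {A : Ex} {x y : Trm A} (p : Trm (Id x y)) : Trm (Id (p ⬝ refl y) p) :=
  J (fun _ y p ↦ Trm (Id (p ⬝ refl y) p)) (fun x ↦ cv (refl (refl x))) p

def concatRefl := @gl 60 _ _ @concatReflTm

def concatAssocTm {A : Ex} {x y z w : Trm A} (p : Trm (Id x y)) (q : Trm (Id y z))
    (r : Trm (Id z w)) : Trm (Id ((p ⬝ q) ⬝ r) (p ⬝ q ⬝ r)) :=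
  J (fun x y p ↦ (q : Trm (Id y z)) → Trm (Id ((p ⬝ q) ⬝ r) (p ⬝ q ⬝ r)))
    (fun _ q ↦ cv (refl (q ⬝ r))) p q

def concatAssoc := @gl 61 _ _ @concatAssocTm

def whiskerLeftTm {A : Ex} {x y z : Trm A} (p : Trm (Id x y)) {q r : Trm (Id y z)}
    (h : Trm (Id q r)) : Trm (Id (p ⬝ q) (p ⬝ r)) :=
  ap (fun q ↦ p ⬝ q) h

def whiskerLeft := @gl 62 _ _ @whiskerLeftTm

def whiskerRightTm {A : Ex} {x y z : Trm A} {p q : Trm (Id x y)} (h : Trm (Id p q))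
    (r : Trm (Id y z)) : Trm (Id (p ⬝ r) (q ⬝ r)) :=
  ap (fun p ↦ p ⬝ r) h

def whiskerRight := @gl 63 _ _ @whiskerRightTm

def cancelLeftTm {A : Ex} {x y z : Trm A} (p : Trm (Id x y)) {q r : Trm (Id y z)}
    (h : Trm (Id (p ⬝ q) (p ⬝ r))) : Trm (Id q r) :=
  J (fun x y p ↦ (q r : Trm (Id y z)) → Trm (Id (p ⬝ q) (p ⬝ r)) → Trm (Id q r))
    (fun _ _ _ h ↦ cv h) p q r h

def cancelLeft := @gl 64 _ _ @cancelLeftTm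

def apConcatTm {A B : Ex} (f : Trm A → Trm B) {x y z : Trm A} (p : Trm (Id x y))
    (q : Trm (Id y z)) : Trm (Id (ap f (p ⬝ q)) (ap f p ⬝ ap f q)) :=
  J (fun x y p ↦ (q : Trm (Id y z)) → Trm (Id (ap f (p ⬝ q)) (ap f p ⬝ ap f q)))
    (fun _ q ↦ cv (refl (ap f q))) p q

def apConcat := @gl 65 _ _ @apConcatTm

def apCompTm {A B C : Ex} (g : Trm B → Trm C) (f : Trm A → Trm B) {x y : Trm A}
    (p : Trm (Id x y)) : Trm (Id (ap g (ap f p)) (ap (fun x ↦ g (f x)) p)) :=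
  J (fun x y p ↦ Trm (Id (ap g (ap f p)) (ap (fun x ↦ g (f x)) p)))
    (fun x ↦ cv (refl (refl (g (f x))))) p

def apComp := @gl 66 _ _ @apCompTm

def apIdTm {A : Ex} {x y : Trm A} (p : Trm (Id x y)) : Trm (Id (ap (fun x ↦ x) p) p) :=
  J (fun x y p ↦ Trm (Id (ap (fun x ↦ x) p) p)) (fun x ↦ cv (refl (refl x))) p

def apId := @gl 67 _ _ @apIdTm

/-! #### Propositions and sets -/

/-- Every `p` satisfies `h x x ⬝ p = h x z` by path induction, so two parallel paths agree after
cancelling `h x x`. -/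
def isSetOfIsPropTm {X : Ex} (h : IsProp X) : IsSet X := fun x y p q ↦
  let key {z : Trm X} (p : Trm (Id x z)) : Trm (Id (h x x ⬝ p) (h x z)) :=
    J (fun x z p ↦ Trm (Id (h x x ⬝ p) (h x z))) (fun x ↦ concatRefl (h x x)) p
  cancelLeft (h x x) (key p ⬝ inverse (key q))

def isSetOfIsProp := @gl 68 _ _ @isSetOfIsPropTm

def is1TypeOfIsSetTm {X : Ex} (h : IsSet X) : Is1Type X := fun x y ↦ isSetOfIsProp (h x y)

def is1TypeOfIsSet := @gl 69 _ _ @is1TypeOfIsSetTm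

/-! #### Paths over paths in constant families -/

/-- Transport in a constant family is the identity only up to a path. Routing all data through
`constOver`, which is injective, turns the dependent eliminators into recursors whose computation
rules speak of `ap` instead of `apd`. -/
def constOverTm {A X : Ex} {x y : Trm A} (p : Trm (Id x y)) {u v : Trm X} (w : Trm (Id u v)) :
    Trm (pathOver (fun _ ↦ X) p u v) :=
  J (fun _ _ p ↦ Trm (Id u v) → Trm (pathOver (fun _ ↦ X) p u v)) (fun _ w ↦ cv w) p w

def constOver := @gl 70 _ _ @constOverTm

def constOverInjTm {A X : Ex} {x y : Trm A} (p : Trm (Id x y)) {u v : Trm X} {w w' : Trm (Id u v)}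
    (h : Trm (Id (constOver p w) (constOver p w'))) : Trm (Id w w') :=
  J (fun _ _ p ↦ Trm (Id (constOver p w) (constOver p w')) → Trm (Id w w')) (fun _ h ↦ cv h) p h

def constOverInj := @gl 71 _ _ @constOverInjTm

def apdConstTm {A X : Ex} (f : Trm A → Trm X) {x y : Trm A} (p : Trm (Id x y)) :
    Trm (Id (apd (fun _ ↦ X) f p) (constOver p (ap f p))) :=
  J (fun _ _ p ↦ Trm (Id (apd (fun _ ↦ X) f p) (constOver p (ap f p))))
    (fun x ↦ cv (refl (refl (f x)))) p

def apdConst := @gl 72 _ _ @apdConstTm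

def concatOverConstTm {A X : Ex} {x y z : Trm A} (p : Trm (Id x y)) (q : Trm (Id y z))
    {u v w : Trm X} (r : Trm (Id u v)) (s : Trm (Id v w)) :
    Trm (Id (concatOver (fun _ ↦ X) (constOver p r) (constOver q s)) (constOver (p ⬝ q) (r ⬝ s))) :=
  J (fun _ y p ↦ (q : Trm (Id y z)) →
      Trm (Id (concatOver (fun _ ↦ X) (constOver p r) (constOver q s))
        (constOver (p ⬝ q) (r ⬝ s))))
    (fun x q ↦ J (fun _ v r ↦ (s : Trm (Id v w)) →
        Trm (Id (concatOver (fun _ ↦ X) (constOver (refl x) r) (constOver q s))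
          (constOver (refl x ⬝ q) (r ⬝ s))))
      (fun _ s ↦ cv (refl (constOver q s))) r s) p q

def concatOverConst := @gl 73 _ _ @concatOverConstTm

def concatOverEqTm {A X : Ex} {x y z : Trm A} {p : Trm (Id x y)} {q : Trm (Id y z)}
    {u v w : Trm X} {r : Trm (Id u v)} {s : Trm (Id v w)}
    {r' : Trm (pathOver (fun _ ↦ X) p u v)} {s' : Trm (pathOver (fun _ ↦ X) q v w)}
    (hr : Trm (Id r' (constOver p r))) (hs : Trm (Id s' (constOver q s))) :
    Trm (Id (concatOver (fun _ ↦ X) r' s') (constOver (p ⬝ q) (r ⬝ s))) :=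
  ap (fun r' ↦ concatOver (fun _ ↦ X) r' s') hr ⬝
    ap (fun s' ↦ concatOver (fun _ ↦ X) (constOver p r) s') hs ⬝ concatOverConst p q r s

def concatOverEq := @gl 74 _ _ @concatOverEqTm

/-- The two-dimensional analogue of `constOver`: it produces the data that the eliminators want over
`fMu`, `aSw` and `aOv` from an ordinary 2-path `k`. -/
def constOverOverTm {A X : Ex} {x y : Trm A} {p q : Trm (Id x y)} (h : Trm (Id p q))
    {u v : Trm X} {r s : Trm (Id u v)} {r' : Trm (pathOver (fun _ ↦ X) p u v)}
    {s' : Trm (pathOver (fun _ ↦ X) q u v)} (hr : Trm (Id r' (constOver p r)))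
    (k : Trm (Id r s)) (hs : Trm (Id s' (constOver q s))) :
    Trm (pathOver (fun q ↦ pathOver (fun _ ↦ X) q u v) h r' s') :=
  J (fun p q h ↦ (r' : Trm (pathOver (fun _ ↦ X) p u v)) →
      (s' : Trm (pathOver (fun _ ↦ X) q u v)) → Trm (Id r' (constOver p r)) →
        Trm (Id s' (constOver q s)) → Trm (pathOver (fun q ↦ pathOver (fun _ ↦ X) q u v) h r' s'))
    (fun p _ _ hr hs ↦ cv (hr ⬝ ap (fun r ↦ constOver p r) k ⬝ inverse hs)) h r' s' hr hs

def constOverOver := @gl 75 _ _ @constOverOverTm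

def apOverConstTm {A X : Ex} (g : Trm A → Trm A) (c : Trm X → Trm X) {x y : Trm A}
    (p : Trm (Id x y)) {u v : Trm X} (r : Trm (Id u v)) :
    Trm (Id (apOver (fun _ ↦ X) g (fun _ u ↦ c u) (constOver p r)) (constOver (ap g p) (ap c r))) :=
  J (fun _ _ p ↦ Trm (Id (apOver (fun _ ↦ X) g (fun _ u ↦ c u) (constOver p r))
      (constOver (ap g p) (ap c r))))
    (fun _ ↦ cv (refl (ap c r))) p

def apOverConst := @gl 76 _ _ @apOverConstTm

def wordOverConstTm {A X : Ex} (e : Trm (words A) → Trm X) {x y : Trm (words A)}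
    (q : Trm (Id x y)) :
    Trm (Id (wordOver (fun _ ↦ X) e q) (constOver (ap (fun x ↦ aEta x) q) (ap e q))) :=
  J (fun _ _ q ↦ Trm (Id (wordOver (fun _ ↦ X) e q)
      (constOver (ap (fun x ↦ aEta x) q) (ap e q))))
    (fun x ↦ cv (refl (refl (e x)))) q

def wordOverConst := @gl 77 _ _ @wordOverConstTm

/-! #### Recursion for the free group -/

def freeRecMuTm {A X : Ex} {c i : Trm A → Trm X → Trm X}
    {m₁ : (a : Trm A) → (p : Trm X) → Trm (Id (i a (c a p)) p)}
    {m₂ : (a : Trm A) → (p : Trm X) → Trm (Id (c a (i a p)) p)}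
    (m : (a : Trm A) → (p : Trm X) → Trm (Id (ap (fun p ↦ c a p) (m₁ a p)) (m₂ a (c a p))))
    (a : Trm A) (x : Trm (free A)) (p : Trm X) :
    Trm (Id (transportMu (fun _ ↦ X) (fun a _ p ↦ c a p) a x (i a (c a p)) p
      (constOver (fMu1 a x) (m₁ a p))) (constOver (fMu2 a (fCons a x)) (m₂ a (c a p)))) :=
  cv (constOverOver (fMu a x)
    (apOverConst (fun x ↦ fCons a x) (fun p ↦ c a p) (fMu1 a x) (m₁ a p)) (m a p)
    (refl (constOver (fMu2 a (fCons a x)) (m₂ a (c a p)))))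

def freeRecMu := @gl 78 _ _ @freeRecMuTm

def freeRecTm {A X : Ex} (u : Trm X) (c i : Trm A → Trm X → Trm X)
    (m₁ : (a : Trm A) → (p : Trm X) → Trm (Id (i a (c a p)) p))
    (m₂ : (a : Trm A) → (p : Trm X) → Trm (Id (c a (i a p)) p))
    (m : (a : Trm A) → (p : Trm X) → Trm (Id (ap (fun p ↦ c a p) (m₁ a p)) (m₂ a (c a p))))
    (x : Trm (free A)) : Trm X :=
  freeInd (fun _ ↦ X) u (fun a _ p ↦ c a p) (fun a _ p ↦ i a p)
    (fun a x p ↦ constOver (fMu1 a x) (m₁ a p)) (fun a x p ↦ constOver (fMu2 a x) (m₂ a p))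
    (fun a x p ↦ freeRecMu m a x p) x

def freeRec := @gl 79 _ _ @freeRecTm

def freeRecMu1Tm {A X : Ex} (u : Trm X) (c i : Trm A → Trm X → Trm X)
    (m₁ : (a : Trm A) → (p : Trm X) → Trm (Id (i a (c a p)) p))
    (m₂ : (a : Trm A) → (p : Trm X) → Trm (Id (c a (i a p)) p))
    (m : (a : Trm A) → (p : Trm X) → Trm (Id (ap (fun p ↦ c a p) (m₁ a p)) (m₂ a (c a p))))
    (a : Trm A) (x : Trm (free A)) :
    Trm (Id (ap (fun x ↦ freeRec u c i m₁ m₂ m x) (fMu1 a x))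
      (cv (m₁ a (freeRec u c i m₁ m₂ m x)))) :=
  constOverInj (fMu1 a x) (inverse (apdConst (fun x ↦ freeRec u c i m₁ m₂ m x) (fMu1 a x)) ⬝
    cv (freeIndMu1 (fun _ ↦ X) u (fun a _ p ↦ c a p) (fun a _ p ↦ i a p)
      (fun a x p ↦ constOver (fMu1 a x) (m₁ a p)) (fun a x p ↦ constOver (fMu2 a x) (m₂ a p))
      (fun a x p ↦ freeRecMu m a x p) a x))

def freeRecMu1 := @gl 80 _ _ @freeRecMu1Tm

def freeRecMu2Tm {A X : Ex} (u : Trm X) (c i : Trm A → Trm X → Trm X)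
    (m₁ : (a : Trm A) → (p : Trm X) → Trm (Id (i a (c a p)) p))
    (m₂ : (a : Trm A) → (p : Trm X) → Trm (Id (c a (i a p)) p))
    (m : (a : Trm A) → (p : Trm X) → Trm (Id (ap (fun p ↦ c a p) (m₁ a p)) (m₂ a (c a p))))
    (a : Trm A) (x : Trm (free A)) :
    Trm (Id (ap (fun x ↦ freeRec u c i m₁ m₂ m x) (fMu2 a x))
      (cv (m₂ a (freeRec u c i m₁ m₂ m x)))) :=
  constOverInj (fMu2 a x) (inverse (apdConst (fun x ↦ freeRec u c i m₁ m₂ m x) (fMu2 a x)) ⬝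
    cv (freeIndMu2 (fun _ ↦ X) u (fun a _ p ↦ c a p) (fun a _ p ↦ i a p)
      (fun a x p ↦ constOver (fMu1 a x) (m₁ a p)) (fun a x p ↦ constOver (fMu2 a x) (m₂ a p))
      (fun a x p ↦ freeRecMu m a x p) a x))

def freeRecMu2 := @gl 81 _ _ @freeRecMu2Tm

/-- Induction for families of sets. -/
def freeIndSetTm {A : Ex} (P : Trm (free A) → Ex) (h : (x : Trm (free A)) → IsSet (P x))
    (u : Trm (P fUnit))
    (c : (a : Trm A) → (x : Trm (free A)) → Trm (P x) → Trm (P (fCons a x)))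
    (i : (a : Trm A) → (x : Trm (free A)) → Trm (P x) → Trm (P (fICons a x)))
    (m₁ : (a : Trm A) → (x : Trm (free A)) → (p : Trm (P x)) →
      Trm (pathOver P (fMu1 a x) (i a (fCons a x) (c a x p)) p))
    (m₂ : (a : Trm A) → (x : Trm (free A)) → (p : Trm (P x)) →
      Trm (pathOver P (fMu2 a x) (c a (fICons a x) (i a x p)) p))
    (x : Trm (free A)) : Trm (P x) :=
  freeInd P u c i m₁ m₂ (fun a x p ↦ cv (h (fCons a x)
    (transport P (fMu2 a (fCons a x)) (c a (fICons a (fCons a x)) (i a (fCons a x) (c a x p))))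
    (c a x p) (cv (transportMu P c a x (i a (fCons a x) (c a x p)) p (m₁ a x p)))
    (cv (m₂ a (fCons a x) (c a x p))))) x

def freeIndSet := @gl 82 _ _ @freeIndSetTm

/-! #### Recursion for the approximation -/

def swLeftConstTm {A X : Ex} (e : Trm (words A) → Trm X) (t : Cancel e) (x : Trm (words A))
    (a : Trm (signed A)) (y : Trm (words A)) (b : Trm (signed A)) (z : Trm (words A)) :
    Trm (Id (swLeftOver (fun _ ↦ X) e (fun x a y ↦ constOver (aTau x a y) (t x a y)) x a y b z)
      (constOver (swLeft (fun x ↦ aEta x) (fun x a y ↦ aTau x a y) x a y b z)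
        (swLeft e t x a y b z))) :=
  cv (concatOverEq (refl (constOver (aTau x a (y ⧺ redex b z)) (t x a (y ⧺ redex b z))))
    (concatOverEq (wordOverConst e (assocInv x y (redex b z)))
      (refl (constOver (aTau (x ⧺ y) b z) (t (x ⧺ y) b z)))))

def swLeftConst := @gl 83 _ _ @swLeftConstTm

def swRightConstTm {A X : Ex} (e : Trm (words A) → Trm X) (t : Cancel e) (x : Trm (words A))
    (a : Trm (signed A)) (y : Trm (words A)) (b : Trm (signed A)) (z : Trm (words A)) :
    Trm (Id (swRightOver (fun _ ↦ X) e (fun x a y ↦ constOver (aTau x a y) (t x a y)) x a y b z)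
      (constOver (swRight (fun x ↦ aEta x) (fun x a y ↦ aTau x a y) x a y b z)
        (swRight e t x a y b z))) :=
  cv (concatOverEq (wordOverConst e (assocInv x (redex a y) (redex b z)))
    (concatOverEq (refl (constOver (aTau (x ⧺ redex a y) b z) (t (x ⧺ redex a y) b z)))
      (concatOverEq (wordOverConst e (assoc x (redex a y) z))
        (concatOverEq (cv (refl (constOver (aTau x a (y ⧺ z)) (t x a (y ⧺ z)))) :
            Trm (Id (A := pathOver (fun _ ↦ X) (x := aEta (x ⧺ (redex a y ⧺ z)))
              (cv (aTau x a (y ⧺ z))) (e (x ⧺ (redex a y ⧺ z))) (e (x ⧺ (y ⧺ z))))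
              (cv (constOver (aTau x a (y ⧺ z)) (t x a (y ⧺ z))))
              (constOver (cv (aTau x a (y ⧺ z))) (cv (t x a (y ⧺ z))))))
          (wordOverConst e (assocInv x y z))))))

def swRightConst := @gl 84 _ _ @swRightConstTm

def ovLeftConstTm {A X : Ex} (e : Trm (words A) → Trm X) (t : Cancel e) (x : Trm (words A))
    (a : Trm (signed A)) (y : Trm (words A)) :
    Trm (Id (ovLeftOver (fun _ ↦ X) e (fun x a y ↦ constOver (aTau x a y) (t x a y)) x a y)
      (constOver (ovLeft (fun x ↦ aEta x) (fun x a y ↦ aTau x a y) x a y) (ovLeft e t x a y))) :=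
  cv (refl (constOver (aTau x a (cons a y)) (t x a (cons a y))))

def ovLeftConst := @gl 85 _ _ @ovLeftConstTm

def ovRightConstTm {A X : Ex} (e : Trm (words A) → Trm X) (t : Cancel e) (x : Trm (words A))
    (a : Trm (signed A)) (y : Trm (words A)) :
    Trm (Id (ovRightOver (fun _ ↦ X) e (fun x a y ↦ constOver (aTau x a y) (t x a y)) x a y)
      (constOver (ovRight (fun x ↦ aEta x) (fun x a y ↦ aTau x a y) x a y) (ovRight e t x a y))) :=
  cv (concatOverEq (wordOverConst e (ins x a y))
    (concatOverEq (wordOverConst e (cv (assocInv x (cons a nil) (redex (inv a) y))))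
      (concatOverEq
        (refl (constOver (aTau (x ⧺ cons a nil) (inv a) y) (t (x ⧺ cons a nil) (inv a) y)))
        (wordOverConst e (assoc x (cons a nil) y)))))

def ovRightConst := @gl 86 _ _ @ovRightConstTm

/-- The type of exchange laws for the cancellation of two redexes. -/
abbrev Sw {A X : Ex} (e : Trm (words A) → Trm X) (t : Cancel e) : Type :=
  (x : Trm (words A)) → (a : Trm (signed A)) → (y : Trm (words A)) → (b : Trm (signed A)) →
    (z : Trm (words A)) → Trm (Id (swLeft e t x a y b z) (swRight e t x a y b z))

/-- The type of coherence laws for the cancellation of overlapping redexes. -/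
abbrev Ov {A X : Ex} (e : Trm (words A) → Trm X) (t : Cancel e) : Type :=
  (x : Trm (words A)) → (a : Trm (signed A)) → (y : Trm (words A)) →
    Trm (Id (ovLeft e t x a y) (ovRight e t x a y))

def approxRecSwTm {A X : Ex} {e : Trm (words A) → Trm X} {t : Cancel e} (s : Sw e t) :
    SwOver (fun _ ↦ X) e (fun x a y ↦ constOver (aTau x a y) (t x a y)) :=
  fun x a y b z ↦ constOverOver (aSw x a y b z) (swLeftConst e t x a y b z) (s x a y b z)
    (swRightConst e t x a y b z)

def approxRecSw := @gl 87 _ _ @approxRecSwTm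

def approxRecOvTm {A X : Ex} {e : Trm (words A) → Trm X} {t : Cancel e} (o : Ov e t) :
    OvOver (fun _ ↦ X) e (fun x a y ↦ constOver (aTau x a y) (t x a y)) :=
  fun x a y ↦ constOverOver (aOv x a y) (ovLeftConst e t x a y) (o x a y) (ovRightConst e t x a y)

def approxRecOv := @gl 88 _ _ @approxRecOvTm

def approxRecTm {A X : Ex} (h : Is1Type X) (e : Trm (words A) → Trm X) (t : Cancel e)
    (s : Sw e t) (o : Ov e t) (n : Trm (approx A)) : Trm X :=
  approxInd (fun _ ↦ X) (fun _ ↦ h) e (fun x a y ↦ constOver (aTau x a y) (t x a y))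
    (fun x a y b z ↦ approxRecSw s x a y b z) (fun x a y ↦ approxRecOv o x a y) n

def approxRec := @gl 89 _ _ @approxRecTm

def approxRecTauTm {A X : Ex} (h : Is1Type X) (e : Trm (words A) → Trm X) (t : Cancel e)
    (s : Sw e t) (o : Ov e t) (x : Trm (words A)) (a : Trm (signed A)) (y : Trm (words A)) :
    Trm (Id (ap (fun n ↦ approxRec h e t s o n) (aTau x a y)) (cv (t x a y))) :=
  constOverInj (aTau x a y)
    (inverse (apdConst (fun n ↦ approxRec h e t s o n) (aTau x a y)) ⬝
      cv (approxIndTau (fun _ ↦ X) (fun _ ↦ h) e (fun x a y ↦ constOver (aTau x a y) (t x a y))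
        (fun x a y b z ↦ approxRecSw s x a y b z) (fun x a y ↦ approxRecOv o x a y) x a y))

def approxRecTau := @gl 90 _ _ @approxRecTauTm

def swOverOfIsSetTm {A : Ex} (P : Trm (approx A) → Ex) (h : (n : Trm (approx A)) → IsSet (P n))
    (e : (x : Trm (words A)) → Trm (P (aEta x))) (t : CancelOver P e) : SwOver P e t :=
  fun x a y b z ↦ cv (h (aEta ((x ⧺ y) ⧺ z))
    (transport P (swRight (fun x ↦ aEta x) (fun x a y ↦ aTau x a y) x a y b z)
      (e (x ⧺ redex a (y ⧺ redex b z)))) (e ((x ⧺ y) ⧺ z))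
    (cv (transport (fun q ↦ pathOver P q (e (x ⧺ redex a (y ⧺ redex b z)))
      (e ((x ⧺ y) ⧺ z))) (aSw x a y b z) (swLeftOver P e t x a y b z)))
    (cv (swRightOver P e t x a y b z)))

def swOverOfIsSet := @gl 91 _ _ @swOverOfIsSetTm

def ovOverOfIsSetTm {A : Ex} (P : Trm (approx A) → Ex) (h : (n : Trm (approx A)) → IsSet (P n))
    (e : (x : Trm (words A)) → Trm (P (aEta x))) (t : CancelOver P e) : OvOver P e t :=
  fun x a y ↦ cv (h (aEta (x ⧺ cons a y))
    (transport P (ovRight (fun x ↦ aEta x) (fun x a y ↦ aTau x a y) x a y)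
      (e (x ⧺ redex a (cons a y)))) (e (x ⧺ cons a y))
    (cv (transport (fun q ↦ pathOver P q (e (x ⧺ redex a (cons a y)))
      (e (x ⧺ cons a y))) (aOv x a y) (ovLeftOver P e t x a y)))
    (cv (ovRightOver P e t x a y)))

def ovOverOfIsSet := @gl 92 _ _ @ovOverOfIsSetTm

/-- Induction for families of sets. -/
def approxIndSetTm {A : Ex} (P : Trm (approx A) → Ex) (h : (n : Trm (approx A)) → IsSet (P n))
    (e : (x : Trm (words A)) → Trm (P (aEta x))) (t : CancelOver P e) (n : Trm (approx A)) :
    Trm (P n) :=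
  approxInd P (fun n ↦ is1TypeOfIsSet (h n)) e t (fun x a y b z ↦ swOverOfIsSet P h e t x a y b z)
    (fun x a y ↦ ovOverOfIsSet P h e t x a y) n

def approxIndSet := @gl 93 _ _ @approxIndSetTm

/-- Induction for families of propositions. -/
def approxIndPropTm {A : Ex} (P : Trm (approx A) → Ex) (h : (n : Trm (approx A)) → IsProp (P n))
    (e : (x : Trm (words A)) → Trm (P (aEta x))) (n : Trm (approx A)) : Trm (P n) :=
  approxIndSet P (fun n ↦ isSetOfIsProp (h n)) e (fun x a y ↦ cv (h (aEta (x ⧺ y))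
    (transport P (aTau x a y) (e (x ⧺ redex a y))) (e (x ⧺ y)))) n

def approxIndProp := @gl 94 _ _ @approxIndPropTm

/-- In a family of identity types a path over `p` amounts to a naturality square along `p`; over a
reflexivity path the square says that `r` and `s` agree. -/
def squareOverTm {A X : Ex} {f g : Trm A → Trm X} {x y : Trm A} (p : Trm (Id x y))
    {r : Trm (Id (f x) (g x))} {s : Trm (Id (f y) (g y))}
    (h : Trm (Id (ap f p ⬝ s) (r ⬝ ap g p))) : Trm (pathOver (fun x ↦ Id (f x) (g x)) p r s) :=
  J (fun x y p ↦ (r : Trm (Id (f x) (g x))) → (s : Trm (Id (f y) (g y))) →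
      Trm (Id (ap f p ⬝ s) (r ⬝ ap g p)) → Trm (pathOver (fun x ↦ Id (f x) (g x)) p r s))
    (fun x r s h ↦ cv (inverse ((cv h : Trm (Id s (r ⬝ refl (g x)))) ⬝ concatRefl r))) p r s h

def squareOver := @gl 95 _ _ @squareOverTm

/-- Two functions on the approximation agree if they agree on words, naturally with respect to
the cancellation of redexes. -/
def approxIndIdTm {A X : Ex} (h : Is1Type X) (f g : Trm (approx A) → Trm X)
    (E : (x : Trm (words A)) → Trm (Id (f (aEta x)) (g (aEta x))))
    (S : (x : Trm (words A)) → (a : Trm (signed A)) → (y : Trm (words A)) →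
      Trm (Id (ap f (aTau x a y) ⬝ E (x ⧺ y)) (E (x ⧺ redex a y) ⬝ ap g (aTau x a y))))
    (n : Trm (approx A)) : Trm (Id (f n) (g n)) :=
  approxIndSet (fun n ↦ Id (f n) (g n)) (fun n ↦ h (f n) (g n)) E
    (fun x a y ↦ squareOver (aTau x a y) (S x a y)) n

def approxIndId := @gl 96 _ _ @approxIndIdTm

/-! #### Further laws of paths -/

def concatCongrTm {A : Ex} {x y z : Trm A} {p p' : Trm (Id x y)} {q q' : Trm (Id y z)}
    (h : Trm (Id p p')) (k : Trm (Id q q')) : Trm (Id (p ⬝ q) (p' ⬝ q')) :=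
  whiskerRight h q ⬝ whiskerLeft p' k

def concatCongr := @gl 97 _ _ @concatCongrTm

def concatApTm {A B : Ex} (f : Trm A → Trm B) {x y z : Trm A} {p : Trm (Id x y)}
    {q : Trm (Id y z)} {p' : Trm (Id (f x) (f y))} {q' : Trm (Id (f y) (f z))}
    (h : Trm (Id p' (ap f p))) (k : Trm (Id q' (ap f q))) :
    Trm (Id (p' ⬝ q') (ap f (p ⬝ q))) :=
  concatCongr h k ⬝ inverse (apConcat f p q)

def concatAp := @gl 98 _ _ @concatApTm

def inverseConcatConcatTm {A : Ex} {x y z : Trm A} (p : Trm (Id x y)) (q : Trm (Id y z)) :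
    Trm (Id (inverse p ⬝ p ⬝ q) q) :=
  J (fun _ y p ↦ (q : Trm (Id y z)) → Trm (Id (inverse p ⬝ p ⬝ q) q))
    (fun _ q ↦ cv (refl q)) p q

def inverseConcatConcat := @gl 99 _ _ @inverseConcatConcatTm

def cancelRightTm {A : Ex} {x y z : Trm A} {p q : Trm (Id x y)} (r : Trm (Id y z))
    (h : Trm (Id (p ⬝ r) (q ⬝ r))) : Trm (Id p q) :=
  J (fun y z r ↦ (p q : Trm (Id x y)) → Trm (Id (p ⬝ r) (q ⬝ r)) → Trm (Id p q))
    (fun _ p q h ↦ inverse (concatRefl p) ⬝ h ⬝ concatRefl q) r p q h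

def cancelRight := @gl 100 _ _ @cancelRightTm

def contractTm {X Y : Ex} (f : Trm Y → Trm X) (g : Trm X → Trm Y)
    (C : (x : Trm X) → Trm (Id (f (g x)) x)) {x y : Trm X} (p : Trm (Id x y)) :
    Trm (Id (C x ⬝ p) (ap f (ap g p) ⬝ C y)) :=
  J (fun x y p ↦ Trm (Id (C x ⬝ p) (ap f (ap g p) ⬝ C y))) (fun x ↦ cv (concatRefl (C x))) p

/-- Naturality of a homotopy from a composite to the identity. -/
def contract := @gl 101 _ _ @contractTm

/-- Naturality of `C` along its own component `C x`, with `C x` cancelled on the right. -/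
def contractSelfTm {X Y : Ex} (f : Trm Y → Trm X) (g : Trm X → Trm Y)
    (C : (x : Trm X) → Trm (Id (f (g x)) x)) (x : Trm X) :
    Trm (Id (C (f (g x))) (ap f (ap g (C x)))) :=
  cancelRight (C x) (contract f g C (C x))

def contractSelf := @gl 102 _ _ @contractSelfTm

def adjointSymmTm {X : Ex} (c i : Trm X → Trm X) (m₁ : (x : Trm X) → Trm (Id (i (c x)) x))
    (m₂ : (x : Trm X) → Trm (Id (c (i x)) x))
    (m : (x : Trm X) → Trm (Id (ap c (m₁ x)) (m₂ (c x)))) (y : Trm X) :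
    Trm (Id (ap i (m₂ y)) (m₁ (i y))) :=
  -- By the first triangle law and two instances of `contractSelf`, the path cancelled here equals
  -- `m₁ (i (c (i y)))`. Naturality of `m₁` along `ap i (m₂ y)` then compares the two sides.
  cancelLeft (ap i (ap c (ap i (m₂ y)))) (whiskerRight (inverse (contractSelf i c m₁ (i y) ⬝
    ap (fun p ↦ ap i p) (m (i y)) ⬝ ap (fun p ↦ ap i p) (contractSelf c i m₂ y))) (ap i (m₂ y)) ⬝
      contract i c m₁ (ap i (m₂ y)))

/-- The second triangle law of a half-adjoint equivalence. -/
def adjointSymm := @gl 103 _ _ @adjointSymmTm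

/-- Extends a decomposition of `k` through the cancellation `C` along a further path `p`; on `p`
this is naturality of `C`. It serves both composites of the final equivalence, at the point where
two opposite letters meet. -/
def squareContractTm {X : Ex} (f g : Trm X → Trm X) (C : (x : Trm X) → Trm (Id (f (g x)) x))
    {w v s t : Trm X} {k : Trm (Id w s)} {h : Trm (Id w (f v))} {h' : Trm (Id v (g s))}
    (K : Trm (Id k (h ⬝ ap f h' ⬝ C s))) (p : Trm (Id s t)) :
    Trm (Id (k ⬝ p) ((h ⬝ ap f (h' ⬝ ap g p)) ⬝ C t)) :=
  J (fun s t p ↦ (k : Trm (Id w s)) → (h' : Trm (Id v (g s))) →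
      Trm (Id k (h ⬝ ap f h' ⬝ C s)) → Trm (Id (k ⬝ p) ((h ⬝ ap f (h' ⬝ ap g p)) ⬝ C t)))
    (fun s k h' K ↦ cv (concatRefl k ⬝ K ⬝ inverse (concatAssoc h (ap f h') (C s)) ⬝
      ap (fun r ↦ (h ⬝ ap f r) ⬝ C s) (inverse (concatRefl h')))) p k h' K

def squareContract := @gl 104 _ _ @squareContractTm

/-- If `F` intertwines `f` with `g`, a naturality square stays a square after acting with one more
letter. This is the inductive step over the letters in front of a redex. -/
def squareStepTm {X Y : Ex} (F : Trm X → Trm Y) (f : Trm X → Trm X) (g : Trm Y → Trm Y)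
    (H : (x : Trm X) → Trm (Id (F (f x)) (g (F x)))) {s t : Trm X} (q : Trm (Id s t))
    {n m : Trm Y} {E₁ : Trm (Id (F s) n)} {E₂ : Trm (Id (F t) m)} {r : Trm (Id n m)}
    {r' : Trm (Id (g n) (g m))} (h : Trm (Id (ap F q ⬝ E₂) (E₁ ⬝ r))) (hr : Trm (Id (ap g r) r')) :
    Trm (Id (ap F (ap f q) ⬝ H t ⬝ ap g E₂) ((H s ⬝ ap g E₁) ⬝ r')) :=
  J (fun s t q ↦ (E₁ : Trm (Id (F s) n)) → (E₂ : Trm (Id (F t) m)) →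
      Trm (Id (ap F q ⬝ E₂) (E₁ ⬝ r)) →
        Trm (Id (ap F (ap f q) ⬝ H t ⬝ ap g E₂) ((H s ⬝ ap g E₁) ⬝ r')))
    (fun s E₁ E₂ h ↦ cv (whiskerLeft (H s) (ap (fun p ↦ ap g p) (cv h : Trm (Id E₂ (E₁ ⬝ r))) ⬝
      apConcat g E₁ r ⬝ whiskerLeft (ap g E₁) hr) ⬝
        inverse (concatAssoc (H s) (ap g E₁) r'))) q E₁ E₂ h

def squareStep := @gl 105 _ _ @squareStepTm

/-! #### Cancellation after prefixing a letter, and after applying a function -/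

def apConsTm {A X : Ex} (e : Trm (words A) → Trm X) (c : Trm (signed A)) {x y : Trm (words A)}
    (p : Trm (Id x y)) : Trm (Id (ap (fun x ↦ e (cons c x)) p) (ap e (ap (fun x ↦ cons c x) p))) :=
  inverse (apComp e (fun x ↦ cons c x) p)

def apCons := @gl 106 _ _ @apConsTm

def apConsInverseTm {A X : Ex} (e : Trm (words A) → Trm X) (c : Trm (signed A))
    {x y : Trm (words A)} (p : Trm (Id x y)) :
    Trm (Id (ap (fun x ↦ e (cons c x)) (inverse p))
      (ap e (inverse (ap (fun x ↦ cons c x) p)))) :=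
  J (fun x y p ↦ Trm (Id (ap (fun x ↦ e (cons c x)) (inverse p))
      (ap e (inverse (ap (fun x ↦ cons c x) p)))))
    (fun x ↦ cv (refl (refl (e (cons c x))))) p

def apConsInverse := @gl 107 _ _ @apConsInverseTm

abbrev consCancel {A X : Ex} {e : Trm (words A) → Trm X} (t : Cancel e) (c : Trm (signed A)) :
    Cancel (fun x ↦ e (cons c x)) :=
  fun x a y ↦ cv (t (cons c x) a y)

/-- Concatenation and associativity compute on a leading letter, so putting `c` into the function or
into the left context gives the same terms except for the re-bracketing paths, where `ap` of a
composite meets an iterated `ap`. -/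
def swLeftConsTm {A X : Ex} (e : Trm (words A) → Trm X) (t : Cancel e) (c : Trm (signed A))
    (x : Trm (words A)) (a : Trm (signed A)) (y : Trm (words A)) (b : Trm (signed A))
    (z : Trm (words A)) :
    Trm (Id (swLeft (fun x ↦ e (cons c x)) (consCancel t c) x a y b z)
      (cv (swLeft e t (cons c x) a y b z))) :=
  cv (whiskerLeft (t (cons c x) a (y ⧺ redex b z))
    (whiskerRight (cv (apConsInverse e c (assoc x y (redex b z))) :
        Trm (Id (cv (ap (fun x ↦ e (cons c x)) (assocInv x y (redex b z))))
          (ap e (assocInv (cons c x) y (redex b z)))))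
      (t (cons c x ⧺ y) b z)))

def swLeftCons := @gl 108 _ _ @swLeftConsTm

def swRightConsTm {A X : Ex} (e : Trm (words A) → Trm X) (t : Cancel e) (c : Trm (signed A))
    (x : Trm (words A)) (a : Trm (signed A)) (y : Trm (words A)) (b : Trm (signed A))
    (z : Trm (words A)) :
    Trm (Id (swRight (fun x ↦ e (cons c x)) (consCancel t c) x a y b z)
      (cv (swRight e t (cons c x) a y b z))) :=
  cv (concatCongr (apConsInverse e c (assoc x (redex a y) (redex b z)))
    (whiskerLeft (cv (t (cons c x ⧺ redex a y) b z))
      (concatCongr (apCons e c (assoc x (redex a y) z))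
        (whiskerLeft (cv (t (cons c x) a (y ⧺ z))) (apConsInverse e c (assoc x y z))))))

def swRightCons := @gl 109 _ _ @swRightConsTm

def ovRightConsTm {A X : Ex} (e : Trm (words A) → Trm X) (t : Cancel e) (c : Trm (signed A))
    (x : Trm (words A)) (a : Trm (signed A)) (y : Trm (words A)) :
    Trm (Id (ovRight (fun x ↦ e (cons c x)) (consCancel t c) x a y)
      (cv (ovRight e t (cons c x) a y))) :=
  cv (concatCongr (p' := cv (ap e (ins (cons c x) a y)))
    (apCons e c (ins x a y) ⬝ cv (ap (fun p ↦ ap e p) (apComp (fun x ↦ cons c x)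
      (fun b ↦ x ⧺ cons a (cons (inv a) (cons b y))) (inverse (invInv a)))))
    (concatCongr (y := e ((cons c x ⧺ cons a nil) ⧺ redex (inv a) y))
      (p := cv (ap (fun x ↦ e (cons c x)) (assocInv x (cons a nil) (redex (inv a) y))))
      (p' := cv (ap e (assocInv (cons c x) (cons a nil) (redex (inv a) y))))
      (cv (apConsInverse e c (assoc x (cons a nil) (redex (inv a) y))))
      (whiskerLeft (cv (t (cons c x ⧺ cons a nil) (inv a) y))
        (apCons e c (assoc x (cons a nil) y)))))

def ovRightCons := @gl 110 _ _ @ovRightConsTm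

/-- Every segment of the composite is either a cancellation or the image of a path of words, and `ap
f` respects both as well as composition. -/
def swLeftApTm {A X Y : Ex} (f : Trm X → Trm Y) (e : Trm (words A) → Trm X) (t : Cancel e)
    (x : Trm (words A)) (a : Trm (signed A)) (y : Trm (words A)) (b : Trm (signed A))
    (z : Trm (words A)) :
    Trm (Id (swLeft (fun x ↦ f (e x)) (fun x a y ↦ ap f (t x a y)) x a y b z)
      (ap f (swLeft e t x a y b z))) :=
  cv (concatAp f (refl (ap f (t x a (y ⧺ redex b z))))
    (concatAp f (inverse (apComp f e (assocInv x y (redex b z))))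
      (refl (ap f (t (x ⧺ y) b z)))))

def swLeftAp := @gl 111 _ _ @swLeftApTm

def swRightApTm {A X Y : Ex} (f : Trm X → Trm Y) (e : Trm (words A) → Trm X) (t : Cancel e)
    (x : Trm (words A)) (a : Trm (signed A)) (y : Trm (words A)) (b : Trm (signed A))
    (z : Trm (words A)) :
    Trm (Id (swRight (fun x ↦ f (e x)) (fun x a y ↦ ap f (t x a y)) x a y b z)
      (ap f (swRight e t x a y b z))) :=
  cv (concatAp f (inverse (apComp f e (assocInv x (redex a y) (redex b z))))
    (concatAp f (refl (ap f (t (x ⧺ redex a y) b z)))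
      (concatAp f (inverse (apComp f e (assoc x (redex a y) z)))
        (concatAp f (p := cv (t x a (y ⧺ z))) (p' := cv (ap f (t x a (y ⧺ z))))
          (cv (refl (ap f (t x a (y ⧺ z)))))
          (inverse (apComp f e (assocInv x y z)))))))

def swRightAp := @gl 112 _ _ @swRightApTm

def ovRightApTm {A X Y : Ex} (f : Trm X → Trm Y) (e : Trm (words A) → Trm X) (t : Cancel e)
    (x : Trm (words A)) (a : Trm (signed A)) (y : Trm (words A)) :
    Trm (Id (ovRight (fun x ↦ f (e x)) (fun x a y ↦ ap f (t x a y)) x a y)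
      (ap f (ovRight e t x a y))) :=
  cv (concatAp f (inverse (apComp f e (ins x a y)))
    (concatAp f (p := cv (ap e (assocInv x (cons a nil) (redex (inv a) y))))
      (p' := cv (ap (fun x ↦ f (e x)) (assocInv x (cons a nil) (redex (inv a) y))))
      (cv (inverse (apComp f e (assocInv x (cons a nil) (redex (inv a) y)))))
      (concatAp f (refl (ap f (t (x ⧺ cons a nil) (inv a) y)))
        (inverse (apComp f e (assoc x (cons a nil) y))))))

def ovRightAp := @gl 113 _ _ @ovRightApTm

/-! #### Prefixing a letter in the approximation -/

def aConsSwTm {A : Ex} (c : Trm (signed A)) :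
    Sw (fun x ↦ aEta (cons c x)) (consCancel (fun x a y ↦ aTau x a y) c) :=
  fun x a y b z ↦ swLeftCons (fun x ↦ aEta x) (fun x a y ↦ aTau x a y) c x a y b z ⬝
    cv (aSw (cons c x) a y b z) ⬝
      inverse (swRightCons (fun x ↦ aEta x) (fun x a y ↦ aTau x a y) c x a y b z)

def aConsSw := @gl 114 _ _ @aConsSwTm

def aConsOvTm {A : Ex} (c : Trm (signed A)) :
    Ov (fun x ↦ aEta (cons c x)) (consCancel (fun x a y ↦ aTau x a y) c) :=
  fun x a y ↦ cv (aOv (cons c x) a y) ⬝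
    inverse (ovRightCons (fun x ↦ aEta x) (fun x a y ↦ aTau x a y) c x a y)

def aConsOv := @gl 115 _ _ @aConsOvTm

/-- All relations are imposed under an arbitrary left context, so prefixing `c` preserves each by
the same constructor with `c` added to its left context. -/
def aConsTm {A : Ex} (c : Trm (signed A)) (n : Trm (approx A)) : Trm (approx A) :=
  approxRec aTr (fun x ↦ aEta (cons c x)) (consCancel (fun x a y ↦ aTau x a y) c)
    (fun x a y b z ↦ aConsSw c x a y b z) (fun x a y ↦ aConsOv c x a y) n

def aCons := @gl 116 _ _ @aConsTm

def aConsTauTm {A : Ex} (c : Trm (signed A)) (x : Trm (words A)) (a : Trm (signed A))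
    (y : Trm (words A)) :
    Trm (Id (ap (fun n ↦ aCons c n) (aTau x a y)) (cv (aTau (cons c x) a y))) :=
  cv (approxRecTau aTr (fun x ↦ aEta (cons c x)) (consCancel (fun x a y ↦ aTau x a y) c)
    (fun x a y b z ↦ aConsSw c x a y b z) (fun x a y ↦ aConsOv c x a y) x a y)

def aConsTau := @gl 117 _ _ @aConsTauTm

/-- Naturality of cancellation at the front against cancellation further right is `aSw` with empty
left context, where the re-bracketings compute away and only a trailing `refl` is left. -/
def aCancelTauTm {A : Ex} (a : Trm (signed A)) (x : Trm (words A)) (b : Trm (signed A))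
    (y : Trm (words A)) :
    Trm (Id (ap (fun n ↦ aCons a (aCons (inv a) n)) (aTau x b y) ⬝ cv (aTau nil a (x ⧺ y)))
      (cv (aTau nil a (x ⧺ redex b y)) ⬝ ap (fun n ↦ n) (aTau x b y))) :=
  concatCongr (p' := cv (aTau (redex a x) b y))
      (inverse (apComp (fun n ↦ aCons a n) (fun n ↦ aCons (inv a) n) (aTau x b y)) ⬝
        ap (fun p ↦ ap (fun n ↦ aCons a n) p) (aConsTau (inv a) x b y) ⬝
          cv (aConsTau a (cons (inv a) x) b y))
      (inverse (concatRefl (cv (aTau nil a (x ⧺ y))))) ⬝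
    cv (inverse (aSw nil a x b y)) ⬝
      whiskerLeft (cv (aTau nil a (x ⧺ redex b y))) (inverse (apId (aTau x b y)))

def aCancelTau := @gl 118 _ _ @aCancelTauTm

def aCancelTm {A : Ex} (a : Trm (signed A)) (n : Trm (approx A)) :
    Trm (Id (aCons a (aCons (inv a) n)) n) :=
  approxIndId aTr (fun n ↦ aCons a (aCons (inv a) n)) (fun n ↦ n) (fun x ↦ cv (aTau nil a x))
    (fun x b y ↦ aCancelTau a x b y) n

def aCancel := @gl 119 _ _ @aCancelTm

/-- Parallel 2-paths in a 1-type form a proposition, so words suffice. There the two sides cancel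
the first and the second pair in a ā a x, and `aOv` with empty left context identifies them. -/
def aCancelConsTm {A : Ex} (a : Trm A) (n : Trm (approx A)) :
    Trm (Id (ap (fun n ↦ aCons (inl a) n) (aCancel (inr a) n))
      (cv (aCancel (inl a) (aCons (inl a) n)))) :=
  approxIndProp
    (fun n ↦ Id (ap (fun n ↦ aCons (inl a) n) (aCancel (inr a) n))
      (cv (aCancel (inl a) (aCons (inl a) n))))
    (fun n ↦ aTr (aCons (inl a) (aCons (inr a) (aCons (inv (inr a)) n))) (aCons (inl a) n)
      (ap (fun n ↦ aCons (inl a) n) (aCancel (inr a) n)) (cv (aCancel (inl a) (aCons (inl a) n))))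
    (fun x ↦ cv (aConsTau (inl a) nil (inr a) x) ⬝
      inverse (concatRefl (cv (aTau (cons (inl a) nil) (inr a) x))) ⬝
        cv (inverse (aOv nil (inl a) x))) n

def aCancelCons := @gl 120 _ _ @aCancelConsTm

def freeToApproxTm {A : Ex} (x : Trm (free A)) : Trm (approx A) :=
  freeRec (aEta nil) (fun a n ↦ aCons (inl a) n) (fun a n ↦ aCons (inr a) n)
    (fun a n ↦ cv (aCancel (inr a) n)) (fun a n ↦ cv (aCancel (inl a) n))
    (fun a n ↦ cv (aCancelCons a n)) x

def freeToApprox := @gl 121 _ _ @freeToApproxTm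

def freeToApproxMu1Tm {A : Ex} (a : Trm A) (x : Trm (free A)) :
    Trm (Id (ap (fun x ↦ freeToApprox x) (fMu1 a x)) (cv (aCancel (inr a) (freeToApprox x)))) :=
  cv (freeRecMu1 (aEta nil) (fun a n ↦ aCons (inl a) n) (fun a n ↦ aCons (inr a) n)
    (fun a n ↦ cv (aCancel (inr a) n)) (fun a n ↦ cv (aCancel (inl a) n))
    (fun a n ↦ cv (aCancelCons a n)) a x)

def freeToApproxMu1 := @gl 122 _ _ @freeToApproxMu1Tm

def freeToApproxMu2Tm {A : Ex} (a : Trm A) (x : Trm (free A)) :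
    Trm (Id (ap (fun x ↦ freeToApprox x) (fMu2 a x)) (cv (aCancel (inl a) (freeToApprox x)))) :=
  cv (freeRecMu2 (aEta nil) (fun a n ↦ aCons (inl a) n) (fun a n ↦ aCons (inr a) n)
    (fun a n ↦ cv (aCancel (inr a) n)) (fun a n ↦ cv (aCancel (inl a) n))
    (fun a n ↦ cv (aCancelCons a n)) a x)

def freeToApproxMu2 := @gl 123 _ _ @freeToApproxMu2Tm

/-! #### The free 1-group -/

/-- The 1-truncation of the free group. -/
abbrev free₁ (A : Ex) : Ex := trunc (free A)

/-- The identity types of a 1-type are sets, in particular 1-types, so the eliminator of the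
truncation applies to them. -/
def truncIndIdTm {X Y : Ex} (h : Is1Type Y) (f g : Trm (trunc X) → Trm Y)
    (E : (x : Trm X) → Trm (Id (f (truncMk x)) (g (truncMk x)))) (x : Trm (trunc X)) :
    Trm (Id (f x) (g x)) :=
  truncInd (fun x ↦ Id (f x) (g x)) (fun x ↦ is1TypeOfIsSet (h (f x) (g x))) E x

def truncIndId := @gl 124 _ _ @truncIndIdTm

def truncIndIdIdTm {X Y : Ex} (h : Is1Type Y) (f g : Trm (trunc X) → Trm Y)
    (p q : (x : Trm (trunc X)) → Trm (Id (f x) (g x)))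
    (E : (x : Trm X) → Trm (Id (p (truncMk x)) (q (truncMk x)))) (x : Trm (trunc X)) :
    Trm (Id (p x) (q x)) :=
  truncInd (fun x ↦ Id (p x) (q x))
    (fun x ↦ is1TypeOfIsSet (isSetOfIsProp (h (f x) (g x) (p x) (q x)))) E x

def truncIndIdId := @gl 125 _ _ @truncIndIdIdTm

def tConsTm {A : Ex} (a : Trm A) (x : Trm (free₁ A)) : Trm (free₁ A) :=
  truncInd (fun _ ↦ free₁ A) (fun _ ↦ truncIs) (fun x ↦ truncMk (fCons a x)) x

def tCons := @gl 126 _ _ @tConsTm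

def tIConsTm {A : Ex} (a : Trm A) (x : Trm (free₁ A)) : Trm (free₁ A) :=
  truncInd (fun _ ↦ free₁ A) (fun _ ↦ truncIs) (fun x ↦ truncMk (fICons a x)) x

def tICons := @gl 127 _ _ @tIConsTm

def tMu1Tm {A : Ex} (a : Trm A) (x : Trm (free₁ A)) : Trm (Id (tICons a (tCons a x)) x) :=
  truncIndId truncIs (fun x ↦ tICons a (tCons a x)) (fun x ↦ x)
    (fun x ↦ cv (ap (fun x ↦ truncMk x) (fMu1 a x))) x

def tMu1 := @gl 128 _ _ @tMu1Tm

def tMu2Tm {A : Ex} (a : Trm A) (x : Trm (free₁ A)) : Trm (Id (tCons a (tICons a x)) x) :=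
  truncIndId truncIs (fun x ↦ tCons a (tICons a x)) (fun x ↦ x)
    (fun x ↦ cv (ap (fun x ↦ truncMk x) (fMu2 a x))) x

def tMu2 := @gl 129 _ _ @tMu2Tm

def tMuTm {A : Ex} (a : Trm A) (x : Trm (free₁ A)) :
    Trm (Id (ap (fun x ↦ tCons a x) (tMu1 a x)) (tMu2 a (tCons a x))) :=
  truncIndIdId truncIs (fun x ↦ tCons a (tICons a (tCons a x))) (fun x ↦ tCons a x)
    (fun x ↦ ap (fun x ↦ tCons a x) (tMu1 a x)) (fun x ↦ tMu2 a (tCons a x))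
    (fun x ↦ concat (y := cv (ap (fun x ↦ truncMk (fCons a x)) (fMu1 a x)))
      (cv (apComp (fun x ↦ tCons a x) (fun x ↦ truncMk x) (fMu1 a x)))
      (cv (inverse (apComp (fun x ↦ truncMk x) (fun x ↦ fCons a x) (fMu1 a x)) ⬝
        ap (fun p ↦ ap (fun x ↦ truncMk x) p) (fMu a x)))) x

def tMu := @gl 130 _ _ @tMuTm

def tActTm {A : Ex} (a : Trm (signed A)) (x : Trm (free₁ A)) : Trm (free₁ A) :=
  sumInd (fun _ ↦ free₁ A) (fun a ↦ tCons a x) (fun a ↦ tICons a x) a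

def tAct := @gl 131 _ _ @tActTm

def tCancelTm {A : Ex} (a : Trm (signed A)) (x : Trm (free₁ A)) :
    Trm (Id (tAct a (tAct (inv a) x)) x) :=
  sumInd (fun a ↦ Id (tAct a (tAct (inv a) x)) x) (fun a ↦ cv (tMu2 a x))
    (fun a ↦ cv (tMu1 a x)) a

def tCancel := @gl 132 _ _ @tCancelTm

/-- The element of the free group that a word describes. -/
def foldTm {A : Ex} (x : Trm (words A)) : Trm (free₁ A) :=
  listInd (fun _ ↦ free₁ A) (truncMk fUnit) (fun a _ p ↦ tAct a p) x

def fold := @gl 133 _ _ @foldTm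

/-! ### Cancellation of redexes in the free 1-group -/

def foldTauTm {A : Ex} (x : Trm (words A)) (a : Trm (signed A)) (y : Trm (words A)) :
    Trm (Id (fold (x ⧺ redex a y)) (fold (x ⧺ y))) :=
  listInd (fun x ↦ Id (fold (x ⧺ redex a y)) (fold (x ⧺ y))) (cv (tCancel a (fold y)))
    (fun b _ p ↦ cv (ap (fun x ↦ tAct b x) p)) x

def foldTau := @gl 134 _ _ @foldTauTm

def foldSwTm {A : Ex} (x : Trm (words A)) (a : Trm (signed A)) (y : Trm (words A))
    (b : Trm (signed A)) (z : Trm (words A)) :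
    Trm (Id (swLeft (fun x ↦ fold x) (fun x a y ↦ foldTau x a y) x a y b z)
      (swRight (fun x ↦ fold x) (fun x a y ↦ foldTau x a y) x a y b z)) :=
  listInd (fun x ↦ Id (swLeft (fun x ↦ fold x) (fun x a y ↦ foldTau x a y) x a y b z)
      (swRight (fun x ↦ fold x) (fun x a y ↦ foldTau x a y) x a y b z))
    -- With empty left context the two orders of cancellation form the naturality square of `tCancel
    -- a` along the cancellation of the second redex.
    (cv (contract (fun x ↦ tAct a x) (fun x ↦ tAct (inv a) x) (fun x ↦ tCancel a x)
        (foldTau y b z) ⬝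
      whiskerLeft (ap (fun x ↦ tAct a x) (ap (fun x ↦ tAct (inv a) x) (foldTau y b z)))
        (inverse (concatRefl (tCancel a (fold (y ⧺ z)))))))
    -- A letter in front acts by `ap` on both composites, so the square is the image of the previous
    -- one.
    (fun c x p ↦ cv (
      inverse (swLeftCons (fun x ↦ fold x) (fun x a y ↦ foldTau x a y) c x a y b z) ⬝
      cv (swLeftAp (fun x ↦ tAct c x) (fun x ↦ fold x) (fun x a y ↦ foldTau x a y) x a y b z ⬝
        ap (fun p ↦ ap (fun x ↦ tAct c x) p) p ⬝
        inverse (swRightAp (fun x ↦ tAct c x) (fun x ↦ fold x) (fun x a y ↦ foldTau x a y)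
          x a y b z)) ⬝
      swRightCons (fun x ↦ fold x) (fun x a y ↦ foldTau x a y) c x a y b z)) x

def foldSw := @gl 135 _ _ @foldSwTm

def foldOvTm {A : Ex} (x : Trm (words A)) (a : Trm (signed A)) (y : Trm (words A)) :
    Trm (Id (ovLeft (fun x ↦ fold x) (fun x a y ↦ foldTau x a y) x a y)
      (ovRight (fun x ↦ fold x) (fun x a y ↦ foldTau x a y) x a y)) :=
  listInd (fun x ↦ Id (ovLeft (fun x ↦ fold x) (fun x a y ↦ foldTau x a y) x a y)
      (ovRight (fun x ↦ fold x) (fun x a y ↦ foldTau x a y) x a y))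
    (sumInd (fun a ↦ Id (ovLeft (fun x ↦ fold x) (fun x a y ↦ foldTau x a y) nil a y)
        (ovRight (fun x ↦ fold x) (fun x a y ↦ foldTau x a y) nil a y))
      -- The overlap law depends on the sign: for a positive letter it is the triangle law given by
      -- μ, for a negative one the triangle law with the roles of the two inverse maps exchanged.
      (fun a ↦ cv (inverse (tMu a (fold y)) ⬝
        inverse (concatRefl (ap (fun x ↦ tCons a x) (tMu1 a (fold y))))))
      (fun a ↦ cv (inverse (adjointSymm (fun x ↦ tCons a x) (fun x ↦ tICons a x)
          (fun x ↦ tMu1 a x) (fun x ↦ tMu2 a x) (fun x ↦ tMu a x) (fold y)) ⬝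
        inverse (concatRefl (ap (fun x ↦ tICons a x) (tMu2 a (fold y)))))) a)
    (fun c x p ↦ cv (
      concat (x := cv (ovLeft (fun x ↦ fold x) (fun x a y ↦ foldTau x a y) (cons c x) a y))
        (cv (ap (fun p ↦ ap (fun x ↦ tAct c x) p) p ⬝
          inverse (ovRightAp (fun x ↦ tAct c x) (fun x ↦ fold x) (fun x a y ↦ foldTau x a y)
            x a y)))
        (ovRightCons (fun x ↦ fold x) (fun x a y ↦ foldTau x a y) c x a y))) x

def foldOv := @gl 136 _ _ @foldOvTm

/-! #### The maps between the free 1-group and the approximation -/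

def toFreeTm {A : Ex} (n : Trm (approx A)) : Trm (free₁ A) :=
  approxRec truncIs (fun x ↦ fold x) (fun x a y ↦ foldTau x a y) (fun x a y b z ↦ foldSw x a y b z)
    (fun x a y ↦ foldOv x a y) n

def toFree := @gl 137 _ _ @toFreeTm

def toFreeTauTm {A : Ex} (x : Trm (words A)) (a : Trm (signed A)) (y : Trm (words A)) :
    Trm (Id (ap (fun n ↦ toFree n) (aTau x a y)) (cv (foldTau x a y))) :=
  cv (approxRecTau truncIs (fun x ↦ fold x) (fun x a y ↦ foldTau x a y)
    (fun x a y b z ↦ foldSw x a y b z) (fun x a y ↦ foldOv x a y) x a y)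

def toFreeTau := @gl 138 _ _ @toFreeTauTm

def toFreeConsTauTm {A : Ex} (a : Trm (signed A)) (x : Trm (words A)) (b : Trm (signed A))
    (y : Trm (words A)) :
    Trm (Id (ap (fun n ↦ toFree (aCons a n)) (aTau x b y) ⬝ cv (refl (fold (cons a (x ⧺ y)))))
      (cv (refl (fold (cons a (x ⧺ redex b y)))) ⬝
        ap (fun n ↦ tAct a (toFree n)) (aTau x b y))) :=
  cv (concatRefl (ap (fun n ↦ toFree (aCons a n)) (aTau x b y)) ⬝
    inverse (apComp (fun n ↦ toFree n) (fun n ↦ aCons a n) (aTau x b y)) ⬝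
    ap (fun p ↦ ap (fun n ↦ toFree n) p) (aConsTau a x b y) ⬝
    concat (y := cv (foldTau (cons a x) b y))
      (z := cv (ap (fun n ↦ tAct a (toFree n)) (aTau x b y)))
      (cv (toFreeTau (cons a x) b y))
      (cv (ap (fun p ↦ ap (fun x ↦ tAct a x) p) (inverse (toFreeTau x b y)) ⬝
        apComp (fun x ↦ tAct a x) (fun n ↦ toFree n) (aTau x b y))))

def toFreeConsTau := @gl 139 _ _ @toFreeConsTauTm

/-- On words both sides compute to the same fold, so reflexivity works there; the square at `aTau`
compares the two computations of `foldTau` under one more letter. -/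
def toFreeConsTm {A : Ex} (a : Trm (signed A)) (n : Trm (approx A)) :
    Trm (Id (toFree (aCons a n)) (tAct a (toFree n))) :=
  approxIndId truncIs (fun n ↦ toFree (aCons a n)) (fun n ↦ tAct a (toFree n))
    (fun x ↦ cv (refl (fold (cons a x)))) (fun x b y ↦ cv (toFreeConsTau a x b y)) n

def toFreeCons := @gl 140 _ _ @toFreeConsTm

/-- A proposition, since the target is a 1-type, so words suffice. There the comparison paths
`toFreeCons` are reflexivities and the claim is the computation rule of `toFree` at `aTau` with
empty left context. -/
def toFreeCancelTm {A : Ex} (a : Trm (signed A)) (n : Trm (approx A)) :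
    Trm (Id (ap (fun n ↦ toFree n) (aCancel a n))
      (toFreeCons a (aCons (inv a) n) ⬝ ap (fun x ↦ tAct a x) (toFreeCons (inv a) n) ⬝
        tCancel a (toFree n))) :=
  approxIndProp (fun n ↦ Id (ap (fun n ↦ toFree n) (aCancel a n))
      (toFreeCons a (aCons (inv a) n) ⬝ ap (fun x ↦ tAct a x) (toFreeCons (inv a) n) ⬝
        tCancel a (toFree n)))
    (fun n ↦ truncIs (toFree (aCons a (aCons (inv a) n))) (toFree n)
      (ap (fun n ↦ toFree n) (aCancel a n))
      (toFreeCons a (aCons (inv a) n) ⬝ ap (fun x ↦ tAct a x) (toFreeCons (inv a) n) ⬝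
        tCancel a (toFree n)))
    (fun x ↦ cv (toFreeTau nil a x)) n

def toFreeCancel := @gl 141 _ _ @toFreeCancelTm

def toFreeStepTm {A : Ex} (a : Trm (signed A)) {n : Trm (approx A)} {x : Trm (free₁ A)}
    (p : Trm (Id (toFree n) x)) : Trm (Id (toFree (aCons a n)) (tAct a x)) :=
  toFreeCons a n ⬝ ap (fun x ↦ tAct a x) p

def toFreeStep := @gl 142 _ _ @toFreeStepTm

/-- Cancelling two opposite letters before or after the comparison `p` gives the same path; this is
the square demanded at μ₁ and μ₂. -/
def toFreeStepStepTm {A : Ex} (a : Trm (signed A)) {n : Trm (approx A)} {x : Trm (free₁ A)}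
    (p : Trm (Id (toFree n) x)) :
    Trm (Id (ap (fun n ↦ toFree n) (aCancel a n) ⬝ p)
      (toFreeStep a (toFreeStep (inv a) p) ⬝ tCancel a x)) :=
  cv (squareContract (fun x ↦ tAct a x) (fun x ↦ tAct (inv a) x) (fun x ↦ tCancel a x)
    (toFreeCancel a n) p)

def toFreeStepStep := @gl 143 _ _ @toFreeStepStepTm

def toFreeMu1Tm {A : Ex} (a : Trm A) (x : Trm (free A))
    (p : Trm (Id (toFree (freeToApprox x)) (truncMk x))) :
    Trm (pathOver (fun x ↦ Id (toFree (freeToApprox x)) (truncMk x)) (fMu1 a x)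
      (cv (toFreeStep (inr a) (toFreeStep (inl a) p))) p) :=
  squareOver (f := fun x ↦ toFree (freeToApprox x)) (g := fun x ↦ truncMk x) (fMu1 a x)
    (whiskerRight (inverse (apComp (fun n ↦ toFree n) (fun x ↦ freeToApprox x) (fMu1 a x)) ⬝
      ap (fun p ↦ ap (fun n ↦ toFree n) p) (freeToApproxMu1 a x)) p ⬝
        cv (toFreeStepStep (inr a) p))

def toFreeMu1 := @gl 144 _ _ @toFreeMu1Tm

def toFreeMu2Tm {A : Ex} (a : Trm A) (x : Trm (free A))
    (p : Trm (Id (toFree (freeToApprox x)) (truncMk x))) :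
    Trm (pathOver (fun x ↦ Id (toFree (freeToApprox x)) (truncMk x)) (fMu2 a x)
      (cv (toFreeStep (inl a) (toFreeStep (inr a) p))) p) :=
  squareOver (f := fun x ↦ toFree (freeToApprox x)) (g := fun x ↦ truncMk x) (fMu2 a x)
    (whiskerRight (inverse (apComp (fun n ↦ toFree n) (fun x ↦ freeToApprox x) (fMu2 a x)) ⬝
      ap (fun p ↦ ap (fun n ↦ toFree n) p) (freeToApproxMu2 a x)) p ⬝
        cv (toFreeStepStep (inl a) p))

def toFreeMu2 := @gl 145 _ _ @toFreeMu2Tm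

/-- The family consists of sets, so no condition over μ arises and the squares over μ₁ and μ₂
suffice. -/
def toFreeFreeToApproxTm {A : Ex} (x : Trm (free A)) :
    Trm (Id (toFree (freeToApprox x)) (truncMk x)) :=
  freeIndSet (fun x ↦ Id (toFree (freeToApprox x)) (truncMk x))
    (fun x ↦ truncIs (toFree (freeToApprox x)) (truncMk x))
    (cv (refl (truncMk (fUnit (A := A))))) (fun a x p ↦ cv (toFreeStep (inl a) p))
    (fun a x p ↦ cv (toFreeStep (inr a) p)) (fun a x p ↦ cv (toFreeMu1 a x p))
    (fun a x p ↦ cv (toFreeMu2 a x p)) x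

def toFreeFreeToApprox := @gl 146 _ _ @toFreeFreeToApproxTm

def toApproxTm {A : Ex} (x : Trm (free₁ A)) : Trm (approx A) :=
  truncInd (fun _ ↦ approx A) (fun _ ↦ aTr) (fun x ↦ freeToApprox x) x

def toApprox := @gl 147 _ _ @toApproxTm

def toFreeToApproxTm {A : Ex} (x : Trm (free₁ A)) : Trm (Id (toFree (toApprox x)) x) :=
  truncIndId truncIs (fun x ↦ toFree (toApprox x)) (fun x ↦ x)
    (fun x ↦ cv (toFreeFreeToApprox x)) x

def toFreeToApprox := @gl 148 _ _ @toFreeToApproxTm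

/-! ### The composite on the approximation -/

def toApproxActTm {A : Ex} (a : Trm (signed A)) (x : Trm (free₁ A)) :
    Trm (Id (toApprox (tAct a x)) (aCons a (toApprox x))) :=
  sumInd (fun a ↦ Id (toApprox (tAct a x)) (aCons a (toApprox x)))
    (fun a ↦ truncIndId aTr (fun x ↦ toApprox (tAct (inl a) x))
      (fun x ↦ aCons (inl a) (toApprox x)) (fun x ↦ cv (refl (freeToApprox (fCons a x)))) x)
    (fun a ↦ truncIndId aTr (fun x ↦ toApprox (tAct (inr a) x))
      (fun x ↦ aCons (inr a) (toApprox x)) (fun x ↦ cv (refl (freeToApprox (fICons a x)))) x) a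

def toApproxAct := @gl 149 _ _ @toApproxActTm

abbrev ToApproxCancel {A : Ex} (a : Trm (signed A)) (x : Trm (free₁ A)) : Type :=
  Trm (Id (ap (fun x ↦ toApprox x) (tCancel a x))
    (toApproxAct a (tAct (inv a) x) ⬝ ap (fun n ↦ aCons a n) (toApproxAct (inv a) x) ⬝
      aCancel a (toApprox x)))

def toApproxCancelTm {A : Ex} (a : Trm (signed A)) (x : Trm (free₁ A)) : ToApproxCancel a x :=
  sumInd (fun a ↦ El (ToApproxCancel a x))
    -- On elements coming from the free ∞-group the comparison paths compute to reflexivities, and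
    -- what remains is the computation rule of `freeToApprox` at μ₂ for a positive letter and at μ₁
    -- for a negative one.
    (fun a ↦ truncIndIdId aTr
      (fun x ↦ toApprox (tAct (inl a) (tAct (inv (inl a)) x))) (fun x ↦ toApprox x)
      (fun x ↦ ap (fun x ↦ toApprox x) (tCancel (inl a) x))
      (fun x ↦ toApproxAct (inl a) (tAct (inv (inl a)) x) ⬝
        ap (fun n ↦ aCons (inl a) n) (toApproxAct (inv (inl a)) x) ⬝ aCancel (inl a) (toApprox x))
      (fun x ↦ concat (y := cv (ap (fun x ↦ freeToApprox x) (fMu2 a x)))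
        (cv (apComp (fun x ↦ toApprox x) (fun x ↦ truncMk x) (fMu2 a x)))
        (cv (freeToApproxMu2 a x))) x |> cv)
    (fun a ↦ truncIndIdId aTr
      (fun x ↦ toApprox (tAct (inr a) (tAct (inv (inr a)) x))) (fun x ↦ toApprox x)
      (fun x ↦ ap (fun x ↦ toApprox x) (tCancel (inr a) x))
      (fun x ↦ toApproxAct (inr a) (tAct (inv (inr a)) x) ⬝
        ap (fun n ↦ aCons (inr a) n) (toApproxAct (inv (inr a)) x) ⬝ aCancel (inr a) (toApprox x))
      (fun x ↦ concat (y := cv (ap (fun x ↦ freeToApprox x) (fMu1 a x)))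
        (cv (apComp (fun x ↦ toApprox x) (fun x ↦ truncMk x) (fMu1 a x)))
        (cv (freeToApproxMu1 a x))) x |> cv) a |> cv

def toApproxCancel := @gl 150 _ _ @toApproxCancelTm

def toApproxFoldTm {A : Ex} (x : Trm (words A)) : Trm (Id (toApprox (fold x)) (aEta x)) :=
  listInd (fun x ↦ Id (toApprox (fold x)) (aEta x)) (cv (refl (aEta (A := A) nil)))
    (fun a x p ↦ cv (toApproxAct a (fold x) ⬝ ap (fun n ↦ aCons a n) p)) x

def toApproxFold := @gl 151 _ _ @toApproxFoldTm

/-- Naturality of `toApproxFold` at a redex: with empty left context it follows from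
`toApproxCancel`, and each letter in front is handled by `squareStep`. -/
def toApproxFoldTauTm {A : Ex} (x : Trm (words A)) (a : Trm (signed A)) (y : Trm (words A)) :
    Trm (Id (ap (fun x ↦ toApprox x) (foldTau x a y) ⬝ toApproxFold (x ⧺ y))
      (toApproxFold (x ⧺ redex a y) ⬝ aTau x a y)) :=
  listInd (fun x ↦ Id (ap (fun x ↦ toApprox x) (foldTau x a y) ⬝ toApproxFold (x ⧺ y))
      (toApproxFold (x ⧺ redex a y) ⬝ aTau x a y))
    (cv (squareContract (fun n ↦ aCons a n) (fun n ↦ aCons (inv a) n) (fun n ↦ aCancel a n)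
      (toApproxCancel a (fold y)) (toApproxFold y)))
    (fun b x p ↦ cv (squareStep (fun x ↦ toApprox x) (fun x ↦ tAct b x) (fun n ↦ aCons b n)
      (fun x ↦ toApproxAct b x) (foldTau x a y) p (aConsTau b x a y))) x

def toApproxFoldTau := @gl 152 _ _ @toApproxFoldTauTm

def toApproxToFreeTm {A : Ex} (n : Trm (approx A)) : Trm (Id (toApprox (toFree n)) n) :=
  approxIndId aTr (fun n ↦ toApprox (toFree n)) (fun n ↦ n) (fun x ↦ cv (toApproxFold x))
    (fun x a y ↦ whiskerRight
        (inverse (apComp (fun x ↦ toApprox x) (fun n ↦ toFree n) (aTau x a y)) ⬝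
          ap (fun p ↦ ap (fun x ↦ toApprox x) p) (toFreeTau x a y)) (cv (toApproxFold (x ⧺ y))) ⬝
      cv (toApproxFoldTau x a y ⬝ whiskerLeft (toApproxFold (x ⧺ redex a y))
        (inverse (apId (aTau x a y))))) n

def toApproxToFree := @gl 153 _ _ @toApproxToFreeTm

/-! #### Equivalences -/

def adjustTm {X Y : Ex} (f : Trm X → Trm Y) (g : Trm Y → Trm X)
    (h : (x : Trm X) → Trm (Id (g (f x)) x)) (k : (y : Trm Y) → Trm (Id (f (g y)) y))
    (y : Trm Y) : Trm (Id (f (g y)) y) :=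
  inverse (k (f (g y))) ⬝ ap f (h (g y)) ⬝ k y

/-- A homotopy that satisfies the triangle law together with `h`. -/
def adjust := @gl 154 _ _ @adjustTm

/-- Insert `k (f (g (f x)))` and its inverse, move `ap f (h x)` past the former by naturality of
`k`, and replace `ap g (ap f (h x))` by `h (g (f x))`; the outcome is the definition of `adjust`. -/
def adjustTriangleTm {X Y : Ex} (f : Trm X → Trm Y) (g : Trm Y → Trm X)
    (h : (x : Trm X) → Trm (Id (g (f x)) x)) (k : (y : Trm Y) → Trm (Id (f (g y)) y))
    (x : Trm X) : Trm (Id (ap f (h x)) (adjust f g h k (f x))) :=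
  cv (inverse (inverseConcatConcat (k (f (g (f x)))) (ap f (h x))) ⬝
    whiskerLeft (inverse (k (f (g (f x))))) (contract f g k (ap f (h x)) ⬝
      whiskerRight (ap (fun p ↦ ap f p) (inverse (contractSelf g f h x))) (k (f x))))

def adjustTriangle := @gl 155 _ _ @adjustTriangleTm

/-- The type of homotopies from `fun x ↦ g (f x)` to the identity. -/
abbrev Retracts {X Y : Ex} (f : Trm X → Trm Y) (g : Trm Y → Trm X) : Ex :=
  El ((x : Trm X) → Trm (Id (g (f x)) x))

/-- Here `ap` is spelled out as a path induction: a global reference would be read through the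
values `ρ`, whereas the final type has to coincide literally with the statement. -/
abbrev Triangle {X Y : Ex} (f : Trm X → Trm Y) (g : Trm Y → Trm X) (h : Trm (Retracts f g))
    (k : Trm (Retracts g f)) : Ex :=
  El ((x : Trm X) → Trm (Id (idInd (fun x y _ ↦ Id (f x) (f y)) (fun x ↦ refl (f x)) (ofEl h x))
    (ofEl k (f x))))

abbrev IsEquiv {X Y : Ex} (f : Trm X → Trm Y) : Ex :=
  sigma (El (Trm Y → Trm X)) fun g ↦ sigma (Retracts f (ofEl g)) fun h ↦
    sigma (Retracts (ofEl g) f) fun k ↦ Triangle f (ofEl g) h k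

abbrev Equiv (X Y : Ex) : Ex := sigma (El (Trm X → Trm Y)) fun f ↦ IsEquiv (ofEl f)

def equivOfTm {X Y : Ex} (f : Trm X → Trm Y) (g : Trm Y → Trm X)
    (h : (x : Trm X) → Trm (Id (g (f x)) x)) (k : (y : Trm Y) → Trm (Id (f (g y)) y)) :
    Trm (Equiv X Y) :=
  pair (fun f ↦ IsEquiv (ofEl f)) (toEl f) (cv (
    pair (fun g ↦ sigma (Retracts f (ofEl g)) fun h ↦ sigma (Retracts (ofEl g) f) fun k ↦
      Triangle f (ofEl g) h k) (toEl g) (cv (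
      pair (fun h ↦ sigma (Retracts g f) fun k ↦ Triangle f g h k) (toEl h) (cv (
        pair (fun k ↦ Triangle f g (toEl h) k) (toEl (adjust f g h k)) (cv (toEl (
          adjustTriangle f g h k)))))))))

def equivOf := @gl 156 _ _ @equivOfTm

def free₁EquivApproxTm (A : Ex) (_ : IsSet A) : Trm (Equiv (free₁ A) (approx A)) :=
  equivOf (fun x ↦ toApprox x) (fun n ↦ toFree n) (fun x ↦ toFreeToApprox x)
    (fun n ↦ toApproxToFree n)

/-- The global definitions, in order. -/
def env : List Entry := [
  primEntry .id @IdP, primEntry .refl @refl, primEntry .idInd @idInd, defEntry @transportTm,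
  defEntry @concatTm, defEntry @inverseTm, defEntry @apTm, defEntry @pathOverTm, defEntry @apdTm,
  defEntry @concatOverTm, defEntry @apOverTm, primEntry .sigma @sigma, primEntry .pair @pair,
  primEntry .sum @sum, primEntry .inl @inl, primEntry .inr @inr, primEntry .sumInd @sumInd,
  primEntry .list @list, primEntry .nil @nil, primEntry .cons @cons, primEntry .listInd @listInd,
  primEntry (.trunc 2) @trunc, primEntry (.truncMk 2) @truncMk, primEntry (.truncIs 2) @truncIs,
  primEntry (.truncInd 2) @truncInd, defEntry @invTm, defEntry @invInvTm, defEntry @appendTm,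
  defEntry @assocTm, defEntry @assocInvTm, defEntry @redexTm, defEntry @insTm,
  primEntry .free @free, primEntry .fUnit @fUnit, primEntry .fCons @fCons,
  primEntry .fICons @fICons, primEntry .fMu1 @fMu1, primEntry .fMu2 @fMu2, primEntry .fMu @fMu,
  defEntry @transportMuTm, primEntry .freeInd @freeInd, primEntry .freeIndMu1 @freeIndMu1,
  primEntry .freeIndMu2 @freeIndMu2, defEntry @swLeftTm, defEntry @swRightTm, defEntry @ovLeftTm,
  defEntry @ovRightTm, primEntry .approx @approx, primEntry .aEta @aEta, primEntry .aTau @aTau,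
  primEntry .aSw @aSw, primEntry .aOv @aOv, primEntry .aTr @aTr, defEntry @wordOverTm,
  defEntry @swLeftOverTm, defEntry @swRightOverTm, defEntry @ovLeftOverTm,
  defEntry @ovRightOverTm, primEntry .approxInd @approxInd,
  primEntry .approxIndTau @approxIndTau, defEntry @concatReflTm, defEntry @concatAssocTm,
  defEntry @whiskerLeftTm, defEntry @whiskerRightTm, defEntry @cancelLeftTm,
  defEntry @apConcatTm, defEntry @apCompTm, defEntry @apIdTm, defEntry @isSetOfIsPropTm,
  defEntry @is1TypeOfIsSetTm, defEntry @constOverTm, defEntry @constOverInjTm,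
  defEntry @apdConstTm, defEntry @concatOverConstTm, defEntry @concatOverEqTm,
  defEntry @constOverOverTm, defEntry @apOverConstTm, defEntry @wordOverConstTm,
  defEntry @freeRecMuTm, defEntry @freeRecTm, defEntry @freeRecMu1Tm, defEntry @freeRecMu2Tm,
  defEntry @freeIndSetTm, defEntry @swLeftConstTm, defEntry @swRightConstTm,
  defEntry @ovLeftConstTm, defEntry @ovRightConstTm, defEntry @approxRecSwTm,
  defEntry @approxRecOvTm, defEntry @approxRecTm, defEntry @approxRecTauTm,
  defEntry @swOverOfIsSetTm, defEntry @ovOverOfIsSetTm, defEntry @approxIndSetTm,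
  defEntry @approxIndPropTm, defEntry @squareOverTm, defEntry @approxIndIdTm,
  defEntry @concatCongrTm, defEntry @concatApTm, defEntry @inverseConcatConcatTm,
  defEntry @cancelRightTm, defEntry @contractTm, defEntry @contractSelfTm,
  defEntry @adjointSymmTm, defEntry @squareContractTm, defEntry @squareStepTm,
  defEntry @apConsTm, defEntry @apConsInverseTm, defEntry @swLeftConsTm, defEntry @swRightConsTm,
  defEntry @ovRightConsTm, defEntry @swLeftApTm, defEntry @swRightApTm, defEntry @ovRightApTm,
  defEntry @aConsSwTm, defEntry @aConsOvTm, defEntry @aConsTm, defEntry @aConsTauTm,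
  defEntry @aCancelTauTm, defEntry @aCancelTm, defEntry @aCancelConsTm, defEntry @freeToApproxTm,
  defEntry @freeToApproxMu1Tm, defEntry @freeToApproxMu2Tm, defEntry @truncIndIdTm,
  defEntry @truncIndIdIdTm, defEntry @tConsTm, defEntry @tIConsTm, defEntry @tMu1Tm,
  defEntry @tMu2Tm, defEntry @tMuTm, defEntry @tActTm, defEntry @tCancelTm, defEntry @foldTm,
  defEntry @foldTauTm, defEntry @foldSwTm, defEntry @foldOvTm, defEntry @toFreeTm,
  defEntry @toFreeTauTm, defEntry @toFreeConsTauTm, defEntry @toFreeConsTm,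
  defEntry @toFreeCancelTm, defEntry @toFreeStepTm, defEntry @toFreeStepStepTm,
  defEntry @toFreeMu1Tm, defEntry @toFreeMu2Tm, defEntry @toFreeFreeToApproxTm,
  defEntry @toApproxTm, defEntry @toFreeToApproxTm, defEntry @toApproxActTm,
  defEntry @toApproxCancelTm, defEntry @toApproxFoldTm, defEntry @toApproxFoldTauTm,
  defEntry @toApproxToFreeTm, defEntry @adjustTm, defEntry @adjustTriangleTm,
  defEntry @equivOfTm, defEntry @free₁EquivApproxTm]

/-- The positions of the constants in the list of global definitions. -/
def constIdx : Const → ℕ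
  | .id => 0
  | .refl => 1
  | .idInd => 2
  | .sigma => 11
  | .pair => 12
  | .sum => 13
  | .inl => 14
  | .inr => 15
  | .sumInd => 16
  | .list => 17
  | .nil => 18
  | .cons => 19
  | .listInd => 20
  | .trunc _ => 21
  | .truncMk _ => 22
  | .truncIs _ => 23
  | .truncInd _ => 24
  | .free => 32
  | .fUnit => 33
  | .fCons => 34
  | .fICons => 35
  | .fMu1 => 36
  | .fMu2 => 37
  | .fMu => 38
  | .freeInd => 40
  | .freeIndMu1 => 41
  | .freeIndMu2 => 42
  | .approx => 47
  | .aEta => 48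
  | .aTau => 49
  | .aSw => 50
  | .aOv => 51
  | .aTr => 52
  | .approxInd => 58
  | .approxIndTau => 59
  -- The default is harmless, because `constType` compares the constant found at the position with
  -- the one sought.
  | _ => 0

end Syn

end

/-! ### The result of the type checker -/

namespace Syn

set_option maxRecDepth 100000 in
-- Here the whole argument inside the type theory is verified, by kernel evaluation of the checker
-- on all 158 entries.
theorem okRange_env : okRange env constIdx 500 0 158 = true := by decide +kernel

theorem ok_env (N : ℕ) (e : Entry) (h : env[N]? = some e) : e.ok env constIdx 500 N = true := by
  have hN : N < 158 := (List.getElem?_eq_some_iff.1 h).1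
  exact ok_of_okRange 158 okRange_env N e (Nat.zero_le N) (by omega) h

theorem den_free₁EquivApprox (ρ : ℕ → Tm) (i : ℕ) :
    Core.den ρ i (defEntry @free₁EquivApproxTm).getTy =
      (Expr.pi (Expr.univ i) fun A ↦ .arr (.isSet A)
        (.equiv (.oneTrunc (.free A)) (.approx A))).toTm := by
  -- The type contains no global references, so its reading does not depend on `ρ`; the irreducible
  -- `Id` has to be unfolded.
  with_unfolding_all rfl

end Syn

end BookHoTT

/-! ### The main theorem -/

open BookHoTT BookHoTT.Expr in
theorem mainTheorem2 (i : ℕ) :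
    Provable (pi (univ i) fun A ↦ isSet A ⇒ equiv (oneTrunc (free A)) (approx A)) := by
  obtain ⟨ρ, hρ⟩ := Core.EnvOK.exists_of_ok Syn.ok_env i 158
  -- Index 157 is the last entry of `env`, the equivalence itself, with all definitions expanded at
  -- base level `i`.
  refine ⟨ρ 157, ?_⟩
  rw [← Syn.den_free₁EquivApprox ρ i]
  exact hρ.hasType (n := 157) rfl
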